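/- **Conventions.** Quantum circuits are over the universal gate set $\{H, T, \mathrm{CNOT}\}$, with ancillas initialised to $|0\rangle$; the depth is the number of layers of gates acting on disjoint qubits. For a function $B:\mathbb N\to\mathbb N$, a family is *efficiently uniform relative to $B$* if one classical program outputs the description of its $n$-th member on input $1^n$ in time polynomial in $B(n)$. **Puzzle.** Let $s,d:\mathbb N\to\mathbb N$ with $s(n)=\Omega(n)$ and $d$ non-decreasing. An $(s,d)$-iterated parallel-hard puzzle consists, for every security parameter $n$, of sets $\hat X_n\subseteq X_n\subseteq\{0,1\}^n$ with $|\hat X_n|=2^{\Theta(n)}$ and a map $g_n:X_n\to X_n$, with $f(k,x)=g_n^{(k)}(x)$, such that * for $n\ge 1$, $g_n$ is computed with probability one by a quantum circuit $C^g_n$ on $n$ qubits with $s(n)$ gates, and $(C^g_n)_n$ is efficiently uniform relative to $n+s(n)$; * for all $k=k(n)$ and $K=K(n)$ of size $2^{o(n)}$ and every family of circuits $(C_n)$ that is efficiently uniform relative to $n+s(n)+k+d(k)$ (in particular $C_n$ has size polynomial in these parameters), for every $e\in\mathbb N$ and all sufficiently large $n$: if $\mathrm{depth}(C_n)<d(k(n))$,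 then $$\Pr_{x\leftarrow\hat X_n}\bigl[C_n(x)=f(k',x)\text{ for some } k(n)/2\le k'\le K(n)\bigr]\le n^{-e}.$$ **Theorem.** Assume an $(s,d)$-iterated parallel-hard puzzle, let $T\ne 0$ be a polynomial with coefficients in $\mathbb N$, and let $c\ge 1$ be an integer constant. Put $L(n)=2s(n)T(n)$ and $m(n)=\lfloor L(n)^{1/c}\rfloor$. There are time-independent Hamiltonians $H_n$ on $n+m(n)$ qubits given by the Feynman–Nagaj construction $$H_n=\sum_{j=1}^{L(n)}\Bigl(U_j\otimes|\gamma_j\rangle\langle\gamma_{j-1}|+U_j^\dagger\otimes|\gamma_{j-1}\rangle\langle\gamma_j|\Bigr)\qquad(n\ge1),$$ where $U_1,\dots,U_{L(n)}$ are the gates of $2T(n)$ consecutive copies of $C^g_n$, each clock state $|\gamma_j\rangle$ is the $m(n)$-qubit basis state with ones exactly on a set $\gamma_j$, and the transition $|\gamma_{j}\rangle\langle\gamma_{j-1}|$ is implemented by the tensor product of $|1\rangle\langle1|$ on $\gamma_{j-1}\cap\gamma_j$, $|1\rangle\langle0|$ on $\gamma_j\setminus\gamma_{j-1}$, $|0\rangle\langle1|$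 on $\gamma_{j-1}\setminus\gamma_j$, and the identity on all other clock qubits. The list of clock states is efficiently uniform relative to $n+s(n)$. For all sufficiently large $n$, $\gamma_0,\dots,\gamma_{L(n)}$ are the first $L(n)+1$ vertices of a Hamiltonian path of the Johnson graph of $(c+1)$-subsets of an $m(n)$-set, and $H_n$ is $(c+4)$-local: a sum of Hermitian terms of operator norm at most $1$, each acting on at most $c+4$ qubits. Moreover there is a constant $A$ (not depending on the evolution time, the error or the simulator) such that the following holds. Let $t(n)\in[0,s(n)T(n)]$ and $\epsilon(n)<1/4$, let $k(n)=\lfloor t(n)/2s(n)\rfloor$, and let $(C_n)$ be any family of circuits on the $n+m(n)$ qubits of $H_n$ and some ancillas that is efficiently uniform relative to $n+s(n)+k(n)+d(k(n))$. Then for all sufficiently large $n$: if $C_n$ simulates $H_n$ for time $t(n)$ with error $\epsilon(n)$, that is, for every initial state $|\psi\rangle$ its output (ancillas traced out) is within trace distance $\epsilon(n)$ of $e^{-iH_nt(n)}|\psi\rangle$, then $$\mathrm{depth}(C_n)\ \ge\ d\!\left(\left\lfloor \frac{t(n)}{2s(n)}\right\rfloor\right)-A\,s(n).$$ -/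

import Mathlib

open Filter Topology
open scoped MatrixOrder

/-! ### Polynomial-time generation

A machine model with a step count: programs over binary trees (a first-order Lisp machine with
`nil`, `cons`, `car`, `cdr`, a conditional and a while loop). Every step is a bounded number of
pointer operations, so polynomially many steps (with an output of polynomial size) is polynomial
time on a Turing machine, and conversely. -/

/-- Binary trees, the data of the machine. -/
inductive Tree₂ : Type
  | leaf : Tree₂
  | node : Tree₂ → Tree₂ → Tree₂

namespace Tree₂

/-- Number of nodes and leaves. -/
def size : Tree₂ → ℕ
  | leaf => 1
  | node l r => l.size + r.size + 1

/-- Unary numerals. -/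
def ofNat : ℕ → Tree₂
  | 0 => leaf
  | k + 1 => node leaf (ofNat k)

/-- Lists, given an encoding of the entries. -/
def ofList {α : Type} (enc : α → Tree₂) : List α → Tree₂
  | [] => leaf
  | a :: l => node (enc a) (ofList enc l)

/-- The left component (`car`). -/
def fst : Tree₂ → Tree₂
  | leaf => leaf
  | node l _ => l

/-- The right component (`cdr`). -/
def snd : Tree₂ → Tree₂
  | leaf => leaf
  | node _ r => r

end Tree₂

/-- Programs, transforming one tree into another. `branch p q` runs `q` if the left component of
the current tree is a leaf and `p` otherwise; `loop p` repeats `p` as long as the left component of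
the current tree is not a leaf. -/
inductive TreeProg : Type
  | skip : TreeProg
  | leaf : TreeProg
  | fst : TreeProg
  | snd : TreeProg
  | pair : TreeProg → TreeProg → TreeProg
  | comp : TreeProg → TreeProg → TreeProg
  | branch : TreeProg → TreeProg → TreeProg
  | loop : TreeProg → TreeProg

/-- `p.Runs x y t`: on input `x` the program `p` halts with output `y` after `t` steps. -/
inductive TreeProg.Runs : TreeProg → Tree₂ → Tree₂ → ℕ → Prop
  | skip (x : Tree₂) : Runs .skip x x 1
  | leaf (x : Tree₂) : Runs .leaf x .leaf 1
  | fst (x : Tree₂) : Runs .fst x x.fst 1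
  | snd (x : Tree₂) : Runs .snd x x.snd 1
  | pair {p q : TreeProg} {x y z : Tree₂} {t u : ℕ} :
      Runs p x y t → Runs q x z u → Runs (.pair p q) x (.node y z) (t + u + 1)
  | comp {p q : TreeProg} {x y z : Tree₂} {t u : ℕ} :
      Runs q x y t → Runs p y z u → Runs (.comp p q) x z (t + u + 1)
  | branch_true {p q : TreeProg} {x y : Tree₂} {t : ℕ} :
      x.fst ≠ .leaf → Runs p x y t → Runs (.branch p q) x y (t + 1)
  | branch_false {p q : TreeProg} {x y : Tree₂} {t : ℕ} :
      x.fst = .leaf → Runs q x y t → Runs (.branch p q) x y (t + 1)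
  | loop_done {p : TreeProg} {x : Tree₂} : x.fst = .leaf → Runs (.loop p) x x 1
  | loop_step {p : TreeProg} {x y z : Tree₂} {t u : ℕ} :
      x.fst ≠ .leaf → Runs p x y t → Runs (.loop p) y z u → Runs (.loop p) x z (t + u + 1)

/-- One program maps `1ⁿ` to `F n`, for every `n`, in time (and with an output of size)
polynomial in `B n`. -/
def PolyTimeGenerated (B : ℕ → ℕ) (F : ℕ → Tree₂) : Prop :=
  ∃ (p : TreeProg) (P : Polynomial ℕ), ∀ n, ∃ t, p.Runs (Tree₂.ofNat n) (F n) t ∧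
    t ≤ P.eval (B n) ∧ (F n).size ≤ P.eval (B n)

/-! ### Quantum circuits -/

/-- Computational basis states of `N` qubits. -/
abbrev Bits (N : ℕ) : Type := Fin N → Bool

/-- Operators on `N` qubits, in the computational basis. -/
abbrev QOp (N : ℕ) : Type := Matrix (Bits N) (Bits N) ℂ

/-- The universal gate set: Hadamard, `T = diag(1, e^{iπ/4})`, and controlled-NOT. -/
inductive QGate (N : ℕ) : Type
  | had (q : Fin N) : QGate N
  | tee (q : Fin N) : QGate N
  | cnot (c t : Fin N) (hne : c ≠ t) : QGate N

namespace QGate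

variable {N : ℕ}

/-- The qubits a gate acts on. -/
def wires : QGate N → Finset (Fin N)
  | had q => {q}
  | tee q => {q}
  | cnot c t _ => {c, t}

/-- The operator `u` on qubit `q`, the identity on all other qubits. -/
def onQubit (q : Fin N) (u : Matrix Bool Bool ℂ) : QOp N :=
  Matrix.of fun x y => if ∀ i, i ≠ q → x i = y i then u (x q) (y q) else 0

/-- The unitary of a gate. -/
noncomputable def op : QGate N → QOp N
  | had q => onQubit q (Matrix.of fun b b' => (if b && b' then -1 else 1) / (Real.sqrt 2 : ℂ))
  | tee q => onQubit q
      (Matrix.diagonal fun b => if b then Complex.exp (Complex.I * Real.pi / 4) else 1)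
  | cnot c t _ => Matrix.of fun x y => if x = Function.update y t (xor (y t) (y c)) then 1 else 0

/-- The description of a gate: its kind and its wires. -/
def toTree : QGate N → Tree₂
  | had q => .node (.ofNat 0) (.ofNat q)
  | tee q => .node (.ofNat 1) (.ofNat q)
  | cnot c t _ => .node (.ofNat 2) (.node (.ofNat c) (.ofNat t))

end QGate

/-- A quantum circuit on `N` qubits: a sequence of layers; the gates of a layer act on disjoint
qubits. -/
structure QCircuit (N : ℕ) where
  layers : List (List (QGate N))
  disjoint : ∀ l ∈ layers, l.Pairwise fun a b => Disjoint a.wires b.wires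

namespace QCircuit

variable {N : ℕ}

/-- Number of layers. -/
def depth (C : QCircuit N) : ℕ := C.layers.length

/-- The gates, in order of application. -/
def gates (C : QCircuit N) : List (QGate N) := C.layers.flatten

/-- Number of gates. -/
def size (C : QCircuit N) : ℕ := C.gates.length

/-- The unitary `U_L ⋯ U_1` of the circuit. -/
noncomputable def op (C : QCircuit N) : QOp N := (C.gates.reverse.map QGate.op).prod

/-- The description of a circuit: its width and its layers. -/
def toTree (C : QCircuit N) : Tree₂ :=
  .node (.ofNat N) (.ofList (.ofList QGate.toTree) C.layers)

/-- Probability that, on input `x` (with ancillas `0`), measuring the first `N` qubits in the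
computational basis yields `y`. -/
noncomputable def outputProb {a : ℕ} (C : QCircuit (N + a)) (x y : Bits N) : ℝ :=
  ∑ w : Bits a, ‖C.op (Fin.append y w) (Fin.append x fun _ => false)‖ ^ 2

end QCircuit

/-- A uniform family of circuits: a program outputs the description of the `n`-th circuit on input
`1ⁿ` in time polynomial in `B n`. In particular the circuits have size polynomial in `B n`. -/
def UniformFamily (B : ℕ → ℕ) {W : ℕ → ℕ} (C : ∀ n, QCircuit (W n)) : Prop :=
  PolyTimeGenerated B fun n => (C n).toTree

/-! ### Iterated parallel-hard puzzles -/

/-- A function `f(k, x) = g^(k)(x)`, whose step function `g` is computed by quantum circuits of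
width `n` and size `s(n)`; here `n` is the security parameter. -/
structure IteratedFunction (s : ℕ → ℕ) where
  /-- The set `X` on which `g` acts. -/
  X : ∀ n, Finset (Bits n)
  /-- The set `X̂` of initial inputs. -/
  Xhat : ∀ n, Finset (Bits n)
  Xhat_subset : ∀ n, Xhat n ⊆ X n
  Xhat_card : ∃ a b : ℝ, 0 < a ∧ 0 < b ∧ ∀ᶠ n : ℕ in atTop,
    (2 : ℝ) ^ (a * n) ≤ (Xhat n).card ∧ ((Xhat n).card : ℝ) ≤ (2 : ℝ) ^ (b * n)
  g : ∀ n, Bits n → Bits n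
  g_mem : ∀ n, ∀ x ∈ X n, g n x ∈ X n
  circuit : ∀ n, QCircuit n
  circuit_uniform : UniformFamily (fun n => n + s n) circuit
  circuit_size : ∀ n, 0 < n → (circuit n).size = s n
  /-- On input `x` the circuit outputs `g(x)` with probability one. -/
  circuit_computes : ∀ n, 0 < n → ∀ x ∈ X n, ‖(circuit n).op (g n x) x‖ ^ 2 = 1
  s_linear : ∃ a : ℝ, 0 < a ∧ ∀ᶠ n : ℕ in atTop, a * n ≤ s n

namespace IteratedFunction

variable {s : ℕ → ℕ}

/-- `f(k, x) = g^(k)(x)`. -/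
def f (F : IteratedFunction s) (n k : ℕ) (x : Bits n) : Bits n := (F.g n)^[k] x

open Classical in
/-- Probability, over a uniform `x ∈ X̂`, that `C(x) = f(k', x)` for some `k'` with
`k / 2 ≤ k' ≤ K`. -/
noncomputable def successProb (F : IteratedFunction s) {n a : ℕ} (C : QCircuit (n + a))
    (k K : ℕ) : ℝ :=
  (∑ x ∈ F.Xhat n,
    ∑ y with ∃ k' : ℕ, k ≤ 2 * k' ∧ k' ≤ K ∧ y = F.f n k' x, C.outputProb x y) /
      (F.Xhat n).card

end IteratedFunction

/-- `k = 2^{o(n)}`. -/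
def Subexponential (k : ℕ → ℕ) : Prop :=
  (fun n => Real.logb 2 (k n)) =o[atTop] fun n : ℕ => (n : ℝ)

/-- `f` is an `(s, d)`-iterated parallel-hard puzzle: for all `k = 2^{o(n)}`, circuits from an
efficient uniform family with depth less than `d(k)` output some `f(k', x)` with `k' ≥ k / 2` only
with negligible probability. Iteration counts range over `2^{o(n)}` throughout, so `k'` too is
bounded by some `K = 2^{o(n)}`: if `g` is a permutation, then the input `x` itself equals
`f(k', x)` for some exponentially large `k'`. -/
def IteratedFunction.IsParallelHardPuzzle {s : ℕ → ℕ} (F : IteratedFunction s) (d : ℕ → ℕ) :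
    Prop :=
  Monotone d ∧
  ∀ k K : ℕ → ℕ, Subexponential k → Subexponential K →
  ∀ (a : ℕ → ℕ) (C : ∀ n, QCircuit (n + a n)),
    UniformFamily (fun n => n + s n + k n + d (k n)) C →
    ∀ e : ℕ, ∀ᶠ n : ℕ in atTop,
      (C n).depth < d (k n) → F.successProb (C n) (k n) (K n) ≤ 1 / (n : ℝ) ^ e

/-! ### Hamiltonians and their simulation -/

/-- `h` acts as the identity outside the set `Q` of qubits. -/
def ActsOn {N : ℕ} (Q : Finset (Fin N)) (h : QOp N) : Prop :=
  ∃ u : Matrix (Q → Bool) (Q → Bool) ℂ, h = Matrix.of fun x y =>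
    if ∀ i, i ∉ Q → x i = y i then u (fun i => x i) (fun i => y i) else 0

/-- `H` is `κ`-local: a sum of Hermitian terms of operator norm at most one, each acting on at most
`κ` qubits. -/
def IsLocalHamiltonian {N : ℕ} (κ : ℕ) (H : QOp N) : Prop :=
  ∃ (r : ℕ) (h : Fin r → QOp N), H = ∑ j, h j ∧
    ∀ j, (h j).IsHermitian ∧ ‖Matrix.toEuclideanCLM (𝕜 := ℂ) (h j)‖ ≤ 1 ∧
      ∃ Q : Finset (Fin N), Q.card ≤ κ ∧ ActsOn Q (h j)

/-- Trace distance `½ ‖ρ - σ‖₁ = ½ tr √((ρ - σ)† (ρ - σ))`. -/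
noncomputable def traceDist {ι : Type} [Fintype ι] [DecidableEq ι] (ρ σ : Matrix ι ι ℂ) : ℝ :=
  (CFC.abs (ρ - σ)).trace.re / 2

/-- The density matrix `|ψ⟩⟨ψ|`. -/
def pureState {ι : Type} (ψ : ι → ℂ) : Matrix ι ι ℂ := Matrix.vecMulVec ψ (star ψ)

/-- The state of the first `N` qubits after running `C` on `|ψ⟩|0…0⟩` and tracing out the
ancillas. -/
noncomputable def QCircuit.outputState {N a : ℕ} (C : QCircuit (N + a)) (ψ : Bits N → ℂ) : QOp N :=
  let φ : Bits (N + a) → ℂ := fun z => ∑ x, C.op z (Fin.append x fun _ => false) * ψ x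
  Matrix.of fun x y => ∑ w : Bits a, φ (Fin.append x w) * star (φ (Fin.append y w))

/-- `C` simulates `H` for time `t` with error `ε`: on every initial state `ψ` its output is within
trace distance `ε` of `e^{-iHt} ψ`. -/
def QCircuit.Simulates {N a : ℕ} (C : QCircuit (N + a)) (H : QOp N) (t ε : ℝ) : Prop :=
  ∀ ψ : Bits N → ℂ, ∑ x, ‖ψ x‖ ^ 2 = 1 →
    traceDist (C.outputState ψ)
      (pureState ((NormedSpace.exp ((-(Complex.I * t)) • H)).mulVec ψ)) ≤ ε

/-! ### The circuit-to-Hamiltonian construction with a Johnson-graph clock -/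

/-- The Johnson graph: `k`-subsets of an `m`-set, adjacent if they share `k - 1` elements. -/
def johnsonGraph (m k : ℕ) : SimpleGraph {S : Finset (Fin m) // S.card = k} where
  Adj S S' := S ≠ S' ∧ (S.1 ∩ S'.1).card + 1 = k
  symm := ⟨fun _ _ h => ⟨h.1.symm, by rw [Finset.inter_comm]; exact h.2⟩⟩
  loopless := ⟨fun _ h => h.1 rfl⟩

/-- `γ 0, …, γ L` are the first `L + 1` vertices of a Hamiltonian path of the Johnson graph. The
set `γ j` stands for the clock state `|γ_j⟩`, the basis state with ones exactly at `γ j`. -/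
def IsJohnsonClock {m : ℕ} (k L : ℕ) (γ : ℕ → Finset (Fin m)) : Prop :=
  ∃ (u v : {S : Finset (Fin m) // S.card = k}) (p : (johnsonGraph m k).Walk u v),
    p.IsHamiltonian ∧ L ≤ p.length ∧ ∀ j ≤ L, γ j = (p.getVert j).1

/-- The clock transition from `S` to `S'`: the tensor product over the clock qubits `i` of
`|1⟩⟨1|` on `S ∩ S'`, `|1⟩⟨0|` on `S' \ S`, `|0⟩⟨1|` on `S \ S'`, and the identity elsewhere. -/
def clockStep {m : ℕ} (S S' : Finset (Fin m)) : QOp m :=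
  Matrix.of fun x y => ∏ i,
    (if i ∈ S then
      if i ∈ S' then Matrix.single true true (1 : ℂ) else Matrix.single false true 1
    else
      if i ∈ S' then Matrix.single true false 1 else 1) (x i) (y i)

/-- The tensor product of an operator on the first `n` qubits and one on the last `m`. -/
def tensorOp {n m : ℕ} (A : QOp n) (B : QOp m) : QOp (n + m) :=
  Matrix.of fun x y =>
    A (fun i => x (Fin.castAdd m i)) (fun i => y (Fin.castAdd m i)) *
      B (fun i => x (Fin.natAdd n i)) (fun i => y (Fin.natAdd n i))

/-- The Hamiltonian `∑_j (U_j ⊗ |γ_j⟩⟨γ_{j-1}| + U_j† ⊗ |γ_{j-1}⟩⟨γ_j|)` of the gate sequence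
`U_1, …, U_L`. -/
noncomputable def feynmanHamiltonian {n m : ℕ} (U : List (QGate n)) (γ : ℕ → Finset (Fin m)) :
    QOp (n + m) :=
  ∑ j : Fin U.length,
    (tensorOp (U.get j).op (clockStep (γ j) (γ (j + 1))) +
      (tensorOp (U.get j).op (clockStep (γ j) (γ (j + 1)))).conjTranspose)

/-- The gates of `r` consecutive runs of the circuit for `g`. -/
def IteratedFunction.iterGates {s : ℕ → ℕ} (F : IteratedFunction s) (n r : ℕ) : List (QGate n) :=
  (List.replicate r (F.circuit n).gates).flatten

/-- `2 s(n) T(n)`, the number of clock steps. -/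
noncomputable def clockLength (s : ℕ → ℕ) (T : Polynomial ℕ) (n : ℕ) : ℕ := 2 * s n * T.eval n

/-- `⌊(2 s(n) T(n))^{1/c}⌋`, the number of clock qubits. -/
noncomputable def clockQubits (s : ℕ → ℕ) (T : Polynomial ℕ) (c n : ℕ) : ℕ :=
  ⌊(clockLength s T n : ℝ) ^ (1 / (c : ℝ))⌋₊

/-- The description of the clock states `γ 0, …, γ L`, as bit strings. -/
def clockTree {m : ℕ} (L : ℕ) (γ : ℕ → Finset (Fin m)) : Tree₂ :=
  .ofList (fun j => .ofList (fun i => if i ∈ γ j then .ofNat 1 else .ofNat 0) (List.finRange m))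
    (List.range (L + 1))

/-!
# A depth lower bound for simulating Feynman-Nagaj Hamiltonians

*The clock.* The clock states are listed by the revolving-door order of the `(c + 1)`-subsets of an
`m`-set, in which consecutive sets differ by the exchange of one element; it is a Hamiltonian path of
the Johnson graph (`isJohnsonClock_doorSet`) and is computed in polynomial time from its recursion
(`polyTimeGenerated_clockTree`). An exchange involves `c + 2` clock qubits and a gate acts on at most
two, so the Hamiltonian is `(c + 4)`-local (`isLocalHamiltonian_feynman`). All clock states have the
same Hamming weight, so on them each transition, although it ignores most of the clock, acts as a
matrix unit. Hence the Hamiltonian moves the history states `U_j ⋯ U_1|x⟩ ⊗ |γ_j⟩` along a path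
(`feynmanHamiltonian_mulVec`).

*The walk.* The evolution of the initial history state is thus a continuous-time quantum walk on a
path, started at one end. At time `t` it has left the first quarter of `[0, t]` with probability at
least `1/3` (`IsPathWalk.escape`, `one_third_le_sum_history`). The proof needs no spectral
decomposition: it bounds the second derivative of the mean of the observable `tX - X²/4`. A simulator
with error less than `1/4` still puts weight at least `1/12` on the history states with
`j + 1 ≥ t/4` (`QCircuit.Simulates.sum_le`).

*Breaking the puzzle.* A simulator of depth `D` gives a circuit of depth `D + O(s)` for the puzzle.
It sets the clock to `γ_0` next to the input `x`, runs the simulator, and turns a history state with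
index `j` into an iterate of `g`. For this it finds `j mod s` from the clock: it copies the clock
register by repeated doubling, compares a copy with every clock state by a conjunction of `c + 1`
bits, and adds the outcomes with equal residue (`RGate.takes_decodeLayers`). Then it completes the
current run of the circuit for `g`: it goes through all `s` gates once more, with the data parked in
a second register until the gate `j mod s` is reached (`RGate.run_resumeLayers`). The output is
`f(⌊j/s⌋ + 1, x)` (`run_finish_historyState`, `exists_breaker`). Measuring the garbage left behind
does no harm, because orthonormal history states stay orthonormal (`sum_outputProb_ge`).

The weight `1/12` therefore becomes a success probability (`one_twelfth_le_successProb`), for the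
range `⌊t/2s⌋ ≤ 2k'`, `k' ≤ 2T + 1` of numbers of iterations. The breaking circuits are efficiently
uniform (`gen_breaker`), which is shown in a small calculus of polynomial-time functions on encoded
data. By the hardness of the puzzle their depth is at least `d(⌊t/2s⌋)`.
-/

/-! ### Polynomial-time functions on encoded data -/

/-- `u` is bounded by a polynomial in `v`. -/
def PolyBdd {ι : Type} (u v : ι → ℕ) : Prop := ∃ P : Polynomial ℕ, ∀ i, u i ≤ P.eval (v i)

theorem Polynomial.eval_nat_mono (P : Polynomial ℕ) : Monotone fun a : ℕ => P.eval a := by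
  intro a b h
  simp only [Polynomial.eval_eq_sum_range]
  exact Finset.sum_le_sum fun i _ => Nat.mul_le_mul_left _ (Nat.pow_le_pow_left h i)

namespace PolyBdd

variable {ι : Type} {u u' v w : ι → ℕ}

theorem of_le (h : ∀ i, u i ≤ v i) : PolyBdd u v := ⟨Polynomial.X, by simpa using h⟩

theorem const (c : ℕ) : PolyBdd (fun _ => c) v := ⟨Polynomial.C c, by simp⟩

theorem mono (h : PolyBdd u v) (h' : ∀ i, u' i ≤ u i) : PolyBdd u' v :=
  let ⟨P, hP⟩ := h
  ⟨P, fun i => (h' i).trans (hP i)⟩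

theorem add (h : PolyBdd u v) (h' : PolyBdd u' v) : PolyBdd (fun i => u i + u' i) v :=
  let ⟨P, hP⟩ := h
  let ⟨Q, hQ⟩ := h'
  ⟨P + Q, fun i => by simpa using Nat.add_le_add (hP i) (hQ i)⟩

theorem mul (h : PolyBdd u v) (h' : PolyBdd u' v) : PolyBdd (fun i => u i * u' i) v :=
  let ⟨P, hP⟩ := h
  let ⟨Q, hQ⟩ := h'
  ⟨P * Q, fun i => by simpa using Nat.mul_le_mul (hP i) (hQ i)⟩

theorem trans (h : PolyBdd u v) (h' : PolyBdd v w) : PolyBdd u w :=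
  let ⟨P, hP⟩ := h
  let ⟨Q, hQ⟩ := h'
  ⟨P.comp Q, fun i => (hP i).trans (by simpa using P.eval_nat_mono (hQ i))⟩

theorem eval (P : Polynomial ℕ) (h : PolyBdd u v) : PolyBdd (fun i => P.eval (u i)) v :=
  trans ⟨P, fun _ => le_rfl⟩ h

theorem precomp {κ : Type} (e : κ → ι) (h : PolyBdd u v) :
    PolyBdd (fun k => u (e k)) (fun k => v (e k)) :=
  let ⟨P, hP⟩ := h
  ⟨P, fun k => hP (e k)⟩

end PolyBdd

/-- Data that is presented to programs as a tree. -/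
class TreeEnc (α : Type) where
  /-- The tree that presents the datum. -/
  tree : α → Tree₂

open TreeEnc

/-- The size of the tree that presents a datum. -/
def sz {α : Type} [TreeEnc α] (a : α) : ℕ := (tree a).size

instance : TreeEnc ℕ := ⟨Tree₂.ofNat⟩
instance : TreeEnc Unit := ⟨fun _ => .leaf⟩
instance : TreeEnc Bool := ⟨fun b => if b then .node .leaf .leaf else .leaf⟩
instance {α β : Type} [TreeEnc α] [TreeEnc β] : TreeEnc (α × β) :=
  ⟨fun x => .node (tree x.1) (tree x.2)⟩
instance {α : Type} [TreeEnc α] : TreeEnc (List α) := ⟨Tree₂.ofList tree⟩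

section sizes

variable {α β : Type} [TreeEnc α] [TreeEnc β]

theorem Tree₂.one_le_size (x : Tree₂) : 1 ≤ x.size := by cases x <;> simp [Tree₂.size]

theorem one_le_sz (a : α) : 1 ≤ sz a := Tree₂.one_le_size _

theorem sz_pair (a : α) (b : β) : sz (a, b) = sz a + sz b + 1 := rfl

theorem sz_nil : sz ([] : List α) = 1 := rfl

theorem sz_cons (a : α) (l : List α) : sz (a :: l) = sz a + sz l + 1 := rfl

theorem sz_nat (k : ℕ) : sz k = 2 * k + 1 := by
  induction k with
  | zero => rfl
  | succ k ih =>
    have : sz (k + 1) = 1 + sz k + 1 := rfl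
    omega

theorem sz_append (l l' : List α) : sz (l ++ l') + 1 = sz l + sz l' := by
  induction l with
  | nil => simp [sz_nil]; omega
  | cons a l ih => simp only [List.cons_append, sz_cons]; omega

theorem sz_reverse (l : List α) : sz l.reverse = sz l := by
  induction l with
  | nil => rfl
  | cons a l ih =>
    have := sz_append l.reverse [a]
    simp only [List.reverse_cons, sz_cons, sz_nil] at *
    omega

theorem length_le_sz (l : List α) : l.length ≤ sz l := by
  induction l with
  | nil => simp
  | cons a l ih => simp only [sz_cons, List.length_cons]; omega

theorem sz_le_of_mem {a : α} {l : List α} (h : a ∈ l) : sz a ≤ sz l := by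
  induction l with
  | nil => simp at h
  | cons b l ih =>
    rw [sz_cons]
    rcases List.mem_cons.1 h with rfl | h
    · omega
    · have := ih h
      omega

theorem sz_le_of_forall {l : List α} {B : ℕ} (h : ∀ a ∈ l, sz a ≤ B) :
    sz l ≤ l.length * (B + 1) + 1 := by
  induction l with
  | nil => simp [sz_nil]
  | cons a l ih =>
    have h1 := h a (by simp)
    have h2 := ih fun b hb => h b (by simp [hb])
    rw [sz_cons, List.length_cons, Nat.succ_mul]
    omega

end sizes

/-- `f` is computed by a program in polynomial time, with outputs of polynomial size, in the size
of the input. -/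
@[fun_prop]
def PolyTime {α β : Type} [TreeEnc α] [TreeEnc β] (f : α → β) : Prop :=
  ∃ (p : TreeProg) (τ : α → ℕ), (∀ a, p.Runs (tree a) (tree (f a)) (τ a)) ∧
    PolyBdd τ sz ∧ PolyBdd (fun a => sz (f a)) sz

namespace PolyTime

variable {α β γ δ σ : Type} [TreeEnc α] [TreeEnc β] [TreeEnc γ] [TreeEnc δ] [TreeEnc σ]

theorem bdd {f : α → β} (h : PolyTime f) : ∃ P : Polynomial ℕ, ∀ a, sz (f a) ≤ P.eval (sz a) :=
  let ⟨_, _, _, _, h⟩ := h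
  h

@[fun_prop]
theorem id : PolyTime fun a : α => a :=
  ⟨.skip, fun _ => 1, fun _ => .skip _, .const 1, .of_le fun _ => le_rfl⟩

/-- A program that outputs a fixed tree. -/
def _root_.TreeProg.constant : Tree₂ → TreeProg
  | .leaf => .leaf
  | .node l r => .pair (constant l) (constant r)

theorem _root_.TreeProg.constant_runs (y x : Tree₂) :
    (TreeProg.constant y).Runs x y y.size := by
  induction y with
  | leaf => exact .leaf x
  | node l r hl hr => exact .pair hl hr

@[fun_prop]
theorem const (b : β) : PolyTime fun _ : α => b :=
  ⟨.constant (tree b), fun _ => sz b, fun _ => TreeProg.constant_runs _ _, .const _, .const _⟩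

@[fun_prop]
theorem comp {g : β → γ} {f : α → β} (hg : PolyTime g) (hf : PolyTime f) :
    PolyTime fun a => g (f a) := by
  obtain ⟨p, τ, hp, hτ, hs⟩ := hf
  obtain ⟨q, υ, hq, hυ, hs'⟩ := hg
  exact ⟨.comp q p, fun a => τ a + υ (f a) + 1, fun a => .comp (hp a) (hq (f a)),
    (hτ.add ((hυ.precomp f).trans hs)).add (.const 1), (hs'.precomp f).trans hs⟩

@[fun_prop]
theorem prodMk {f : α → β} {g : α → γ} (hf : PolyTime f) (hg : PolyTime g) :
    PolyTime fun a => (f a, g a) := by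
  obtain ⟨p, τ, hp, hτ, hs⟩ := hf
  obtain ⟨q, υ, hq, hυ, hs'⟩ := hg
  exact ⟨.pair p q, fun a => τ a + υ a + 1, fun a => .pair (hp a) (hq a),
    (hτ.add hυ).add (.const 1), (hs.add hs').add (.const 1)⟩

theorem _root_.polyTime_fst : PolyTime fun x : α × β => x.1 :=
  ⟨.fst, fun _ => 1, fun x => .fst (tree x), .const 1, .of_le fun x => by
    rcases x with ⟨a, b⟩; dsimp only; rw [sz_pair]; omega⟩

theorem _root_.polyTime_snd : PolyTime fun x : α × β => x.2 :=
  ⟨.snd, fun _ => 1, fun x => .snd (tree x), .const 1, .of_le fun x => by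
    rcases x with ⟨a, b⟩; dsimp only; rw [sz_pair]; omega⟩

@[fun_prop]
theorem fst {f : α → β × γ} (hf : PolyTime f) : PolyTime fun a => (f a).1 := polyTime_fst.comp hf

@[fun_prop]
theorem snd {f : α → β × γ} (hf : PolyTime f) : PolyTime fun a => (f a).2 := polyTime_snd.comp hf

/-- A function whose value is presented by the same tree as its argument. -/
theorem of_tree_eq {f : α → β} (h : ∀ a, tree (f a) = tree a) : PolyTime f :=
  ⟨.skip, fun _ => 1, fun a => by rw [h]; exact .skip _, .const 1, .of_le fun a => by
    rw [sz, h]; rfl⟩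

theorem cond {b : α → Bool} {f g : α → β} (hb : PolyTime b) (hf : PolyTime f) (hg : PolyTime g) :
    PolyTime fun a => bif b a then f a else g a := by
  obtain ⟨r, ρ, hr, hρ, -⟩ := hb
  obtain ⟨p, τ, hp, hτ, hs⟩ := hf
  obtain ⟨q, υ, hq, hυ, hs'⟩ := hg
  refine ⟨.comp (.branch (.comp p .snd) (.comp q .snd)) (.pair r .skip),
    fun a => (ρ a + 1 + 1) + ((1 + (bif b a then τ a else υ a) + 1) + 1) + 1, fun a => ?_, ?_, ?_⟩
  · dsimp only
    refine .comp (.pair (hr a) (.skip _)) ?_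
    cases h : b a with
    | true =>
      refine .branch_true (by simp [Tree₂.fst, tree]) (.comp (.snd _) ?_)
      simpa [Tree₂.snd] using hp a
    | false =>
      refine .branch_false (by simp [Tree₂.fst, tree]) (.comp (.snd _) ?_)
      simpa [Tree₂.snd] using hq a
  · refine ((hρ.add (hτ.add hυ)).add (.const 6)).mono fun a => ?_
    cases b a <;> simp only [cond_true, cond_false] <;> omega
  · refine (hs.add hs').mono fun a => ?_
    dsimp only
    cases b a <;> simp

@[fun_prop]
theorem ite {c : α → Prop} [DecidablePred c] {f g : α → β} (hc : PolyTime fun a => decide (c a))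
    (hf : PolyTime f) (hg : PolyTime g) : PolyTime fun a => if c a then f a else g a := by
  have := cond hc hf hg
  convert this using 2 with a
  by_cases h : c a <;> simp [h]

@[fun_prop]
theorem cons {f : α → β} {l : α → List β} (hf : PolyTime f) (hl : PolyTime l) :
    PolyTime fun a => f a :: l a :=
  (of_tree_eq (f := fun x : β × List β => x.1 :: x.2) fun _ => rfl).comp (hf.prodMk hl)

theorem tail {l : α → List β} (hl : PolyTime l) : PolyTime fun a => (l a).tail :=
  comp (g := fun l : List β => l.tail) ⟨.snd, fun _ => 1, fun x => by
    cases x with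
    | nil => exact .snd _
    | cons b l => exact .snd _, .const 1, .of_le fun x => by
    cases x with
    | nil => exact le_rfl
    | cons b l => dsimp only; rw [sz_cons, List.tail_cons]; omega⟩ hl

/-- The loop that runs through a list, updating an accumulator. Its state is the triple of the
remaining list, a parameter and the accumulator. -/
def _root_.TreeProg.foldLoop (p : TreeProg) : TreeProg :=
  .loop (.pair (.comp .snd .fst) (.pair (.comp .fst .snd)
    (.comp p (.pair (.comp .fst .snd) (.pair (.comp .snd .snd) (.comp .fst .fst))))))

theorem foldLoop_runs {p : TreeProg} {h : α × σ × β → σ} {τ : α × σ × β → ℕ}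
    (hp : ∀ x, p.Runs (tree x) (tree (h x)) (τ x)) (a : α) (M : ℕ) :
    ∀ (l : List β) (s : σ), (∀ l₁ b l₂, l = l₁ ++ b :: l₂ →
        τ (a, l₁.foldl (fun s b => h (a, s, b)) s, b) ≤ M) →
      ∃ t, (TreeProg.foldLoop p).Runs (tree (l, a, s))
        (tree (([] : List β), a, l.foldl (fun s b => h (a, s, b)) s)) t ∧
        t ≤ l.length * (M + 21) + 1 := by
  intro l
  induction l with
  | nil => exact fun s _ => ⟨1, .loop_done rfl, by simp⟩
  | cons b l ih =>
    intro s hM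
    obtain ⟨t, ht, htb⟩ := ih (h (a, s, b)) fun l₁ b' l₂ hl =>
      hM (b :: l₁) b' l₂ (by rw [hl]; rfl)
    have h0 := hM [] b l rfl
    simp only [List.foldl_nil] at h0
    have hstep := TreeProg.Runs.loop_step
      (p := .pair (.comp .snd .fst) (.pair (.comp .fst .snd)
        (.comp p (.pair (.comp .fst .snd) (.pair (.comp .snd .snd) (.comp .fst .fst))))))
      (x := tree (b :: l, a, s)) (y := tree (l, a, h (a, s, b)))
      (by simp [tree, Tree₂.fst, Tree₂.ofList])
      (.pair (.comp (.fst _) (.snd _)) (.pair (.comp (.snd _) (.fst _))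
        (.comp (.pair (.comp (.snd _) (.fst _)) (.pair (.comp (.snd _) (.snd _))
          (.comp (.fst _) (.fst _)))) (hp (a, s, b))))) ht
    refine ⟨_, hstep, ?_⟩
    rw [List.length_cons, Nat.succ_mul]
    omega

/-- Folding over a list is polynomial time as long as the accumulator stays of polynomial size. -/
theorem foldl {f : α → List β} {g : α → σ} {h : α → σ → β → σ} (hf : PolyTime f)
    (hg : PolyTime g) (hh : PolyTime fun x : α × σ × β => h x.1 x.2.1 x.2.2)
    (hbd : ∃ P : Polynomial ℕ, ∀ a l₁ l₂, f a = l₁ ++ l₂ →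
      sz (l₁.foldl (h a) (g a)) ≤ P.eval (sz a)) :
    PolyTime fun a => (f a).foldl (h a) (g a) := by
  obtain ⟨pf, τf, hpf, hτf, hsf⟩ := hf
  obtain ⟨pg, τg, hpg, hτg, -⟩ := hg
  obtain ⟨ph, τh, hph, ⟨Ph, hPh⟩, -⟩ := hh
  obtain ⟨P, hP⟩ := hbd
  have key : ∀ a, ∃ t, (TreeProg.foldLoop ph).Runs (tree (f a, a, g a))
      (tree (([] : List β), a, (f a).foldl (h a) (g a))) t ∧
      t ≤ (f a).length * (Ph.eval (sz a + (P.eval (sz a) + sz (f a) + 1) + 1) + 21) + 1 := by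
    intro a
    refine foldLoop_runs hph a _ (f a) (g a) fun l₁ b l₂ hl => (hPh _).trans ?_
    apply Ph.eval_nat_mono
    have h1 : sz b ≤ sz (f a) := sz_le_of_mem (by rw [hl]; simp)
    have h2 : sz (l₁.foldl (fun s b => h a s b) (g a)) ≤ P.eval (sz a) := hP a l₁ (b :: l₂) hl
    show sz (a, _, b) ≤ _
    rw [sz_pair, sz_pair]
    dsimp only
    omega
  choose τ hτ hτb using key
  refine ⟨.comp (.comp .snd .snd) (.comp (.foldLoop ph) (.pair pf (.pair .skip pg))),
    fun a => (τf a + (1 + τg a + 1) + 1 + τ a + 1) + (1 + 1 + 1) + 1, fun a => ?_, ?_, ?_⟩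
  · have h1 := TreeProg.Runs.comp (.pair (hpf a) (.pair (.skip _) (hpg a))) (hτ a)
    have h2 := TreeProg.Runs.comp
      (.snd (tree (([] : List β), a, (f a).foldl (h a) (g a)))) (.snd _)
    have h3 := TreeProg.Runs.comp h1 h2
    exact h3
  · have hid : PolyBdd (fun a : α => sz a) sz := .of_le fun _ => le_rfl
    have hPb : PolyBdd (fun a : α => P.eval (sz a)) sz := .eval P hid
    have hlen : PolyBdd (fun a => (f a).length) sz := hsf.mono fun a => length_le_sz _
    have hτ' : PolyBdd τ sz := by
      refine PolyBdd.mono ?_ hτb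
      exact (hlen.mul ((PolyBdd.eval Ph ((hid.add ((hPb.add hsf).add (.const 1))).add
        (.const 1))).add (.const 21))).add (.const 1)
    exact ((((hτf.add (((PolyBdd.const 1).add hτg).add (.const 1))).add (.const 1)).add hτ').add
      (.const 1)).add (.const 3) |>.add (.const 1)
  · exact ⟨P, fun a => hP a (f a) [] (by simp)⟩

@[fun_prop]
theorem reverse {f : α → List β} (hf : PolyTime f) : PolyTime fun a => (f a).reverse := by
  have : PolyTime fun a => (f a).foldl (fun s b => b :: s) [] := by
    refine foldl (h := fun _ s b => b :: s) hf (by fun_prop) (by fun_prop) ?_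
    obtain ⟨P, hP⟩ := hf.bdd
    refine ⟨P, fun a l₁ l₂ hl => le_trans ?_ (hP a)⟩
    have e : l₁.foldl (fun s b => b :: s) [] = l₁.reverse := by simp
    rw [e, sz_reverse, hl]
    have := sz_append l₁ l₂
    have := one_le_sz l₂
    omega
  simpa using this

@[fun_prop]
theorem headD {l : α → List β} {f : α → β} (hl : PolyTime l) (hf : PolyTime f) :
    PolyTime fun a => (l a).headD (f a) := by
  have : PolyTime fun a => (l a).reverse.foldl (fun _ b => b) (f a) := by
    refine foldl (h := fun _ _ b => b) (by fun_prop) hf (by fun_prop) ?_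
    obtain ⟨P, hP⟩ := hf.bdd
    obtain ⟨Q, hQ⟩ := hl.bdd
    refine ⟨P + Q, fun a l₁ l₂ h => ?_⟩
    have h1 := hP a
    have h2 := hQ a
    rw [Polynomial.eval_add]
    induction l₁ using List.reverseRecOn with
    | nil => simp only [List.foldl_nil]; omega
    | append_singleton l₁ b _ =>
      have h3 : sz b ≤ sz (l a).reverse := sz_le_of_mem (by rw [h]; simp)
      rw [sz_reverse] at h3
      simp only [List.foldl_append, List.foldl_cons, List.foldl_nil]
      omega
  convert this using 2 with a
  cases l a <;> simp

@[fun_prop]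
theorem append {f g : α → List β} (hf : PolyTime f) (hg : PolyTime g) :
    PolyTime fun a => f a ++ g a := by
  have : PolyTime fun a => (f a).reverse.foldl (fun s b => b :: s) (g a) := by
    refine foldl (h := fun _ s b => b :: s) (by fun_prop) hg (by fun_prop) ?_
    obtain ⟨P, hP⟩ := hf.bdd
    obtain ⟨Q, hQ⟩ := hg.bdd
    refine ⟨P + Q, fun a l₁ l₂ hl => ?_⟩
    have e : l₁.foldl (fun s b => b :: s) (g a) = l₁.reverse ++ g a := by simp
    have h1 := sz_append l₁.reverse (g a)
    have h2 := sz_append l₁ l₂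
    have h3 := one_le_sz l₂
    have h4 : sz (f a) = sz (l₁ ++ l₂) := by rw [← hl, sz_reverse]
    have h5 := sz_reverse l₁
    have h6 := hP a
    have h7 := hQ a
    rw [e, Polynomial.eval_add]
    omega
  simpa using this

theorem map {f : α → List β} {g : α → β → γ} (hf : PolyTime f)
    (hg : PolyTime fun x : α × β => g x.1 x.2) : PolyTime fun a => (f a).map (g a) := by
  have : PolyTime fun a => ((f a).foldl (fun s b => g a b :: s) []).reverse := by
    refine reverse (foldl (h := fun a s b => g a b :: s) hf (by fun_prop) ?_ ?_)
    · exact cons (hg.comp (f := fun x : α × List γ × β => (x.1, x.2.2)) (by fun_prop))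
        (by fun_prop)
    · obtain ⟨P, hP⟩ := hf.bdd
      obtain ⟨Q, hQ⟩ := hg.bdd
      refine ⟨P * (Q.comp (Polynomial.X + P + 1) + 1) + 1, fun a l₁ l₂ hl => ?_⟩
      have e : l₁.foldl (fun s b => g a b :: s) [] = (l₁.map (g a)).reverse := by
        rw [← List.map_reverse]
        clear hl
        induction l₁ using List.reverseRecOn <;> simp_all
      rw [e, sz_reverse]
      refine (sz_le_of_forall (B := Q.eval (sz a + P.eval (sz a) + 1)) ?_).trans ?_
      · intro c hc
        obtain ⟨b, hb, rfl⟩ := List.mem_map.1 hc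
        refine (hQ (a, b)).trans (Q.eval_nat_mono ?_)
        have h1 : sz b ≤ sz (f a) := sz_le_of_mem (by rw [hl]; simp [hb])
        have h2 := hP a
        rw [sz_pair]
        omega
      · have h1 := length_le_sz (f a)
        have h2 := hP a
        have h3 : l₁.length ≤ (f a).length := by rw [hl]; simp
        simp only [List.length_map, Polynomial.eval_add, Polynomial.eval_mul, Polynomial.eval_comp,
          Polynomial.eval_X, Polynomial.eval_one]
        exact Nat.add_le_add_right (Nat.mul_le_mul_right _ (by omega)) 1
  convert this using 2 with a
  rw [eq_comm, List.reverse_eq_iff, ← List.map_reverse]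
  induction f a using List.reverseRecOn <;> simp_all

theorem flatten {f : α → List (List β)} (hf : PolyTime f) : PolyTime fun a => (f a).flatten := by
  have aux : ∀ l : List (List β), l.foldl (fun s b => s ++ b) [] = l.flatten := by
    intro l
    induction l using List.reverseRecOn <;> simp_all
  have hsz : ∀ l : List (List β), sz l.flatten ≤ sz l := by
    intro l
    induction l with
    | nil => exact le_rfl
    | cons b l ih =>
      have := sz_append b l.flatten
      rw [List.flatten_cons, sz_cons]
      omega
  have : PolyTime fun a => (f a).foldl (fun s b => s ++ b) [] := by
    refine foldl (h := fun _ s b => s ++ b) hf (by fun_prop) (by fun_prop) ?_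
    obtain ⟨P, hP⟩ := hf.bdd
    refine ⟨P, fun a l₁ l₂ hl => le_trans ?_ (hP a)⟩
    rw [aux, hl]
    have h1 := hsz l₁
    have h2 := sz_append l₁ l₂
    have h3 := one_le_sz l₂
    omega
  simpa [aux] using this

theorem flatMap {f : α → List β} {g : α → β → List γ} (hf : PolyTime f)
    (hg : PolyTime fun x : α × β => g x.1 x.2) : PolyTime fun a => (f a).flatMap (g a) := by
  simpa [List.flatMap_def] using flatten (map hf hg)

theorem filter {f : α → List β} {c : α → β → Bool} (hf : PolyTime f)
    (hc : PolyTime fun x : α × β => c x.1 x.2) : PolyTime fun a => (f a).filter (c a) := by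
  have : PolyTime fun a => (f a).flatMap fun b => bif c a b then [b] else [] :=
    flatMap hf (cond hc (by fun_prop) (by fun_prop))
  convert this using 2 with a
  induction f a with
  | nil => rfl
  | cons b l ih => cases h : c a b <;> simp [h, ih]

attribute [fun_prop] tail map flatten flatMap filter cond

end PolyTime

namespace PolyTime

/-! ### Arithmetic and list functions in polynomial time -/

variable {α β γ : Type} [TreeEnc α] [TreeEnc β] [TreeEnc γ]

theorem sz_bool_le (b : Bool) : sz b ≤ 3 := by cases b <;> decide

@[fun_prop]
theorem not {f : α → Bool} (hf : PolyTime f) : PolyTime fun a => !f a := by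
  convert cond hf (const false) (const true) using 2 with a
  cases f a <;> rfl

@[fun_prop]
theorem and {f g : α → Bool} (hf : PolyTime f) (hg : PolyTime g) :
    PolyTime fun a => f a && g a := by
  convert cond hf hg (const false) using 2 with a
  cases f a <;> rfl

@[fun_prop]
theorem succ {f : α → ℕ} (hf : PolyTime f) : PolyTime fun a => f a + 1 :=
  (of_tree_eq (f := fun x : Unit × ℕ => x.2 + 1) fun _ => rfl).comp ((const ()).prodMk hf)

@[fun_prop]
theorem replicate_unit {f : α → ℕ} (hf : PolyTime f) :
    PolyTime fun a => List.replicate (f a) () :=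
  (of_tree_eq (f := fun k : ℕ => List.replicate k ()) fun k => by
    induction k with
    | zero => rfl
    | succ k ih =>
      show Tree₂.node .leaf (tree (List.replicate k ())) = _
      rw [ih]; rfl).comp hf

theorem iterate {f : α → ℕ} {g : α → β} {h : α → β → β} (hf : PolyTime f) (hg : PolyTime g)
    (hh : PolyTime fun x : α × β => h x.1 x.2)
    (hbd : ∃ P : Polynomial ℕ, ∀ a k, k ≤ f a → sz ((h a)^[k] (g a)) ≤ P.eval (sz a)) :
    PolyTime fun a => (h a)^[f a] (g a) := by
  have aux : ∀ a (l : List Unit), l.foldl (fun s _ => h a s) (g a) = (h a)^[l.length] (g a) := by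
    intro a l
    induction l using List.reverseRecOn with
    | nil => rfl
    | append_singleton l b ih =>
      simp only [List.foldl_append, ih, List.foldl_cons, List.foldl_nil, List.length_append,
        List.length_singleton, Function.iterate_succ_apply']
  have : PolyTime fun a => (List.replicate (f a) ()).foldl (fun s _ => h a s) (g a) := by
    refine foldl (h := fun a s _ => h a s) (by fun_prop) hg
      (hh.comp (f := fun x : α × β × Unit => (x.1, x.2.1)) (by fun_prop)) ?_
    obtain ⟨P, hP⟩ := hbd
    refine ⟨P, fun a l₁ l₂ hl => ?_⟩
    rw [aux]
    refine hP a _ ?_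
    have := congrArg List.length hl
    simp at this
    omega
  simpa only [aux, List.length_replicate] using this

@[fun_prop]
theorem add {f g : α → ℕ} (hf : PolyTime f) (hg : PolyTime g) : PolyTime fun a => f a + g a := by
  have : PolyTime fun a => (fun s => s + 1)^[f a] (g a) := by
    refine iterate (h := fun _ s => s + 1) hf hg (by fun_prop) ?_
    obtain ⟨P, hP⟩ := hf.bdd
    obtain ⟨Q, hQ⟩ := hg.bdd
    refine ⟨P + Q, fun a k hk => ?_⟩
    have h1 := hP a
    have h2 := hQ a
    have e : (fun s => s + 1)^[k] (g a) = g a + k := by simp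
    rw [e, Polynomial.eval_add]
    simp only [sz_nat] at *
    omega
  convert this using 2 with a
  simp [add_comm]

@[fun_prop]
theorem mul {f g : α → ℕ} (hf : PolyTime f) (hg : PolyTime g) : PolyTime fun a => f a * g a := by
  have e : ∀ a k, (fun s => s + g a)^[k] 0 = k * g a := by
    intro a k
    induction k with
    | zero => simp
    | succ k ih => rw [Function.iterate_succ_apply', ih, Nat.succ_mul]
  have : PolyTime fun a => (fun s => s + g a)^[f a] 0 := by
    refine iterate (h := fun a s => s + g a) hf (by fun_prop)
      (by fun_prop) ?_
    obtain ⟨P, hP⟩ := hf.bdd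
    obtain ⟨Q, hQ⟩ := hg.bdd
    refine ⟨P * Q + 1, fun a k hk => ?_⟩
    have h1 := hP a
    have h2 := hQ a
    rw [e, Polynomial.eval_add, Polynomial.eval_mul, Polynomial.eval_one]
    simp only [sz_nat] at *
    have : 2 * (k * g a) ≤ (2 * f a + 1) * (2 * g a + 1) := by nlinarith
    have := Nat.mul_le_mul h1 h2
    omega
  simpa only [e] using this

theorem pred {f : α → ℕ} (hf : PolyTime f) : PolyTime fun a => f a - 1 := by
  have : PolyTime fun a => ((List.replicate (f a) ()).tail).foldl (fun s _ => s + 1) 0 := by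
    refine foldl (h := fun _ s _ => s + 1) (by fun_prop) (by fun_prop) (by fun_prop) ?_
    obtain ⟨P, hP⟩ := hf.bdd
    refine ⟨P, fun a l₁ l₂ hl => (le_trans ?_ (hP a))⟩
    have h1 := congrArg List.length hl
    have e : ∀ l : List Unit, l.foldl (fun s _ => s + 1) 0 = l.length := by
      intro l; induction l using List.reverseRecOn <;> simp_all
    simp at h1
    rw [e]
    simp only [sz_nat] at *
    omega
  convert this using 2 with a
  have e : ∀ l : List Unit, l.foldl (fun s _ => s + 1) 0 = l.length := by
    intro l; induction l using List.reverseRecOn <;> simp_all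
  rw [e]
  simp

@[fun_prop]
theorem sub {f g : α → ℕ} (hf : PolyTime f) (hg : PolyTime g) : PolyTime fun a => f a - g a := by
  have e : ∀ a k, (fun s => s - 1)^[k] (f a) = f a - k := by
    intro a k
    induction k with
    | zero => simp
    | succ k ih => rw [Function.iterate_succ_apply', ih]; omega
  have : PolyTime fun a => (fun s => s - 1)^[g a] (f a) := by
    refine iterate (h := fun _ s => s - 1) hg hf (pred (by fun_prop)) ?_
    obtain ⟨P, hP⟩ := hf.bdd
    refine ⟨P, fun a k _ => (le_trans ?_ (hP a))⟩
    rw [e]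
    simp only [sz_nat]
    omega
  simpa only [e] using this

theorem isZero {f : α → ℕ} (hf : PolyTime f) : PolyTime fun a => decide (f a = 0) := by
  have : PolyTime fun a => (fun _ => false)^[f a] true :=
    iterate (h := fun _ _ => false) hf (by fun_prop) (by fun_prop)
      ⟨3, fun a k _ => by simpa using sz_bool_le _⟩
  convert this using 2 with a
  cases h : f a with
  | zero => simp
  | succ k => rw [Function.iterate_succ_apply']; simp

@[fun_prop]
theorem le {f g : α → ℕ} (hf : PolyTime f) (hg : PolyTime g) :
    PolyTime fun a => decide (f a ≤ g a) := by
  simpa only [Nat.sub_eq_zero_iff_le] using isZero (sub hf hg)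

@[fun_prop]
theorem eq {f g : α → ℕ} (hf : PolyTime f) (hg : PolyTime g) :
    PolyTime fun a => decide (f a = g a) := by
  convert and (le hf hg) (le hg hf) using 2 with a
  rw [← Bool.decide_and]
  exact decide_eq_decide.2 le_antisymm_iff

@[fun_prop]
theorem natMin {f g : α → ℕ} (hf : PolyTime f) (hg : PolyTime g) :
    PolyTime fun a => min (f a) (g a) := by
  simp only [min_def]
  fun_prop

@[fun_prop]
theorem pow {f : α → ℕ} (hf : PolyTime f) (k : ℕ) : PolyTime fun a => f a ^ k := by
  induction k with
  | zero => simp only [pow_zero]; fun_prop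
  | succ k ih => simp only [pow_succ]; fun_prop

@[fun_prop]
theorem polynomialEval {f : α → ℕ} (hf : PolyTime f) (T : Polynomial ℕ) :
    PolyTime fun a => T.eval (f a) := by
  induction T using Polynomial.induction_on' with
  | add p q hp hq => simp only [Polynomial.eval_add]; fun_prop
  | monomial k c => simp only [Polynomial.eval_monomial]; fun_prop

@[fun_prop]
theorem range {f : α → ℕ} (hf : PolyTime f) : PolyTime fun a => List.range (f a) := by
  have e : ∀ k, (fun s : ℕ × List ℕ => (s.1 + 1, s.1 :: s.2))^[k] (0, []) =
      (k, (List.range k).reverse) := by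
    intro k
    induction k with
    | zero => rfl
    | succ k ih => rw [Function.iterate_succ_apply', ih, List.range_succ]; simp
  have : PolyTime fun a =>
      ((fun s : ℕ × List ℕ => (s.1 + 1, s.1 :: s.2))^[f a] (0, [])).2.reverse := by
    refine reverse (snd (iterate (h := fun _ s => (s.1 + 1, s.1 :: s.2)) hf (by fun_prop)
      (by fun_prop) ?_))
    obtain ⟨P, hP⟩ := hf.bdd
    refine ⟨P + P * (P + 1) + 2, fun a k hk => ?_⟩
    have h1 := hP a
    rw [e, sz_pair, sz_reverse]
    have h2 : sz (List.range k) ≤ k * (2 * k + 1) + 1 := by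
      have := sz_le_of_forall (l := List.range k) (B := 2 * k) fun x hx => by
        rw [sz_nat]; have := List.mem_range.1 hx; omega
      simpa using this
    simp only [Polynomial.eval_add, Polynomial.eval_mul, Polynomial.eval_one,
      Polynomial.eval_ofNat]
    rw [sz_nat] at h1 ⊢
    have : k * (2 * k + 1) ≤ P.eval (sz a) * (P.eval (sz a) + 1) :=
      Nat.mul_le_mul (by omega) (by omega)
    omega
  simpa [e] using this

@[fun_prop]
theorem length {f : α → List β} (hf : PolyTime f) : PolyTime fun a => (f a).length := by
  have e : ∀ l : List β, l.foldl (fun s _ => s + 1) 0 = l.length := by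
    intro l; induction l using List.reverseRecOn <;> simp_all
  have : PolyTime fun a => (f a).foldl (fun s _ => s + 1) 0 := by
    refine foldl (h := fun _ s _ => s + 1) hf (by fun_prop) (by fun_prop) ?_
    obtain ⟨P, hP⟩ := hf.bdd
    refine ⟨2 * P + 1, fun a l₁ l₂ hl => ?_⟩
    have h1 := (length_le_sz (f a)).trans (hP a)
    have h2 := congrArg List.length hl
    simp at h2
    rw [e, sz_nat, Polynomial.eval_add, Polynomial.eval_mul, Polynomial.eval_one,
      Polynomial.eval_ofNat]
    omega
  simpa only [e] using this

@[fun_prop]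
theorem getD {l : α → List β} {i : α → ℕ} {d : α → β} (hl : PolyTime l) (hi : PolyTime i)
    (hd : PolyTime d) : PolyTime fun a => (l a).getD (i a) (d a) := by
  have e : ∀ k (l : List β), List.tail^[k] l = l.drop k := by
    intro k
    induction k with
    | zero => simp
    | succ k ih => intro l; rw [Function.iterate_succ_apply, ih, List.drop_tail]
  have : PolyTime fun a => ((List.tail)^[i a] (l a)).headD (d a) := by
    refine headD (iterate (h := fun _ s => s.tail) hi hl (by fun_prop) ?_) hd
    obtain ⟨P, hP⟩ := hl.bdd
    refine ⟨P, fun a k _ => le_trans ?_ (hP a)⟩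
    show sz (List.tail^[k] (l a)) ≤ _
    rw [e]
    have h1 := sz_append ((l a).take k) ((l a).drop k)
    rw [List.take_append_drop] at h1
    have := one_le_sz ((l a).take k)
    omega
  convert this using 2 with a
  rw [e]
  simp [List.getD_eq_getElem?_getD, List.head?_drop]

@[fun_prop]
theorem div {f g : α → ℕ} (hf : PolyTime f) (hg : PolyTime g) : PolyTime fun a => f a / g a := by
  -- the quotient is the number of `i < p` with `(i + 1) n ≤ p`
  have e : ∀ p n : ℕ, p / n =
      if n = 0 then 0 else ((List.range p).filter fun i => decide ((i + 1) * n ≤ p)).length := by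
    intro p n
    split_ifs with h
    · simp [h]
    · have hn : 0 < n := Nat.pos_of_ne_zero h
      have : (List.range p).filter (fun i => decide ((i + 1) * n ≤ p)) = List.range (p / n) := by
        have hle : p / n ≤ p := Nat.div_le_self p n
        obtain ⟨r, hr⟩ := Nat.exists_eq_add_of_le hle
        rw [show List.range p = List.range (p / n + r) by rw [← hr], List.range_add,
          List.filter_append, List.filter_eq_self.2, List.filter_eq_nil_iff.2, List.append_nil]
        · simp only [List.mem_map, List.mem_range, decide_eq_true_eq]
          rintro _ ⟨i, -, rfl⟩ hle
          have := (Nat.le_div_iff_mul_le hn).2 hle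
          omega
        · intro i hi
          rw [List.mem_range] at hi
          exact decide_eq_true ((Nat.le_div_iff_mul_le hn).1 hi)
      rw [this, List.length_range]
  simp only [e]
  exact ite (by fun_prop) (by fun_prop) (length (filter (by fun_prop) (by fun_prop)))

end PolyTime

/-! ### Uniform generation of data -/

theorem polyTimeGenerated_iff {B : ℕ → ℕ} {F : ℕ → Tree₂} : PolyTimeGenerated B F ↔
    ∃ (p : TreeProg) (τ : ℕ → ℕ), (∀ n, p.Runs (Tree₂.ofNat n) (F n) (τ n)) ∧ PolyBdd τ B ∧
      PolyBdd (fun n => (F n).size) B := by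
  constructor
  · rintro ⟨p, P, h⟩
    choose τ h1 h2 h3 using h
    exact ⟨p, τ, h1, ⟨P, h2⟩, ⟨P, h3⟩⟩
  · rintro ⟨p, τ, h1, ⟨P, hP⟩, ⟨Q, hQ⟩⟩
    refine ⟨p, P + Q, fun n => ⟨τ n, h1 n, ?_, ?_⟩⟩
    · rw [Polynomial.eval_add]; have : τ n ≤ _ := hP n; omega
    · rw [Polynomial.eval_add]; have : (F n).size ≤ _ := hQ n; omega

/-- The data `h n` are generated on input `1ⁿ` in time polynomial in `B n`. -/
def Gen {α : Type} [TreeEnc α] (B : ℕ → ℕ) (h : ℕ → α) : Prop :=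
  PolyTimeGenerated B fun n => tree (h n)

namespace Gen

variable {α β : Type} [TreeEnc α] [TreeEnc β] {B B' : ℕ → ℕ}

theorem map {f : α → β} (hf : PolyTime f) {h : ℕ → α} (hh : Gen B h) : Gen B fun n => f (h n) := by
  obtain ⟨p, τ, hp, hτ, hs⟩ := polyTimeGenerated_iff.1 hh
  obtain ⟨q, υ, hq, hυ, hs'⟩ := hf
  exact polyTimeGenerated_iff.2 ⟨.comp q p, fun n => τ n + υ (h n) + 1,
    fun n => .comp (hp n) (hq _), (hτ.add ((hυ.precomp h).trans hs)).add (.const 1),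
    (hs'.precomp h).trans hs⟩

theorem pair {h : ℕ → α} {h' : ℕ → β} (hh : Gen B h) (hh' : Gen B h') :
    Gen B fun n => (h n, h' n) := by
  obtain ⟨p, τ, hp, hτ, hs⟩ := polyTimeGenerated_iff.1 hh
  obtain ⟨q, υ, hq, hυ, hs'⟩ := polyTimeGenerated_iff.1 hh'
  exact polyTimeGenerated_iff.2 ⟨.pair p q, fun n => τ n + υ n + 1,
    fun n => .pair (hp n) (hq n), (hτ.add hυ).add (.const 1), (hs.add hs').add (.const 1)⟩

end Gen

theorem PolyTimeGenerated.mono {B B' : ℕ → ℕ} {F : ℕ → Tree₂} (hF : PolyTimeGenerated B F)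
    (h : PolyBdd B B') : PolyTimeGenerated B' F := by
  obtain ⟨p, τ, hp, hτ, hs⟩ := polyTimeGenerated_iff.1 hF
  exact polyTimeGenerated_iff.2 ⟨p, τ, hp, hτ.trans h, hs.trans h⟩

/-- Finitely many values of a generated sequence may be changed: they are stored in the program. -/
theorem PolyTimeGenerated.congr_eventually {B : ℕ → ℕ} (hB : PolyBdd (fun n => n) B)
    {F G : ℕ → Tree₂} (hF : PolyTimeGenerated B F) (h : ∀ᶠ n in atTop, F n = G n) :
    PolyTimeGenerated B G := by
  obtain ⟨N, hN⟩ := eventually_atTop.1 h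
  clear h
  induction N generalizing F with
  | zero => rwa [← funext fun n => hN n n.zero_le]
  | succ N ih =>
    refine ih (F := fun n => bif decide (n = N) then G n else F n) ?_ fun n hn => ?_
    · obtain ⟨p, τ, hp, hτ, hs⟩ := polyTimeGenerated_iff.1 hF
      obtain ⟨q, υ, hq, hυ, -⟩ := (PolyTime.id (α := ℕ)).eq (.const N)
      have hsz : PolyBdd (sz : ℕ → ℕ) B :=
        (((PolyBdd.const 2).mul hB).add (.const 1)).mono fun n => (sz_nat n).le
      refine polyTimeGenerated_iff.2
        ⟨.comp (.branch (.comp (.constant (G N)) .snd) (.comp p .snd)) (.pair q .skip),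
          fun n => (υ n + 1 + 1) + ((1 + (bif decide (n = N) then (G N).size else τ n) + 1) + 1) + 1,
          fun n => ?_, ?_, ?_⟩
      · dsimp only
        refine .comp (.pair (hq n) (.skip _)) ?_
        by_cases hn : n = N
        · refine .branch_true (by simp [Tree₂.fst, tree, hn]) (.comp (.snd _) ?_)
          simpa [Tree₂.snd, hn] using TreeProg.constant_runs (G N) (Tree₂.ofNat N)
        · refine .branch_false (by simp [Tree₂.fst, tree, hn]) (.comp (.snd _) ?_)
          simpa [Tree₂.snd, hn] using hp n
      · refine (((hυ.trans hsz).add (hτ.add (.const (G N).size))).add (.const 6)).mono fun n => ?_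
        cases decide (n = N) <;> simp only [cond_true, cond_false] <;> omega
      · refine (hs.add (.const (G N).size)).mono fun n => ?_
        by_cases hn : n = N
        · subst hn; simp
        · simp [hn]
    · by_cases h : n = N
      · simp [h]
      · simpa [h] using hN n (by omega)

/-! ### A Hamiltonian path of the Johnson graph -/

/-- The `k`-subsets of `{0, …, m - 1}`, each as a decreasing list, in revolving-door order: those
with largest element `0`, `1`, `2`, …, where the remaining elements run through the order for
`k - 1` backwards. -/
def revolvingDoor : ℕ → ℕ → List (List ℕ)
  | 0, _ => [[]]
  | k + 1, m => (List.range m).flatMap fun i => (revolvingDoor k i).reverse.map (i :: ·)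

theorem revolvingDoor_succ_zero (k : ℕ) : revolvingDoor (k + 1) 0 = [] := rfl

theorem revolvingDoor_succ_succ (k m : ℕ) : revolvingDoor (k + 1) (m + 1) =
    revolvingDoor (k + 1) m ++ (revolvingDoor k m).reverse.map (m :: ·) := by
  simp [revolvingDoor, List.range_succ]

theorem PolyTime.revolvingDoor {α : Type} [TreeEnc α] (k : ℕ) {f : α → ℕ} (hf : PolyTime f) :
    PolyTime fun a => revolvingDoor k (f a) := by
  induction k generalizing α with
  | zero => exact .const [[]]
  | succ k ih =>
    have := ih (f := fun x : α × ℕ => x.2) (by fun_prop)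
    simp only [_root_.revolvingDoor]
    refine flatMap (by fun_prop) (map (reverse this) ?_)
    fun_prop

theorem length_revolvingDoor (k m : ℕ) : (revolvingDoor k m).length = m.choose k := by
  induction k generalizing m with
  | zero => simp [revolvingDoor]
  | succ k ih =>
    induction m with
    | zero => simp [revolvingDoor_succ_zero]
    | succ m ih' =>
      rw [revolvingDoor_succ_succ, List.length_append, ih', List.length_map, List.length_reverse,
        ih, Nat.choose_succ_succ, add_comm]

theorem of_mem_revolvingDoor {k m : ℕ} {l : List ℕ} (h : l ∈ revolvingDoor k m) :
    l.length = k ∧ l.Nodup ∧ ∀ x ∈ l, x < m := by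
  induction k generalizing m l with
  | zero => simp [revolvingDoor] at h; simp [h]
  | succ k ih =>
    simp only [revolvingDoor, List.mem_flatMap, List.mem_range, List.mem_map,
      List.mem_reverse] at h
    obtain ⟨i, hi, l, hl, rfl⟩ := h
    obtain ⟨h1, h2, h3⟩ := ih hl
    refine ⟨by simp [h1], List.nodup_cons.2 ⟨fun h => (h3 i h).false, h2⟩, ?_⟩
    intro x hx
    rcases List.mem_cons.1 hx with rfl | hx
    · exact hi
    · exact (h3 x hx).trans hi

theorem nodup_revolvingDoor (k m : ℕ) : ((revolvingDoor k m).map List.toFinset).Nodup := by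
  induction k generalizing m with
  | zero => simp [revolvingDoor]
  | succ k ih =>
    induction m with
    | zero => simp [revolvingDoor_succ_zero]
    | succ m ih' =>
      have hm : ∀ l ∈ revolvingDoor k m, m ∉ l.toFinset := fun l hl h =>
        ((of_mem_revolvingDoor hl).2.2 m (List.mem_toFinset.1 h)).false
      rw [revolvingDoor_succ_succ, List.map_append, List.nodup_append]
      refine ⟨ih', ?_, ?_⟩
      · rw [List.map_map]
        have e : (List.toFinset ∘ fun l => m :: l) = insert m ∘ List.toFinset := by
          funext l; simp
        rw [e, ← List.map_map]
        refine List.Nodup.map_on ?_ (by simpa using ih m)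
        simp only [List.mem_map, List.mem_reverse]
        rintro _ ⟨l, hl, rfl⟩ _ ⟨l', hl', rfl⟩ h
        rw [← Finset.erase_insert (hm l hl), h, Finset.erase_insert (hm l' hl')]
      · simp only [List.mem_map, List.mem_reverse, exists_exists_and_eq_and]
        rintro _ ⟨l, hl, rfl⟩ _ ⟨l', hl', rfl⟩ h
        have h1 : m ∈ l := by
          rw [← List.mem_toFinset, h]; simp
        exact ((of_mem_revolvingDoor hl).2.2 m h1).false

theorem head_revolvingDoor {k m : ℕ} (h : k ≤ m) :
    (revolvingDoor k m).head? = some (List.range k).reverse := by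
  induction k generalizing m with
  | zero => simp [revolvingDoor]
  | succ k ih =>
    induction m, h using Nat.le_induction with
    | base =>
      have e : revolvingDoor (k + 1) k = [] := by
        rw [← List.length_eq_zero_iff, length_revolvingDoor, Nat.choose_succ_self]
      have e' : (revolvingDoor k k).length = 1 := by simp [length_revolvingDoor]
      obtain ⟨l, hl⟩ := List.length_eq_one_iff.1 e'
      have h' := ih le_rfl
      rw [hl] at h'
      simp only [List.head?_cons, Option.some.injEq] at h'
      rw [revolvingDoor_succ_succ, e, hl, h', List.range_succ]
      simp
    | succ m _ ih' => rw [revolvingDoor_succ_succ, List.head?_append, ih']; rfl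

theorem getLast_revolvingDoor {k m : ℕ} (h : k ≤ m) :
    (revolvingDoor (k + 1) (m + 1)).getLast? = some (m :: (List.range k).reverse) := by
  rw [revolvingDoor_succ_succ, List.getLast?_append, List.getLast?_map, List.getLast?_reverse,
    head_revolvingDoor h]
  rfl

theorem isChain_revolvingDoor (k m : ℕ) : (revolvingDoor k m).IsChain
    fun l l' => (l.toFinset ∩ l'.toFinset).card + 1 = k := by
  induction k generalizing m with
  | zero => simp [revolvingDoor]
  | succ k ih =>
    induction m with
    | zero => simp [revolvingDoor_succ_zero]
    | succ m ih' =>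
      rw [revolvingDoor_succ_succ, List.isChain_append]
      refine ⟨ih', ?_, ?_⟩
      · rw [List.isChain_map, List.isChain_reverse]
        have hm : ∀ l ∈ revolvingDoor k m, m ∉ l.toFinset := fun l hl h =>
          ((of_mem_revolvingDoor hl).2.2 m (List.mem_toFinset.1 h)).false
        refine List.IsChain.imp_of_mem_imp ?_ (ih m)
        intro l l' hl hl' h
        rw [List.toFinset_cons, List.toFinset_cons, ← Finset.insert_inter_distrib,
          Finset.card_insert_of_notMem fun h => hm l' hl' (Finset.mem_inter.1 h).1]
        rw [Finset.inter_comm, h]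
      · intro l hl l' hl'
        rcases Nat.lt_or_ge m (k + 1) with hlt | hge
        · have e : revolvingDoor (k + 1) m = [] := by
            rw [← List.length_eq_zero_iff, length_revolvingDoor, Nat.choose_eq_zero_of_lt hlt]
          simp [e] at hl
        obtain ⟨m, rfl⟩ := Nat.exists_eq_add_of_le' (Nat.one_le_of_lt hge)
        rw [getLast_revolvingDoor (by omega)] at hl
        simp only [Option.mem_def, Option.some.injEq] at hl
        subst hl
        rcases k with _ | k
        · simp only [revolvingDoor, List.reverse_cons, List.reverse_nil, List.nil_append,
            List.map_cons, List.map_nil, List.head?_cons, Option.mem_def, Option.some.injEq] at hl'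
          subst hl'
          simp
        · rw [List.head?_map, List.head?_reverse, getLast_revolvingDoor (by omega)] at hl'
          simp only [Option.map_some, Option.mem_def, Option.some.injEq] at hl'
          subst hl'
          have e : (m :: (List.range (k + 1)).reverse).toFinset ∩
              ((m + 1) :: m :: (List.range k).reverse).toFinset = insert m (Finset.range k) := by
            ext x
            simp only [List.toFinset_cons, List.toFinset_reverse, Finset.mem_inter,
              Finset.mem_insert, List.mem_toFinset, List.mem_range, Finset.mem_range]
            omega
          rw [e, Finset.card_insert_of_notMem (by simp; omega), Finset.card_range]

/-- The `j`-th `k`-subset of an `m`-set in revolving-door order. -/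
def doorSet (k m j : ℕ) : Finset (Fin m) :=
  Finset.univ.filter fun i => i.1 ∈ (revolvingDoor k m).getD j []

theorem map_filter_mem {m : ℕ} {l : List ℕ} (h : ∀ x ∈ l, x < m) :
    (Finset.univ.filter fun i : Fin m => i.1 ∈ l).map Fin.valEmbedding = l.toFinset := by
  ext x
  simp only [Finset.mem_map, Finset.mem_filter, Finset.mem_univ, true_and, Fin.valEmbedding_apply,
    List.mem_toFinset]
  exact ⟨by rintro ⟨i, hi, rfl⟩; exact hi, fun hx => ⟨⟨x, h x hx⟩, hx, rfl⟩⟩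

theorem map_doorSet {k m j : ℕ} (hj : j < m.choose k) : (doorSet k m j).map Fin.valEmbedding =
    ((revolvingDoor k m)[j]'(by rwa [length_revolvingDoor])).toFinset := by
  have hj' : j < (revolvingDoor k m).length := by rwa [length_revolvingDoor]
  rw [doorSet, List.getD_eq_getElem _ _ hj']
  exact map_filter_mem (of_mem_revolvingDoor (List.getElem_mem hj')).2.2

theorem card_doorSet {k m j : ℕ} (hj : j < m.choose k) : (doorSet k m j).card = k := by
  have hj' : j < (revolvingDoor k m).length := by rwa [length_revolvingDoor]
  obtain ⟨h1, h2, -⟩ := of_mem_revolvingDoor (List.getElem_mem hj')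
  rw [← Finset.card_map Fin.valEmbedding, map_doorSet hj, List.toFinset_card_of_nodup h2, h1]

theorem doorSet_injOn {k m i j : ℕ} (hi : i < m.choose k) (hj : j < m.choose k)
    (h : doorSet k m i = doorSet k m j) : i = j := by
  have h' := congrArg (Finset.map Fin.valEmbedding) h
  rw [map_doorSet hi, map_doorSet hj] at h'
  have := (nodup_revolvingDoor k m).getElem_inj_iff (i := i) (j := j)
    (hi := by simpa [length_revolvingDoor]) (hj := by simpa [length_revolvingDoor])
  simp only [List.getElem_map] at this
  exact this.1 h'

theorem card_doorSet_inter {k m j : ℕ} (hj : j + 1 < m.choose k) :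
    (doorSet k m j ∩ doorSet k m (j + 1)).card + 1 = k := by
  rw [← Finset.card_map Fin.valEmbedding, Finset.map_inter, map_doorSet hj, map_doorSet (by omega)]
  exact List.isChain_iff_getElem.1 (isChain_revolvingDoor k m) j (by rwa [length_revolvingDoor])

/-- The revolving-door order is a Hamiltonian path of the Johnson graph. -/
theorem isJohnsonClock_doorSet {k m L : ℕ} (h : L < m.choose k) :
    IsJohnsonClock k L (doorSet k m) := by
  let V := {S : Finset (Fin m) // S.card = k}
  let w : List V := List.ofFn fun j : Fin (m.choose k) => ⟨doorSet k m j, card_doorSet j.2⟩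
  have hlen : w.length = m.choose k := by simp [w]
  have hne : w ≠ [] := by
    intro h'
    rw [h'] at hlen
    simp at hlen
    omega
  have hchain : w.IsChain (johnsonGraph m k).Adj := by
    rw [List.isChain_iff_getElem]
    intro i hi
    rw [hlen] at hi
    simp only [w, List.getElem_ofFn]
    refine ⟨fun heq => ?_, card_doorSet_inter hi⟩
    have := doorSet_injOn (by omega) hi (congrArg Subtype.val heq)
    omega
  have hnodup : w.Nodup := by
    rw [List.nodup_ofFn]
    intro i j hij
    exact Fin.ext (doorSet_injOn i.2 j.2 (congrArg Subtype.val hij))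
  have hall : ∀ v : V, v ∈ w := by
    have : w.toFinset = Finset.univ := by
      apply Finset.eq_univ_of_card
      rw [List.toFinset_card_of_nodup hnodup, hlen, Fintype.card_finset_len, Fintype.card_fin]
    intro v
    rw [← List.mem_toFinset, this]
    exact Finset.mem_univ v
  refine ⟨_, _, SimpleGraph.Walk.ofSupport w hne hchain, ?_, ?_, ?_⟩
  · refine (SimpleGraph.Walk.IsPath.isHamiltonian_iff ?_).2 ?_
    · exact SimpleGraph.Walk.IsPath.mk' (by rwa [SimpleGraph.Walk.support_ofSupport])
    · rw [SimpleGraph.Walk.support_ofSupport]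
      exact hall
  · rw [SimpleGraph.Walk.length_ofSupport, hlen]
    omega
  · intro j hj
    rw [SimpleGraph.Walk.getVert_eq_support_getElem _
      (by rw [SimpleGraph.Walk.length_ofSupport, hlen]; omega)]
    simp only [SimpleGraph.Walk.support_ofSupport]
    simp [w]

/-! ### The continuous-time walk on a path -/

/-- Real amplitudes of a walk on the path `1, …, N` (with `y 0 = y (N + 1) = 0`), in the gauge in
which the Schrödinger equation reads `y_j' = y_{j-1} - y_{j+1}`. -/
structure IsPathWalk (N : ℕ) (y : ℕ → ℝ → ℝ) : Prop where
  zero : ∀ u, y 0 u = 0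
  last : ∀ u, y (N + 1) u = 0
  deriv : ∀ j < N, ∀ u, HasDerivAt (y (j + 1)) (y j u - y (j + 2) u) u

namespace IsPathWalk

variable {N : ℕ} {y : ℕ → ℝ → ℝ}

theorem const_of_deriv_zero {f : ℝ → ℝ} (h : ∀ u, HasDerivAt f 0 u) (u : ℝ) : f u = f 0 :=
  is_const_of_deriv_eq_zero (fun u => (h u).differentiableAt) (fun u => (h u).deriv) u 0

theorem le_of_deriv_nonneg {f f' : ℝ → ℝ} (h : ∀ u, HasDerivAt f (f' u) u) {a b : ℝ} (hab : a ≤ b)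
    (h' : ∀ u, a ≤ u → u ≤ b → 0 ≤ f' u) : f a ≤ f b := by
  refine monotoneOn_of_deriv_nonneg (convex_Icc a b)
    (fun u _ => (h u).continuousAt.continuousWithinAt)
    (fun u _ => (h u).differentiableAt.differentiableWithinAt) (fun u hu => ?_)
    (Set.left_mem_Icc.2 hab) (Set.right_mem_Icc.2 hab) hab
  rw [(h u).deriv]
  have := interior_subset hu
  exact h' u this.1 this.2

/-- The norm is conserved. -/
theorem sum_sq_eq (h : IsPathWalk N y) (u : ℝ) :
    ∑ j ∈ Finset.range N, y (j + 1) u ^ 2 = ∑ j ∈ Finset.range N, y (j + 1) 0 ^ 2 := by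
  refine const_of_deriv_zero (f := fun u => ∑ j ∈ Finset.range N, y (j + 1) u ^ 2)
    (fun u => ?_) u
  have h1 : HasDerivAt (fun u => ∑ j ∈ Finset.range N, y (j + 1) u ^ 2)
      (∑ j ∈ Finset.range N, 2 * (y j u * y (j + 1) u - y (j + 1) u * y (j + 1 + 1) u)) u := by
    refine HasDerivAt.fun_sum fun j hj => ?_
    have := (h.deriv j (Finset.mem_range.1 hj) u).pow 2
    refine this.congr_deriv ?_
    push_cast
    ring
  refine h1.congr_deriv ?_
  rw [← Finset.mul_sum, Finset.sum_range_sub' (fun j => y j u * y (j + 1) u), h.zero, h.last]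
  ring

/-- The velocity of a walk is again a walk. -/
theorem derivative (h : IsPathWalk N y) : IsPathWalk N fun j u =>
    if j = 0 ∨ j = N + 1 then 0 else y (j - 1) u - y (j + 1) u where
  zero u := by simp
  last u := by simp
  deriv j hj u := by
    have hD : ∀ i, i ≤ N + 1 → HasDerivAt (y i)
        (if i = 0 ∨ i = N + 1 then 0 else y (i - 1) u - y (i + 1) u) u := by
      intro i hi
      split_ifs with hc
      · have : y i = fun _ => 0 := by
          funext u
          rcases hc with rfl | rfl
          exacts [h.zero u, h.last u]
        rw [this]
        exact hasDerivAt_const u 0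
      · obtain ⟨i, rfl⟩ := Nat.exists_eq_succ_of_ne_zero (fun h => hc (Or.inl h))
        exact h.deriv i (by omega) u
    have e : ∀ v, (if j + 1 = 0 ∨ j + 1 = N + 1 then (0 : ℝ) else
        y (j + 1 - 1) v - y (j + 1 + 1) v) = y j v - y (j + 2) v := fun v => by
      rw [if_neg (by omega)]; rfl
    simp only [e]
    exact (hD j (by omega)).sub (hD (j + 2) (by omega))

theorem sum_linear (a : ℕ → ℝ) (n : ℕ) : ∑ j ∈ Finset.range n, ((j : ℝ) + 1) * (a j - a (j + 1)) =
    ∑ j ∈ Finset.range n, a j - n * a n := by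
  induction n with
  | zero => simp
  | succ n ih => rw [Finset.sum_range_succ, ih, Finset.sum_range_succ]; push_cast; ring

theorem sum_quadratic (a : ℕ → ℝ) (n : ℕ) :
    ∑ j ∈ Finset.range n, ((j : ℝ) + 1) ^ 2 * (a j - a (j + 1)) =
    ∑ j ∈ Finset.range n, (2 * (j : ℝ) + 1) * a j - n ^ 2 * a n := by
  induction n with
  | zero => simp
  | succ n ih => rw [Finset.sum_range_succ, ih, Finset.sum_range_succ]; push_cast; ring

theorem sum_odd (c : ℕ → ℝ) (n : ℕ) :
    ∑ j ∈ Finset.range n, (2 * (j : ℝ) + 3) * (c j - c (j + 1)) =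
    c 0 + 2 * ∑ j ∈ Finset.range n, c j - (2 * n + 1) * c n := by
  induction n with
  | zero => simp
  | succ n ih => rw [Finset.sum_range_succ, ih, Finset.sum_range_succ]; push_cast; ring

variable {M : ℕ}

/-- Derivative of the mean position. -/
theorem hasDerivAt_mean (h : IsPathWalk (M + 1) y) (u : ℝ) :
    HasDerivAt (fun u => ∑ j ∈ Finset.range (M + 1), ((j : ℝ) + 1) * y (j + 1) u ^ 2)
      (2 * ∑ j ∈ Finset.range M, y (j + 1) u * y (j + 2) u) u := by
  have h1 : HasDerivAt (fun u => ∑ j ∈ Finset.range (M + 1), ((j : ℝ) + 1) * y (j + 1) u ^ 2)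
      (∑ j ∈ Finset.range (M + 1), 2 * (((j : ℝ) + 1) *
        (y j u * y (j + 1) u - y (j + 1) u * y (j + 1 + 1) u))) u := by
    refine HasDerivAt.fun_sum fun j hj => ?_
    refine (((h.deriv j (Finset.mem_range.1 hj) u).pow 2).const_mul ((j : ℝ) + 1)).congr_deriv ?_
    push_cast
    ring
  refine h1.congr_deriv ?_
  rw [← Finset.mul_sum, sum_linear (fun j => y j u * y (j + 1) u), Finset.sum_range_succ']
  simp only [h.zero, h.last]
  ring_nf

/-- Derivative of the mean square of the position. -/
theorem hasDerivAt_meanSq (h : IsPathWalk (M + 1) y) (u : ℝ) :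
    HasDerivAt (fun u => ∑ j ∈ Finset.range (M + 1), ((j : ℝ) + 1) ^ 2 * y (j + 1) u ^ 2)
      (2 * ∑ j ∈ Finset.range M, (2 * (j : ℝ) + 3) * (y (j + 1) u * y (j + 2) u)) u := by
  have h1 : HasDerivAt (fun u => ∑ j ∈ Finset.range (M + 1), ((j : ℝ) + 1) ^ 2 * y (j + 1) u ^ 2)
      (∑ j ∈ Finset.range (M + 1), 2 * (((j : ℝ) + 1) ^ 2 *
        (y j u * y (j + 1) u - y (j + 1) u * y (j + 1 + 1) u))) u := by
    refine HasDerivAt.fun_sum fun j hj => ?_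
    refine (((h.deriv j (Finset.mem_range.1 hj) u).pow 2).const_mul
      (((j : ℝ) + 1) ^ 2)).congr_deriv ?_
    push_cast
    ring
  refine h1.congr_deriv ?_
  rw [← Finset.mul_sum, sum_quadratic (fun j => y j u * y (j + 1) u), Finset.sum_range_succ']
  simp only [h.zero, h.last]
  push_cast
  simp only [zero_mul, mul_zero, add_zero, sub_zero]
  congr 1
  refine Finset.sum_congr rfl fun j _ => ?_
  ring

theorem hasDerivAt_hop (h : IsPathWalk (M + 1) y) {j : ℕ} (hj : j < M) (u : ℝ) :
    HasDerivAt (fun u => y (j + 1) u * y (j + 2) u)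
      ((y j u * y (j + 2) u - y (j + 1) u * y (j + 1 + 2) u) +
        (y (j + 1) u ^ 2 - y (j + 1 + 1) u ^ 2)) u := by
  refine ((h.deriv j (by omega) u).mul (h.deriv (j + 1) (by omega) u)).congr_deriv ?_
  ring

theorem hasDerivAt_sum_hop (h : IsPathWalk (M + 1) y) (u : ℝ) :
    HasDerivAt (fun u => ∑ j ∈ Finset.range M, y (j + 1) u * y (j + 2) u)
      (y 1 u ^ 2 - y (M + 1) u ^ 2) u := by
  refine (HasDerivAt.fun_sum fun j hj =>
    h.hasDerivAt_hop (Finset.mem_range.1 hj) u).congr_deriv ?_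
  rw [Finset.sum_add_distrib, Finset.sum_range_sub' (fun j => y j u * y (j + 2) u),
    Finset.sum_range_sub' (fun j => y (j + 1) u ^ 2), h.zero, h.last]
  ring

theorem hasDerivAt_sum_odd_hop (h : IsPathWalk (M + 1) y) (u : ℝ) :
    HasDerivAt (fun u => ∑ j ∈ Finset.range M, (2 * (j : ℝ) + 3) * (y (j + 1) u * y (j + 2) u))
      (2 * ∑ j ∈ Finset.range M, y j u * y (j + 2) u + y 1 u ^ 2 +
        2 * ∑ j ∈ Finset.range (M + 1), y (j + 1) u ^ 2 - (2 * M + 3) * y (M + 1) u ^ 2) u := by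
  refine (HasDerivAt.fun_sum fun j hj =>
    (h.hasDerivAt_hop (Finset.mem_range.1 hj) u).const_mul (2 * (j : ℝ) + 3)).congr_deriv ?_
  simp only [mul_add]
  rw [Finset.sum_add_distrib, sum_odd (fun j => y j u * y (j + 2) u),
    sum_odd (fun j => y (j + 1) u ^ 2), h.zero, h.last, Finset.sum_range_succ _ M]
  ring

/-- The energy, expressed by next-to-nearest neighbour correlations. -/
theorem sum_velocity_sq (h : IsPathWalk (M + 1) y) (u : ℝ) :
    ∑ j ∈ Finset.range (M + 1), (y j u - y (j + 2) u) ^ 2 =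
      2 * ∑ j ∈ Finset.range (M + 1), y (j + 1) u ^ 2 - y 1 u ^ 2 - y (M + 1) u ^ 2 -
        2 * ∑ j ∈ Finset.range M, y j u * y (j + 2) u := by
  have h1 : ∑ j ∈ Finset.range (M + 1), y j u ^ 2 =
      ∑ j ∈ Finset.range (M + 1), y (j + 1) u ^ 2 - y (M + 1) u ^ 2 := by
    rw [Finset.sum_range_succ', Finset.sum_range_succ _ M, h.zero]; ring
  have h2 : ∑ j ∈ Finset.range (M + 1), y (j + 2) u ^ 2 =
      ∑ j ∈ Finset.range (M + 1), y (j + 1) u ^ 2 - y 1 u ^ 2 := by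
    rw [Finset.sum_range_succ, Finset.sum_range_succ' _ M, h.last]; ring
  have h3 : ∑ j ∈ Finset.range M, y j u * y (j + 2) u =
      ∑ j ∈ Finset.range (M + 1), y j u * y (j + 2) u := by
    rw [Finset.sum_range_succ, h.last]; ring
  have e : ∀ j, (y j u - y (j + 2) u) ^ 2 =
      y j u ^ 2 + y (j + 2) u ^ 2 - 2 * (y j u * y (j + 2) u) := fun j => by ring
  simp only [e]
  rw [Finset.sum_sub_distrib, Finset.sum_add_distrib, h1, h2, h3, ← Finset.mul_sum]
  ring

/-- The walk started at the end `1` of a path of length at least `2t` has left the first quarter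
of `[0, t]` with probability at least `1/3`. The proof follows the observable `G = tX - X²/4`. Since
`2t ≤ N + 1`, the other end of the path contributes to `G''` with a nonnegative sign, so `G''` is
bounded below, and positive enough at early times to give `G(t) ≥ (7/12)t²`. On the other hand
`tX - X²/4` is at most `t²` everywhere and at most `t²/4` on the first quarter; so the remaining
positions carry the weight `7/12 - 1/4 = 1/3`. -/
theorem escape (h : IsPathWalk N y) (hN : 2 ≤ N) (h1 : y 1 0 = 1)
    (h0 : ∀ j, 1 < j → j ≤ N → y j 0 = 0) {t : ℝ} (ht : 1 ≤ t) (htN : 2 * t ≤ N + 1) :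
    1 / 3 ≤ ∑ j ∈ Finset.range N with t / 4 ≤ ((j : ℕ) : ℝ) + 1, y (j + 1) t ^ 2 := by
  obtain ⟨M, rfl⟩ : ∃ M, N = M + 1 := ⟨N - 1, by omega⟩
  have hy0 : ∀ j, j ≤ M + 2 → y j 0 = if j = 1 then 1 else 0 := by
    intro j hj
    split_ifs with hj1
    · rw [hj1, h1]
    · rcases Nat.lt_or_ge 1 j with hlt | hge
      · rcases Nat.lt_or_ge (M + 1) j with hl | hl
        · rw [show j = M + 1 + 1 by omega, h.last]
        · exact h0 j hlt hl
      · rw [show j = 0 by omega, h.zero]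
  -- conserved quantities
  have hS : ∀ u, ∑ j ∈ Finset.range (M + 1), y (j + 1) u ^ 2 = 1 := by
    intro u
    rw [h.sum_sq_eq, Finset.sum_eq_single 0]
    · simp [h1]
    · intro j hj hj0
      have := Finset.mem_range.1 hj
      rw [hy0 _ (by omega), if_neg (by omega)]; simp
    · simp
  have hE : ∀ u, ∑ j ∈ Finset.range (M + 1), (y j u - y (j + 2) u) ^ 2 = 1 := by
    intro u
    have h2 := h.derivative.sum_sq_eq u
    have e : ∀ v, ∑ j ∈ Finset.range (M + 1), (if j + 1 = 0 ∨ j + 1 = M + 1 + 1 then (0 : ℝ) else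
        y (j + 1 - 1) v - y (j + 1 + 1) v) ^ 2 =
        ∑ j ∈ Finset.range (M + 1), (y j v - y (j + 2) v) ^ 2 := by
      intro v
      refine Finset.sum_congr rfl fun j hj => ?_
      have := Finset.mem_range.1 hj
      rw [if_neg (by omega)]; rfl
    rw [e, e] at h2
    rw [h2, Finset.sum_eq_single 1]
    · rw [h1, hy0 3 (by omega)]; simp
    · intro j hj hj1
      have := Finset.mem_range.1 hj
      rw [hy0 j (by omega), hy0 (j + 2) (by omega), if_neg hj1, if_neg (by omega)]; simp
    · intro hM
      rw [Finset.mem_range] at hM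
      omega
  -- the amplitude at the starting point decays slowly
  have hw : ∀ u, y 1 u - y 3 u ≤ 1 := by
    intro u
    have h2 := Finset.single_le_sum (f := fun j => (y j u - y (j + 2) u) ^ 2)
      (fun j _ => sq_nonneg _) (Finset.mem_range.2 (show 1 < M + 1 by omega))
    rw [hE] at h2
    exact (abs_le_one_iff_mul_self_le_one.2 (by rw [← sq]; exact h2) |> abs_le.1).2
  have hy2 : ∀ u, 0 ≤ u → y 2 u ≤ u := by
    intro u hu
    have h2 := le_of_deriv_nonneg (f := fun v => v - y 2 v)
      (fun v => (hasDerivAt_id v).sub (h.deriv 1 (by omega) v)) hu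
      fun v _ _ => by have := hw v; simp only [Nat.reduceAdd] at *; linarith
    have h3 := hy0 2 (by omega)
    simp only [OfNat.ofNat_ne_one, if_false] at h3
    simp only [h3] at h2
    linarith
  have hy1 : ∀ u, 0 ≤ u → 1 - u ^ 2 / 2 ≤ y 1 u := by
    intro u hu
    have h2 := le_of_deriv_nonneg (f := fun v => y 1 v + v ^ 2 / 2)
      (fun v => (h.deriv 0 (by omega) v).add ((hasDerivAt_pow 2 v).div_const 2)) hu
      fun v hv _ => by
        have := hy2 v hv
        simp only [h.zero, zero_add]
        push_cast
        linarith
    simp only [h1] at h2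
    linarith
  -- the observable, its derivative, and the bound on the second derivative
  let G : ℝ → ℝ := fun u => t * (∑ j ∈ Finset.range (M + 1), ((j : ℝ) + 1) * y (j + 1) u ^ 2) -
    (∑ j ∈ Finset.range (M + 1), ((j : ℝ) + 1) ^ 2 * y (j + 1) u ^ 2) / 4
  let G' : ℝ → ℝ := fun u => t * (2 * ∑ j ∈ Finset.range M, y (j + 1) u * y (j + 2) u) -
    (2 * ∑ j ∈ Finset.range M, (2 * (j : ℝ) + 3) * (y (j + 1) u * y (j + 2) u)) / 4
  let G'' : ℝ → ℝ := fun u => 2 * t * y 1 u ^ 2 - 3 / 2 + (M + 2 - 2 * t) * y (M + 1) u ^ 2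
  have hG : ∀ u, HasDerivAt G (G' u) u := fun u =>
    ((h.hasDerivAt_mean u).const_mul t).sub ((h.hasDerivAt_meanSq u).div_const 4)
  have hG' : ∀ u, HasDerivAt G' (G'' u) u := by
    intro u
    refine ((((h.hasDerivAt_sum_hop u).const_mul 2).const_mul t).sub
      (((h.hasDerivAt_sum_odd_hop u).const_mul 2).div_const 4)).congr_deriv ?_
    have h2 := h.sum_velocity_sq u
    rw [hE, hS] at h2
    rw [hS]
    simp only [G'']
    linarith
  push_cast at htN
  have hG''pos : ∀ u, -(3 / 2) ≤ G'' u := by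
    intro u
    have : 0 ≤ (M + 2 - 2 * t) * y (M + 1) u ^ 2 :=
      mul_nonneg (by linarith) (sq_nonneg _)
    have : 0 ≤ 2 * t * y 1 u ^ 2 := by positivity
    simp only [G'']
    linarith
  have hG''small : ∀ u, 0 ≤ u → u ≤ 1 → 2 * t * (1 - u ^ 2) - 3 / 2 ≤ G'' u := by
    intro u hu hu1
    have h2 : 0 ≤ (M + 2 - 2 * t) * y (M + 1) u ^ 2 :=
      mul_nonneg (by linarith) (sq_nonneg _)
    have h3 : 1 - u ^ 2 ≤ y 1 u ^ 2 := by
      have h4 := hy1 u hu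
      have h5 : 0 ≤ 1 - u ^ 2 / 2 := by nlinarith
      have h6 := pow_le_pow_left₀ h5 h4 2
      nlinarith [sq_nonneg (u ^ 2)]
    have h4 : 2 * t * (1 - u ^ 2) ≤ 2 * t * y 1 u ^ 2 :=
      mul_le_mul_of_nonneg_left h3 (by linarith)
    simp only [G'']
    linarith
  have hsum0 : ∀ c : ℕ → ℝ, ∑ j ∈ Finset.range M, c j * (y (j + 1) 0 * y (j + 2) 0) = 0 := by
    intro c
    refine Finset.sum_eq_zero fun j hj => ?_
    have := Finset.mem_range.1 hj
    rw [hy0 (j + 2) (by omega), if_neg (by omega)]; simp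
  have hsum1 : ∀ c : ℕ → ℝ, ∑ j ∈ Finset.range (M + 1), c j * y (j + 1) 0 ^ 2 = c 0 := by
    intro c
    rw [Finset.sum_eq_single 0]
    · simp [h1]
    · intro j hj hj0
      have := Finset.mem_range.1 hj
      rw [hy0 _ (by omega), if_neg (by omega)]; simp
    · simp
  have hG'0 : G' 0 = 0 := by
    have h2 := hsum0 fun _ => 1
    simp only [one_mul] at h2
    simp only [G', h2, hsum0 (fun j => 2 * (j : ℝ) + 3)]
    ring
  have hG0 : G 0 = t - 1 / 4 := by
    simp only [G, hsum1 (fun j => (j : ℝ) + 1), hsum1 (fun j => ((j : ℝ) + 1) ^ 2)]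
    push_cast
    ring
  have hG'small : ∀ u, 0 ≤ u → u ≤ 1 → 2 * t * (u - u ^ 3 / 3) - 3 / 2 * u ≤ G' u := by
    intro u hu hu1
    have h2 := le_of_deriv_nonneg
      (f := fun v => G' v - (2 * t * (v - v ^ 3 / 3) - 3 / 2 * v))
      (fun v => (hG' v).sub ((((hasDerivAt_id v).sub ((hasDerivAt_pow 3 v).div_const 3)).const_mul
        (2 * t)).sub ((hasDerivAt_id v).const_mul (3 / 2)))) hu
      fun v hv hv1 => by
        have := hG''small v hv (hv1.trans hu1)
        push_cast
        linarith
    simp only [hG'0] at h2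
    linarith
  have hG1 : t - 1 / 4 + (5 / 6 * t - 3 / 4) ≤ G 1 := by
    have h2 := le_of_deriv_nonneg
      (f := fun v => G v - (2 * t * (v ^ 2 / 2 - v ^ 4 / 4 / 3) - 3 / 2 * (v ^ 2 / 2)))
      (fun v => (hG v).sub (((((hasDerivAt_pow 2 v).div_const 2).sub
        (((hasDerivAt_pow 4 v).div_const 4).div_const 3)).const_mul
        (2 * t)).sub (((hasDerivAt_pow 2 v).div_const 2).const_mul (3 / 2)))) zero_le_one
      fun v hv hv1 => by
        have := hG'small v hv hv1
        push_cast
        linarith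
    simp only [hG0] at h2
    linarith
  have hG'large : ∀ u, 1 ≤ u → 4 / 3 * t - 3 / 2 * u ≤ G' u := by
    intro u hu
    have h2 := le_of_deriv_nonneg (f := fun v => G' v + 3 / 2 * v)
      (fun v => (hG' v).add ((hasDerivAt_id v).const_mul (3 / 2))) hu
      fun v hv hv1 => by have := hG''pos v; linarith
    have h3 := hG'small 1 zero_le_one le_rfl
    linarith
  have hGt : 7 / 12 * t ^ 2 ≤ G t := by
    have h2 := le_of_deriv_nonneg
      (f := fun v => G v - (4 / 3 * t * v - 3 / 2 * (v ^ 2 / 2)))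
      (fun v => (hG v).sub (((hasDerivAt_id v).const_mul (4 / 3 * t)).sub
        (((hasDerivAt_pow 2 v).div_const 2).const_mul (3 / 2)))) ht
      fun v hv hv1 => by
        have := hG'large v hv
        push_cast
        linarith
    nlinarith
  -- the observable is at most `t²`, and at most `t²/4` on the first quarter
  have hupper : G t ≤ t ^ 2 * (∑ j ∈ Finset.range (M + 1) with t / 4 ≤ ((j : ℕ) : ℝ) + 1,
      y (j + 1) t ^ 2) + t ^ 2 / 4 := by
    have e : G t = ∑ j ∈ Finset.range (M + 1),
        (t * ((j : ℝ) + 1) - ((j : ℝ) + 1) ^ 2 / 4) * y (j + 1) t ^ 2 := by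
      simp only [G, Finset.mul_sum, Finset.sum_div, ← Finset.sum_sub_distrib]
      refine Finset.sum_congr rfl fun j _ => by ring
    have e2 : t ^ 2 / 4 = ∑ j ∈ Finset.range (M + 1), t ^ 2 / 4 * y (j + 1) t ^ 2 := by
      rw [← Finset.mul_sum, hS, mul_one]
    rw [e, e2, Finset.sum_filter, Finset.mul_sum, ← Finset.sum_add_distrib]
    refine Finset.sum_le_sum fun j _ => ?_
    have hj : (0 : ℝ) ≤ j := j.cast_nonneg
    have hsq := sq_nonneg (y (j + 1) t)
    split_ifs with hc
    · have h2 : t * ((j : ℝ) + 1) - ((j : ℝ) + 1) ^ 2 / 4 ≤ t ^ 2 := by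
        nlinarith [sq_nonneg (t - ((j : ℝ) + 1) / 2)]
      have h3 := mul_le_mul_of_nonneg_right h2 hsq
      have h4 : 0 ≤ t ^ 2 / 4 * y (j + 1) t ^ 2 := by positivity
      linarith
    · rw [mul_zero, zero_add]
      refine mul_le_mul_of_nonneg_right ?_ hsq
      push Not at hc
      nlinarith [sq_nonneg ((j : ℝ) + 1)]
  have ht2 : 0 < t ^ 2 := by positivity
  by_contra hlt
  push Not at hlt
  have := mul_lt_mul_of_pos_left hlt ht2
  linarith

end IsPathWalk

/-! ### The clock is long enough -/

/-- There are enough `(c + 1)`-subsets of an `m`-set. -/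
theorem eventually_pow_le_choose (c : ℕ) :
    ∀ᶠ m : ℕ in atTop, 2 * (m + 1) ^ c ≤ m.choose (c + 1) := by
  filter_upwards [eventually_ge_atTop (2 * 2 ^ c * (c + 1).factorial + c),
    eventually_ge_atTop (2 * c + 1)] with m hm hm2
  have h1 := Nat.pow_sub_le_descFactorial m (c + 1)
  rw [Nat.descFactorial_eq_factorial_mul_choose, Nat.add_sub_add_right] at h1
  refine Nat.le_of_mul_le_mul_left (le_trans ?_ h1) (c + 1).factorial_pos
  have h2 : (m + 1) ^ c ≤ 2 ^ c * (m - c) ^ c := by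
    rw [← mul_pow]
    exact Nat.pow_le_pow_left (by omega) c
  calc (c + 1).factorial * (2 * (m + 1) ^ c)
      ≤ (c + 1).factorial * (2 * (2 ^ c * (m - c) ^ c)) := by gcongr
    _ = (m - c) ^ c * (2 * 2 ^ c * (c + 1).factorial) := by ring
    _ ≤ (m - c) ^ c * (m - c) := Nat.mul_le_mul_left _ (by omega)
    _ = (m - c) ^ (c + 1) := (pow_succ _ _).symm

theorem le_clockQubits_iff {s : ℕ → ℕ} {T : Polynomial ℕ} {c : ℕ} (hc : 1 ≤ c) (n i : ℕ) :
    i ≤ clockQubits s T c n ↔ i ^ c ≤ clockLength s T n := by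
  rw [clockQubits, Nat.le_floor_iff (by positivity), one_div,
    Real.le_rpow_inv_iff_of_pos (by positivity) (by positivity) (by exact_mod_cast hc),
    Real.rpow_natCast]
  exact_mod_cast Iff.rfl

theorem clockQubits_eq (s : ℕ → ℕ) (T : Polynomial ℕ) {c : ℕ} (hc : 1 ≤ c) (n : ℕ) :
    clockQubits s T c n = ((List.range (clockLength s T n)).filter
      fun i => decide ((i + 1) ^ c ≤ clockLength s T n)).length := by
  have hle : clockQubits s T c n ≤ clockLength s T n := by
    have h1 := (le_clockQubits_iff (s := s) (T := T) hc n _).1 le_rfl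
    exact (Nat.le_self_pow (by omega) _).trans h1
  obtain ⟨r, hr⟩ := Nat.exists_eq_add_of_le hle
  have hiff := le_clockQubits_iff (s := s) (T := T) hc n
  rw [show List.range (clockLength s T n) = List.range (clockQubits s T c n + r) by rw [← hr],
    List.range_add, List.filter_append, List.filter_eq_self.2, List.filter_eq_nil_iff.2,
    List.append_nil, List.length_range]
  · simp only [List.mem_map, List.mem_range, decide_eq_true_eq]
    rintro _ ⟨i, -, rfl⟩ h
    have := (hiff _).2 h
    omega
  · intro i hi
    rw [List.mem_range] at hi
    exact decide_eq_true ((hiff _).1 hi)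

theorem lt_clockQubits_succ_pow {s : ℕ → ℕ} {T : Polynomial ℕ} {c : ℕ} (hc : 1 ≤ c) (n : ℕ) :
    clockLength s T n < (clockQubits s T c n + 1) ^ c := by
  by_contra h
  push Not at h
  have := (le_clockQubits_iff (s := s) (T := T) hc n _).2 h
  omega

theorem one_le_eval {T : Polynomial ℕ} (hT : T ≠ 0) {n : ℕ} (hn : 1 ≤ n) : 1 ≤ T.eval n := by
  rw [Polynomial.eval_eq_sum_range]
  have h1 := Finset.single_le_sum (f := fun i => T.coeff i * n ^ i) (fun i _ => Nat.zero_le _)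
    (Finset.mem_range.2 (Nat.lt_succ_self T.natDegree))
  refine le_trans ?_ h1
  have h2 : 0 < T.coeff T.natDegree :=
    Nat.pos_of_ne_zero (Polynomial.leadingCoeff_ne_zero.2 hT)
  exact Nat.one_le_iff_ne_zero.2 (by positivity)

theorem tendsto_size {s : ℕ → ℕ} (F : IteratedFunction s) : Tendsto s atTop atTop := by
  obtain ⟨a, ha, h⟩ := F.s_linear
  rw [← tendsto_natCast_atTop_iff (R := ℝ)]
  exact tendsto_atTop_mono' _ h (tendsto_natCast_atTop_atTop.const_mul_atTop ha)

theorem tendsto_clockQubits {s : ℕ → ℕ} (F : IteratedFunction s) {T : Polynomial ℕ} (hT : T ≠ 0)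
    {c : ℕ} (hc : 1 ≤ c) : Tendsto (clockQubits s T c) atTop atTop := by
  rw [tendsto_atTop]
  intro b
  filter_upwards [(tendsto_size F).eventually_ge_atTop (b ^ c), eventually_ge_atTop 1] with n hn hn1
  rw [le_clockQubits_iff hc, clockLength]
  have := one_le_eval hT hn1
  nlinarith

/-- The revolving-door path is long enough for `2T + 1` runs of the circuit. -/
theorem eventually_le_choose {s : ℕ → ℕ} (F : IteratedFunction s) {T : Polynomial ℕ} (hT : T ≠ 0)
    {c : ℕ} (hc : 1 ≤ c) : ∀ᶠ n : ℕ in atTop,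
    (2 * T.eval n + 1) * s n ≤ (clockQubits s T c n).choose (c + 1) := by
  filter_upwards [(tendsto_clockQubits F hT hc).eventually (eventually_pow_le_choose c),
    eventually_ge_atTop 1] with n hn hn1
  refine le_trans ?_ hn
  have h1 := lt_clockQubits_succ_pow (s := s) (T := T) hc n
  have h2 := one_le_eval hT hn1
  rw [clockLength] at h1
  nlinarith

/-! ### Gates on unboundedly many wires -/

/-- A gate whose wires are natural numbers. -/
inductive RGate : Type
  | had (q : ℕ) : RGate
  | tee (q : ℕ) : RGate
  | cnot (c t : ℕ) : RGate

/-- States of a register with wires `0, 1, 2, …`. -/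
abbrev Wave : Type := (ℕ → Bool) → ℂ

/-- The eighth root of unity of the `T` gate. -/
noncomputable def teePhase : ℂ := Complex.exp (Complex.I * Real.pi / 4)

theorem teePhase_pow_four : teePhase ^ 4 = -1 := by
  rw [teePhase, ← Complex.exp_nat_mul,
    show ((4 : ℕ) : ℂ) * (Complex.I * Real.pi / 4) = Real.pi * Complex.I by push_cast; ring,
    Complex.exp_pi_mul_I]

namespace RGate

/-- The wires of a gate. -/
def wires : RGate → Finset ℕ
  | had q => {q}
  | tee q => {q}
  | cnot c t => {c, t}

/-- The gate makes sense on `N` qubits. -/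
def Valid (N : ℕ) : RGate → Prop
  | had q => q < N
  | tee q => q < N
  | cnot c t => c < N ∧ t < N ∧ c ≠ t

instance : TreeEnc RGate := ⟨fun g => match g with
  | had q => .node (.ofNat 0) (.ofNat q)
  | tee q => .node (.ofNat 1) (.ofNat q)
  | cnot c t => .node (.ofNat 2) (.node (.ofNat c) (.ofNat t))⟩

/-- The action of a gate. All gates are symmetric matrices, so a state, as a function on basis
states, is pulled back along the classical gates. -/
noncomputable def ap : RGate → Wave → Wave
  | had q, ψ => fun z => (ψ (Function.update z q false) +
      (if z q then -1 else 1) * ψ (Function.update z q true)) / (Real.sqrt 2 : ℂ)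
  | tee q, ψ => fun z => (if z q then teePhase else 1) * ψ z
  | cnot c t, ψ => fun z => ψ (Function.update z t (xor (z t) (z c)))

/-- The action of a sequence of gates. -/
noncomputable def run (G : List RGate) (ψ : Wave) : Wave := G.foldl (fun ψ g => g.ap ψ) ψ

theorem run_nil (ψ : Wave) : run [] ψ = ψ := rfl

theorem run_cons (g : RGate) (G : List RGate) (ψ : Wave) : run (g :: G) ψ = run G (g.ap ψ) := rfl

theorem run_append (G G' : List RGate) (ψ : Wave) : run (G ++ G') ψ = run G' (run G ψ) :=
  List.foldl_append

/-- Gates on disjoint sets of wires commute. -/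
theorem ap_comm {g h : RGate} (hd : Disjoint g.wires h.wires) (ψ : Wave) :
    g.ap (h.ap ψ) = h.ap (g.ap ψ) := by
  funext z
  cases g <;> cases h <;> simp only [wires, Finset.disjoint_singleton, Finset.disjoint_insert_left,
    Finset.disjoint_insert_right, Finset.mem_insert, Finset.mem_singleton, not_or] at hd <;>
    simp only [ap]
  case had.had q r =>
    simp only [Function.update_of_ne hd, Function.update_of_ne (Ne.symm hd),
      Function.update_comm hd]
    ring
  case had.tee q r =>
    simp only [Function.update_of_ne (Ne.symm hd)]
    ring
  case had.cnot q c t =>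
    rw [Function.update_of_ne hd.2]
    have h1 : c ≠ q := by tauto
    simp only [Function.update_of_ne h1, Function.update_of_ne (Ne.symm hd.2),
      Function.update_comm hd.2]
  case tee.had q r =>
    simp only [Function.update_of_ne hd]
    ring
  case tee.tee q r => ring
  case tee.cnot q c t => rw [Function.update_of_ne hd.2]
  case cnot.had c t q =>
    simp only [Function.update_of_ne hd.1, Function.update_of_ne hd.2,
      Function.update_of_ne (Ne.symm hd.2), Function.update_comm hd.2]
  case cnot.tee c t q => rw [Function.update_of_ne (Ne.symm hd.2)]
  case cnot.cnot c t c' t' =>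
    obtain ⟨⟨h1, h2⟩, h3, h4⟩ := hd
    have a1 : c ≠ t' := by tauto
    have a2 : t ≠ t' := by tauto
    have a3 : c' ≠ t := by tauto
    rw [Function.update_of_ne a1, Function.update_of_ne a2, Function.update_of_ne a3,
      Function.update_of_ne (Ne.symm a2), Function.update_comm a2]

theorem ap_run_comm {g : RGate} {G : List RGate} (hd : ∀ h ∈ G, Disjoint g.wires h.wires)
    (ψ : Wave) : run G (g.ap ψ) = g.ap (run G ψ) := by
  induction G generalizing ψ with
  | nil => rfl
  | cons h G ih =>
    rw [run_cons, ← ap_comm (hd h (by simp)), ih fun h' hh' => hd h' (by simp [hh']), run_cons]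

theorem run_comm {G G' : List RGate} (hd : ∀ g ∈ G, ∀ h ∈ G', Disjoint g.wires h.wires)
    (ψ : Wave) : run G (run G' ψ) = run G' (run G ψ) := by
  induction G generalizing ψ with
  | nil => rfl
  | cons g G ih =>
    rw [run_cons, run_cons, ← ih fun g' hg' => hd g' (by simp [hg']),
      ap_run_comm (hd g (by simp))]

/-! ### Classical gates -/

/-- The gates `G` multiply the basis state `z` by `f z`. -/
def IsDiag (G : List RGate) (f : (ℕ → Bool) → ℂ) : Prop := ∀ ψ z, run G ψ z = f z * ψ z

theorem IsDiag.append {G G' : List RGate} {f f' : (ℕ → Bool) → ℂ} (h : IsDiag G f)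
    (h' : IsDiag G' f') : IsDiag (G ++ G') fun z => f z * f' z := by
  intro ψ z
  rw [run_append, h', h]
  ring

theorem IsDiag.teePow (q k : ℕ) :
    IsDiag (List.replicate k (tee q)) fun z => if z q then teePhase ^ k else 1 := by
  induction k with
  | zero => intro ψ z; simp [run_nil]
  | succ k ih =>
    intro ψ z
    rw [List.replicate_succ, run_cons, ih, ap]
    dsimp only
    split_ifs <;> ring

theorem IsDiag.conj_cnot {G : List RGate} {f : (ℕ → Bool) → ℂ} (h : IsDiag G f) {c t : ℕ}
    (hct : c ≠ t) : IsDiag (cnot c t :: G ++ [cnot c t])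
      fun z => f (Function.update z t (xor (z t) (z c))) := by
  intro ψ z
  rw [List.cons_append, run_cons, run_append, run_cons, run_nil]
  simp only [ap, h _ _]
  rw [Function.update_idem, Function.update_self, Function.update_of_ne hct]
  simp

/-- Conjugation by a Hadamard gate turns a conditional phase into a conditional flip. -/
theorem IsDiag.conj_had {G : List RGate} {f : (ℕ → Bool) → ℂ} (h : IsDiag G f) {t : ℕ}
    {v : (ℕ → Bool) → Bool} (h0 : ∀ z, f (Function.update z t false) = 1)
    (h1 : ∀ z, f (Function.update z t true) = if v z then -1 else 1) (ψ : Wave) :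
    run (had t :: G ++ [had t]) ψ =
      fun z => ψ (Function.update z t (xor (z t) (v z))) := by
  funext z
  have h2 : ((Real.sqrt 2 : ℝ) : ℂ) ≠ 0 := by simp
  have h3 : ((Real.sqrt 2 : ℝ) : ℂ) * (Real.sqrt 2 : ℝ) = 2 := by
    rw [← Complex.ofReal_mul, Real.mul_self_sqrt (by norm_num)]; norm_num
  rw [List.cons_append, run_cons, run_append, run_cons, run_nil]
  simp only [ap, h _ _, h0, h1, Function.update_self, Function.update_idem]
  cases hv : v z <;> cases hz : z t <;> simp <;> field_simp <;> rw [sq, h3] <;> ring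

/-- A Toffoli gate; the doubly controlled phase comes from
`4abt = a + b + t - (a ⊕ b) - (b ⊕ t) - (a ⊕ t) + (a ⊕ b ⊕ t)`, with `T⁷` for the inverse of
`T`. -/
def toffSteps : List (ℕ × ℕ × ℕ → RGate) :=
  (fun x => had x.2.2) ::
    (([fun x => tee x.1] ++ [fun x => tee x.2.1] ++ [fun x => tee x.2.2] ++
      ((fun x => cnot x.1 x.2.1) :: List.replicate 7 (fun x => tee x.2.1) ++
        [fun x => cnot x.1 x.2.1]) ++
      ((fun x => cnot x.2.1 x.2.2) :: List.replicate 7 (fun x => tee x.2.2) ++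
        [fun x => cnot x.2.1 x.2.2]) ++
      ((fun x => cnot x.1 x.2.2) :: (List.replicate 7 (fun x => tee x.2.2) ++
        ((fun x => cnot x.2.1 x.2.2) :: [fun x => tee x.2.2] ++ [fun x => cnot x.2.1 x.2.2])) ++
        [fun x => cnot x.1 x.2.2]))) ++
    [fun x => had x.2.2]

/-- A NOT gate, `H T⁴ H`. -/
def invSteps : List (ℕ → RGate) := had :: List.replicate 4 tee ++ [had]

theorem run_invSteps (t : ℕ) (ψ : Wave) :
    run (invSteps.map fun st => st t) ψ = fun z => ψ (Function.update z t (!z t)) := by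
  have h := (IsDiag.teePow t 4).conj_had (t := t) (v := fun _ => true) (by simp)
    (by simp [teePhase_pow_four]) ψ
  simpa [invSteps] using h

theorem run_toffSteps {a b t : ℕ} (hab : a ≠ b) (hat : a ≠ t) (hbt : b ≠ t) (ψ : Wave) :
    run (toffSteps.map fun st => st (a, b, t)) ψ =
      fun z => ψ (Function.update z t (xor (z t) (z a && z b))) := by
  have w7 : teePhase ^ 7 = -teePhase ^ 3 := by
    rw [show (7 : ℕ) = 4 + 3 from rfl, pow_add, teePhase_pow_four]; ring
  have hmid := ((((((IsDiag.teePow a 1).append (IsDiag.teePow b 1)).append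
    (IsDiag.teePow t 1)).append ((IsDiag.teePow b 7).conj_cnot hab)).append
    ((IsDiag.teePow t 7).conj_cnot hbt))).append
    (((IsDiag.teePow t 7).append ((IsDiag.teePow t 1).conj_cnot hbt)).conj_cnot hat)
  have h := hmid.conj_had (t := t) (v := fun z => z a && z b) ?_ ?_ ψ
  · simpa [toffSteps] using h
  · intro z
    have w := teePhase_pow_four
    simp only [Function.update_self, Function.update_of_ne hat, Function.update_of_ne hbt,
      pow_one, w7]
    cases z a <;> cases z b <;> simp <;> linear_combination (teePhase ^ 4 - 1) * w
  · intro z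
    have w := teePhase_pow_four
    simp only [Function.update_self, Function.update_of_ne hat, Function.update_of_ne hbt,
      pow_one, w7]
    cases z a <;> cases z b <;> simp <;>
      first | linear_combination (teePhase ^ 4 - 1) * w | linear_combination w

end RGate

/-- Classical reversible gates: NOT, CNOT and Toffoli. -/
inductive COp : Type
  | inv (t : ℕ) : COp
  | cnot (a t : ℕ) : COp
  | toff (a b t : ℕ) : COp

namespace COp

/-- The wire that is changed. -/
def tgt : COp → ℕ
  | inv t => t
  | cnot _ t => t
  | toff _ _ t => t

/-- The wires that are read. -/
def ctrls : COp → Finset ℕ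
  | inv _ => ∅
  | cnot a _ => {a}
  | toff a b _ => {a, b}

/-- The bit that is added to the target. -/
def val : COp → (ℕ → Bool) → Bool
  | inv _, _ => true
  | cnot a _, z => z a
  | toff a b _, z => z a && z b

/-- The wires of a classical gate. -/
def wires (o : COp) : Finset ℕ := insert o.tgt o.ctrls

/-- The wires of the gate are distinct. -/
def Ok : COp → Prop
  | inv _ => True
  | cnot a t => a ≠ t
  | toff a b t => a ≠ b ∧ a ≠ t ∧ b ≠ t

/-- The action on basis states. -/
def act (o : COp) (z : ℕ → Bool) : ℕ → Bool :=
  Function.update z o.tgt (xor (z o.tgt) (o.val z))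

/-- The action of a list of gates, the last one first; the order does not matter within a layer. -/
def actL (l : List COp) (z : ℕ → Bool) : ℕ → Bool := l.foldr act z

theorem val_congr (o : COp) {z z' : ℕ → Bool} (h : ∀ i ∈ o.ctrls, z i = z' i) :
    o.val z = o.val z' := by
  cases o <;> simp_all [val, ctrls]

theorem Ok.tgt_notMem {o : COp} (h : o.Ok) : o.tgt ∉ o.ctrls := by
  cases o with
  | inv t => simp [ctrls]
  | cnot a t => simpa [ctrls, tgt] using Ne.symm h
  | toff a b t =>
    have h1 := Ne.symm h.2.1
    have h2 := Ne.symm h.2.2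
    simp [ctrls, tgt, h1, h2]

/-- Gates that act on disjoint sets of distinct wires. -/
def Layer (l : List COp) : Prop := (∀ o ∈ l, o.Ok) ∧ l.Pairwise fun o o' => Disjoint o.wires o'.wires

theorem actL_of_forall_ne {l : List COp} {i : ℕ} (h : ∀ o ∈ l, o.tgt ≠ i) (z : ℕ → Bool) :
    actL l z i = z i := by
  induction l with
  | nil => rfl
  | cons o l ih =>
    show Function.update (actL l z) o.tgt _ i = _
    rw [Function.update_of_ne (Ne.symm (h o (by simp))), ih fun o' h' => h o' (by simp [h'])]

theorem Layer.actL_tgt {l : List COp} (hl : Layer l) {o : COp} (ho : o ∈ l) (z : ℕ → Bool) :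
    actL l z o.tgt = xor (z o.tgt) (o.val z) := by
  induction l with
  | nil => simp at ho
  | cons o' l ih =>
    obtain ⟨h1, h2⟩ := hl
    rw [List.pairwise_cons] at h2
    have hl' : Layer l := ⟨fun o h => h1 o (by simp [h]), h2.2⟩
    show Function.update (actL l z) o'.tgt (xor (actL l z o'.tgt) (o'.val (actL l z))) o.tgt = _
    rcases List.mem_cons.1 ho with rfl | ho
    · have h3 : ∀ i ∈ o.wires, actL l z i = z i := fun i hi =>
        actL_of_forall_ne (fun o'' h'' heq => by
          have h4 : i ∈ o''.wires := by rw [← heq]; simp [wires]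
          exact Finset.disjoint_left.1 (h2.1 o'' h'') hi h4) z
      rw [Function.update_self, h3 _ (by simp [wires]), val_congr o fun i hi =>
        h3 i (by simp [wires, hi])]
    · have h3 : o.tgt ≠ o'.tgt := fun heq =>
        Finset.disjoint_left.1 (h2.1 o ho) (by simp [wires] : o'.tgt ∈ o'.wires)
          (heq ▸ by simp [wires])
      rw [Function.update_of_ne h3, ih hl' ho]

theorem Layer.ctrl_ne_tgt {l : List COp} (hl : Layer l) {o o' : COp} (ho : o ∈ l) (ho' : o' ∈ l)
    {i : ℕ} (hi : i ∈ o.ctrls) : o'.tgt ≠ i := by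
  by_cases h : o = o'
  · subst h
    exact fun heq => (hl.1 o ho).tgt_notMem (heq ▸ hi)
  · have hsymm : Std.Symm fun o o' : COp => Disjoint o.wires o'.wires :=
      ⟨fun _ _ h => Disjoint.symm h⟩
    have hp : l.Pairwise fun o o' => Disjoint o.wires o'.wires := hl.2
    have := hp.forall ho ho' h
    intro heq
    have h4 : i ∈ o'.wires := by rw [← heq]; simp [wires]
    exact Finset.disjoint_left.1 this (by simp [wires, hi]) h4

theorem Layer.actL_actL {l : List COp} (hl : Layer l) (z : ℕ → Bool) : actL l (actL l z) = z := by
  funext i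
  by_cases h : ∃ o ∈ l, o.tgt = i
  · obtain ⟨o, ho, rfl⟩ := h
    rw [hl.actL_tgt ho, hl.actL_tgt ho, val_congr o (z := actL l z) (z' := z) fun i hi =>
      actL_of_forall_ne (fun o' ho' => hl.ctrl_ne_tgt ho ho' hi) z]
    simp
  · push Not at h
    rw [actL_of_forall_ne h, actL_of_forall_ne h]

end COp

/-! ### Parallel execution -/

namespace RGate

/-- Layers that carry out the same steps on several objects in parallel. -/
def block {ι : Type} (steps : List (ι → RGate)) (l : List ι) : List (List RGate) :=
  steps.map fun st => l.map st

theorem run_block {ι : Type} {steps : List (ι → RGate)} {W : ι → Finset ℕ}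
    (hW : ∀ st ∈ steps, ∀ x, (st x).wires ⊆ W x) {l : List ι}
    (hl : l.Pairwise fun x y => Disjoint (W x) (W y)) (ψ : Wave) :
    run (block steps l).flatten ψ = run (l.flatMap fun x => steps.map fun st => st x) ψ := by
  induction l generalizing ψ with
  | nil =>
    have : (block steps ([] : List ι)).flatten = [] := by
      simp [block]
    rw [this]; rfl
  | cons x l ih =>
    rw [List.pairwise_cons] at hl
    rw [List.flatMap_cons, run_append, ← ih hl.2]
    clear ih
    induction steps generalizing ψ with
    | nil => rfl
    | cons st steps ih =>
      have hW' : ∀ st ∈ steps, ∀ x, (st x).wires ⊆ W x := fun st h => hW st (by simp [h])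
      have e : ∀ l', (block (st :: steps) l').flatten = l'.map st ++ (block steps l').flatten :=
        fun l' => rfl
      rw [e, e, List.map_cons, List.cons_append, run_cons, run_append, ih hW', List.map_cons,
        run_cons, run_append]
      congr 1
      refine run_comm ?_ _
      simp only [List.mem_map]
      rintro _ ⟨st', hst', rfl⟩ _ ⟨y, hy, rfl⟩
      exact (hl.1 y hy).mono (hW' st' hst' x) (hW st (by simp) y)

/-- The layers that execute NOT gates in parallel. -/
def invBlock (l : List ℕ) : List (List RGate) := block invSteps l

/-- The layer that executes CNOT gates in parallel. -/
def cnotBlock (l : List (ℕ × ℕ)) : List (List RGate) := block [fun x => cnot x.1 x.2] l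

/-- The layers that execute Toffoli gates in parallel. -/
def toffBlock (l : List (ℕ × ℕ × ℕ)) : List (List RGate) := block toffSteps l

/-- The layers `B` execute the layer `l` of classical gates. -/
def Executes (B : List (List RGate)) (l : List COp) : Prop :=
  COp.Layer l → ∀ ψ : Wave, run B.flatten ψ = fun z => ψ (COp.actL l z)

theorem executes_block {ι : Type} {steps : List (ι → RGate)} {l : List ι} (o : ι → COp)
    (hW : ∀ st ∈ steps, ∀ x, (st x).wires ⊆ (o x).wires)
    (h : ∀ x, (o x).Ok → ∀ ψ : Wave, run (steps.map fun st => st x) ψ = fun z => ψ ((o x).act z)) :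
    Executes (block steps l) (l.map o) := by
  intro hl ψ
  have h2 := hl.2
  rw [List.pairwise_map] at h2
  rw [run_block hW h2]
  have h1 : ∀ x ∈ l, (o x).Ok := fun x hx => hl.1 _ (List.mem_map.2 ⟨x, hx, rfl⟩)
  clear hl h2
  induction l generalizing ψ with
  | nil => rfl
  | cons x l ih =>
    rw [List.flatMap_cons, run_append, h x (h1 x (by simp)), ih _ fun y hy => h1 y (by simp [hy])]
    rfl

theorem executes_invBlock (l : List ℕ) : Executes (invBlock l) (l.map .inv) := by
  refine executes_block _ ?_ fun x _ ψ => ?_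
  · intro st hst x
    simp only [invSteps, List.mem_append, List.mem_cons, List.mem_replicate] at hst
    rcases hst with (rfl | ⟨-, rfl⟩) | (rfl | h) <;>
      simp_all [COp.wires, COp.tgt, COp.ctrls, wires]
  · rw [run_invSteps]
    simp [COp.act, COp.tgt, COp.val]

theorem executes_cnotBlock (l : List (ℕ × ℕ)) :
    Executes (cnotBlock l) (l.map fun x => .cnot x.1 x.2) := by
  refine executes_block _ ?_ fun x _ ψ => rfl
  simp [COp.wires, COp.tgt, COp.ctrls, wires, Finset.pair_comm]

theorem toffSteps_wires {st : ℕ × ℕ × ℕ → RGate} (hst : st ∈ toffSteps) (x : ℕ × ℕ × ℕ) :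
    (st x).wires ⊆ {x.1, x.2.1, x.2.2} := by
  simp only [toffSteps, List.mem_append, List.mem_cons, List.mem_replicate, List.not_mem_nil,
    or_false] at hst
  intro i
  casesm* _ ∨ _, _ ∧ _ <;> subst_vars <;>
    simp only [wires, Finset.mem_insert, Finset.mem_singleton] <;> tauto

theorem executes_toffBlock (l : List (ℕ × ℕ × ℕ)) :
    Executes (toffBlock l) (l.map fun x => .toff x.1 x.2.1 x.2.2) := by
  refine executes_block _ ?_ fun x hx ψ => ?_
  · intro st hst x
    refine (toffSteps_wires hst x).trans ?_
    intro i hi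
    simp only [COp.wires, COp.tgt, COp.ctrls, Finset.mem_insert, Finset.mem_singleton] at *
    tauto
  · exact run_toffSteps hx.1 hx.2.1 hx.2.2 ψ

end RGate

/-! ### Matrices of gates and circuits -/

/-- The assignment `z` with its first `N` bits replaced by `w`. -/
def splice {N : ℕ} (z : ℕ → Bool) (w : Bits N) : ℕ → Bool :=
  fun i => if h : i < N then w ⟨i, h⟩ else z i

section splice

variable {N : ℕ} (z : ℕ → Bool) (w : Bits N)

theorem splice_of_lt {i : ℕ} (h : i < N) : splice z w i = w ⟨i, h⟩ := dif_pos h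

theorem splice_val (i : Fin N) : splice z w i = w i := dif_pos i.2

theorem splice_of_le {i : ℕ} (h : N ≤ i) : splice z w i = z i := dif_neg (by omega)

theorem splice_self : splice z (fun i : Fin N => z i) = z := by
  funext i
  unfold splice
  split_ifs <;> rfl

theorem update_splice (q : Fin N) (b : Bool) :
    Function.update (splice z w) q b = splice z (Function.update w q b) := by
  funext i
  by_cases h : i < N
  · by_cases hq : i = q
    · subst hq
      rw [Function.update_self, splice_val, Function.update_self]
    · rw [Function.update_of_ne hq, splice_of_lt _ _ h, splice_of_lt _ _ h, Function.update_of_ne]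
      exact fun h' => hq (congrArg Fin.val h')
  · have hq : i ≠ q := by have := q.2; omega
    rw [Function.update_of_ne hq, splice_of_le _ _ (by omega), splice_of_le _ _ (by omega)]

end splice

namespace QGate

variable {N : ℕ}

/-- The gate, forgetting the number of qubits. -/
def raw : QGate N → RGate
  | had q => .had q
  | tee q => .tee q
  | cnot c t _ => .cnot c t

theorem tree_raw (g : QGate N) : tree g.raw = g.toTree := by cases g <;> rfl

theorem wires_raw (g : QGate N) : g.raw.wires = g.wires.map Fin.valEmbedding := by
  cases g <;> simp [raw, wires, RGate.wires]

theorem valid_raw (g : QGate N) : g.raw.Valid N := by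
  cases g with
  | had q => exact q.2
  | tee q => exact q.2
  | cnot c t h => exact ⟨c.2, t.2, fun h' => h (Fin.ext h')⟩

theorem sum_onQubit (q : Fin N) (u : Matrix Bool Bool ℂ) (w : Bits N) (φ : Bits N → ℂ) :
    ∑ v, onQubit q u w v * φ v = u (w q) false * φ (Function.update w q false) +
      u (w q) true * φ (Function.update w q true) := by
  have h1 : ∀ v : Bits N, (∀ i, i ≠ q → w i = v i) ↔ v = Function.update w q (v q) := by
    intro v
    constructor
    · intro h
      funext i
      by_cases hi : i = q
      · subst hi; simp
      · rw [Function.update_of_ne hi, h i hi]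
    · intro h i hi
      rw [h, Function.update_of_ne hi]
  have h2 : ∑ v, onQubit q u w v * φ v =
      ∑ b : Bool, u (w q) b * φ (Function.update w q b) := by
    simp only [onQubit, Matrix.of_apply, h1, ite_mul, zero_mul]
    rw [← Finset.sum_filter]
    refine Finset.sum_nbij' (fun v => v q) (fun b => Function.update w q b) (by simp) (by simp)
      ?_ (by simp) ?_
    · intro v hv
      exact (Finset.mem_filter.1 hv).2.symm
    · intro v hv
      rw [← (Finset.mem_filter.1 hv).2]
  rw [h2, Fintype.sum_bool]
  ring

theorem mulVec_had (q : Fin N) (w : Bits N) (φ : Bits N → ℂ) :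
    ((had q).op.mulVec φ) w = (φ (Function.update w q false) +
      (if w q then -1 else 1) * φ (Function.update w q true)) / (Real.sqrt 2 : ℂ) := by
  simp only [Matrix.mulVec, dotProduct, op]
  rw [sum_onQubit]
  cases w q <;> simp <;> ring

theorem mulVec_tee (q : Fin N) (w : Bits N) (φ : Bits N → ℂ) :
    ((tee q).op.mulVec φ) w = (if w q then teePhase else 1) * φ w := by
  simp only [Matrix.mulVec, dotProduct, op]
  rw [sum_onQubit]
  have h : Function.update w q (w q) = w := by simp
  cases hw : w q <;> rw [hw] at h <;> simp [teePhase, h]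

theorem mulVec_cnot (c t : Fin N) (hne : c ≠ t) (w : Bits N) (φ : Bits N → ℂ) :
    ((cnot c t hne).op.mulVec φ) w = φ (Function.update w t (xor (w t) (w c))) := by
  have h1 : ∀ v : Bits N, w = Function.update v t (xor (v t) (v c)) ↔
      v = Function.update w t (xor (w t) (w c)) := by
    have h2 : ∀ v : Bits N, Function.update (Function.update v t (xor (v t) (v c))) t
        (xor (Function.update v t (xor (v t) (v c)) t)
          (Function.update v t (xor (v t) (v c)) c)) = v := by
      intro v
      rw [Function.update_idem, Function.update_self, Function.update_of_ne hne]
      simp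
    intro v
    constructor <;> rintro rfl <;> rw [h2]
  simp only [Matrix.mulVec, dotProduct, op, Matrix.of_apply, h1, ite_mul, one_mul, zero_mul]
  simp

/-- The matrix of a gate gives its action on any part of a larger register. -/
theorem ap_splice (g : QGate N) (ψ : Wave) (z : ℕ → Bool) (w : Bits N) :
    g.raw.ap ψ (splice z w) = (g.op.mulVec fun v => ψ (splice z v)) w := by
  cases g with
  | had q => rw [mulVec_had]; simp only [raw, RGate.ap, update_splice, splice_val]
  | tee q => rw [mulVec_tee]; simp only [raw, RGate.ap, splice_val]
  | cnot c t h => rw [mulVec_cnot]; simp only [raw, RGate.ap, update_splice, splice_val]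

theorem op_unitary (g : QGate N) : g.op ∈ Matrix.unitaryGroup (Bits N) ℂ := by
  rw [Matrix.mem_unitaryGroup_iff]
  have key : ∀ A B : QOp N, (∀ φ, A.mulVec (B.mulVec φ) = φ) → A * B = 1 := by
    intro A B h
    refine Matrix.ext_of_mulVec_single fun i => ?_
    rw [← Matrix.mulVec_mulVec, h, Matrix.one_mulVec]
  cases g with
  | had q =>
    have hs : star (had q).op = (had q).op := by
      ext x y
      simp only [op, onQubit, Matrix.star_apply, Matrix.of_apply]
      have e : (∀ i, i ≠ q → y i = x i) ↔ ∀ i, i ≠ q → x i = y i :=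
        ⟨fun h i hi => (h i hi).symm, fun h i hi => (h i hi).symm⟩
      simp only [e, Bool.and_comm (y q)]
      split_ifs <;> simp
    rw [hs]
    refine key _ _ fun φ => funext fun w => ?_
    have h2 : ((Real.sqrt 2 : ℝ) : ℂ) ≠ 0 := by simp
    have h3 : ((Real.sqrt 2 : ℝ) : ℂ) * (Real.sqrt 2 : ℝ) = 2 := by
      rw [← Complex.ofReal_mul, Real.mul_self_sqrt (by norm_num)]; norm_num
    have h4 : Function.update w q (w q) = w := by simp
    simp only [mulVec_had, Function.update_self, Function.update_idem]
    cases hw : w q <;> rw [hw] at h4 <;> simp [h4] <;> field_simp <;> rw [sq, h3] <;> ring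
  | tee q =>
    have hp : teePhase * star teePhase = 1 := by
      simp only [RCLike.star_def]
      rw [Complex.mul_conj, teePhase, Complex.normSq_eq_norm_sq,
        show Complex.I * (Real.pi : ℂ) / 4 = ((Real.pi / 4 : ℝ) : ℂ) * Complex.I by push_cast; ring,
        Complex.norm_exp_ofReal_mul_I]
      simp
    have hs : star (tee q).op =
        onQubit q (Matrix.diagonal fun b => if b then star teePhase else 1) := by
      ext x y
      simp only [op, onQubit, Matrix.star_apply, Matrix.of_apply]
      have e : (∀ i, i ≠ q → y i = x i) ↔ ∀ i, i ≠ q → x i = y i :=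
        ⟨fun h i hi => (h i hi).symm, fun h i hi => (h i hi).symm⟩
      simp only [e]
      by_cases hxy : ∀ i, i ≠ q → x i = y i
      · rw [if_pos hxy, if_pos hxy]
        cases x q <;> cases y q <;> simp [teePhase]
      · rw [if_neg hxy, if_neg hxy, star_zero]
    rw [hs]
    refine key _ _ fun φ => funext fun w => ?_
    rw [mulVec_tee]
    simp only [Matrix.mulVec, dotProduct]
    rw [sum_onQubit]
    have h4 : Function.update w q (w q) = w := by simp
    cases hw : w q <;> rw [hw] at h4 <;> simp only [h4]
    · simp
    · have : teePhase * (star teePhase * φ w) = φ w := by rw [← mul_assoc, hp, one_mul]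
      simpa using this
  | cnot c t h =>
    have hs : star (cnot c t h).op = (cnot c t h).op := by
      have h5 : ∀ x y : Bits N, (cnot c t h).op x y =
          if y = Function.update x t (xor (x t) (x c)) then 1 else 0 := by
        intro x y
        have := mulVec_cnot c t h x (Pi.single y 1)
        rw [Matrix.mulVec_single_one] at this
        rw [show (cnot c t h).op x y = (cnot c t h).op.col y x from rfl, this, Pi.single_apply]
        simp only [eq_comm]
      ext x y
      rw [Matrix.star_apply, h5]
      simp only [op, Matrix.of_apply]
      split_ifs <;> simp
    rw [hs]
    refine key _ _ fun φ => funext fun w => ?_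
    rw [mulVec_cnot, mulVec_cnot, Function.update_idem, Function.update_self,
      Function.update_of_ne h]
    simp

end QGate

/-- The unitary of a sequence of gates. -/
noncomputable def gatesOp {N : ℕ} (G : List (QGate N)) : QOp N := (G.reverse.map QGate.op).prod

section gatesOp

variable {N : ℕ}

theorem gatesOp_nil : gatesOp ([] : List (QGate N)) = 1 := rfl

theorem gatesOp_append (G G' : List (QGate N)) : gatesOp (G ++ G') = gatesOp G' * gatesOp G := by
  simp [gatesOp]

theorem gatesOp_singleton (g : QGate N) : gatesOp [g] = g.op := by simp [gatesOp]

theorem gatesOp_unitary (G : List (QGate N)) : gatesOp G ∈ Matrix.unitaryGroup (Bits N) ℂ :=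
  Submonoid.list_prod_mem _ fun u hu => by
    obtain ⟨g, -, rfl⟩ := List.mem_map.1 hu
    exact g.op_unitary

theorem run_splice (G : List (QGate N)) (ψ : Wave) (z : ℕ → Bool) (w : Bits N) :
    RGate.run (G.map QGate.raw) ψ (splice z w) =
      ((gatesOp G).mulVec fun v => ψ (splice z v)) w := by
  induction G generalizing ψ w with
  | nil => rw [gatesOp_nil, Matrix.one_mulVec]; rfl
  | cons g G ih =>
    rw [List.map_cons, RGate.run_cons, ih, show g :: G = [g] ++ G from rfl, gatesOp_append,
      gatesOp_singleton, ← Matrix.mulVec_mulVec]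
    congr 2
    funext v
    exact g.ap_splice ψ z v

end gatesOp

/-- The layers of a circuit, forgetting the number of qubits. -/
def QCircuit.raw {N : ℕ} (C : QCircuit N) : List (List RGate) := C.layers.map (List.map QGate.raw)

theorem QCircuit.tree_raw {N : ℕ} (C : QCircuit N) : tree (N, C.raw) = C.toTree := by
  have h : ∀ {α β : Type} (e : α → Tree₂) (e' : β → Tree₂) (f : α → β), (∀ a, e' (f a) = e a) →
      ∀ l : List α, Tree₂.ofList e' (l.map f) = Tree₂.ofList e l := by
    intro α β e e' f hf l
    induction l with
    | nil => rfl
    | cons a l ih => rw [List.map_cons, Tree₂.ofList, Tree₂.ofList, hf, ih]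
  show Tree₂.node _ _ = Tree₂.node _ _
  congr 1
  exact h _ _ _ (h _ _ _ QGate.tree_raw) _

theorem QCircuit.flatten_raw {N : ℕ} (C : QCircuit N) :
    C.raw.flatten = C.gates.map QGate.raw := by
  rw [raw, gates, List.map_flatten]

theorem RGate.Valid.exists_qGate {N : ℕ} {g : RGate} (h : g.Valid N) :
    ∃ g' : QGate N, g'.raw = g := by
  cases g with
  | had q => exact ⟨.had ⟨q, h⟩, rfl⟩
  | tee q => exact ⟨.tee ⟨q, h⟩, rfl⟩
  | cnot c t => exact ⟨.cnot ⟨c, h.1⟩ ⟨t, h.2.1⟩ fun h' => h.2.2 (congrArg Fin.val h'), rfl⟩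

theorem List.exists_map_eq {α β : Type*} {f : α → β} {l : List β} (h : ∀ b ∈ l, ∃ a, f a = b) :
    ∃ l' : List α, l'.map f = l := by
  induction l with
  | nil => exact ⟨[], rfl⟩
  | cons b l ih =>
    obtain ⟨a, rfl⟩ := h b (by simp)
    obtain ⟨l', rfl⟩ := ih fun b hb => h b (by simp [hb])
    exact ⟨a :: l', rfl⟩

/-- The layer consists of gates on `N` qubits that act on disjoint wires. -/
def RGate.ValidLayer (N : ℕ) (l : List RGate) : Prop :=
  (∀ g ∈ l, g.Valid N) ∧ l.Pairwise fun g h => Disjoint g.wires h.wires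

/-- Valid layers of raw gates are the layers of a circuit. -/
theorem QCircuit.exists_raw_eq {N : ℕ} {ls : List (List RGate)}
    (h : ∀ l ∈ ls, RGate.ValidLayer N l) : ∃ C : QCircuit N, C.raw = ls := by
  obtain ⟨ls', rfl⟩ := List.exists_map_eq (f := List.map (QGate.raw (N := N))) fun l hl =>
    List.exists_map_eq fun g hg => ((h l hl).1 g hg).exists_qGate
  refine ⟨⟨ls', fun l hl => ?_⟩, rfl⟩
  have h1 := (h _ (List.mem_map.2 ⟨l, hl, rfl⟩)).2
  rw [List.pairwise_map] at h1
  refine h1.imp fun {g g'} hd => ?_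
  rwa [QGate.wires_raw, QGate.wires_raw, Finset.disjoint_map] at hd

theorem QCircuit.validLayer_raw {N : ℕ} (C : QCircuit N) {l : List RGate} (hl : l ∈ C.raw) :
    RGate.ValidLayer N l := by
  obtain ⟨l, hl', rfl⟩ := List.mem_map.1 hl
  refine ⟨?_, ?_⟩
  · intro g hg
    obtain ⟨g, -, rfl⟩ := List.mem_map.1 hg
    exact g.valid_raw
  · rw [List.pairwise_map]
    refine (C.disjoint l hl').imp fun {g g'} hd => ?_
    rwa [QGate.wires_raw, QGate.wires_raw, Finset.disjoint_map]

theorem RGate.ValidLayer.mono {N N' : ℕ} (h : N ≤ N') {l : List RGate} (hl : ValidLayer N l) :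
    ValidLayer N' l := by
  refine ⟨fun g hg => ?_, hl.2⟩
  have := hl.1 g hg
  cases g <;> simp only [Valid] at * <;> omega

namespace RGate

theorem validLayer_block {N : ℕ} {ι : Type} {steps : List (ι → RGate)} {W : ι → Finset ℕ}
    {P : ι → Prop} (hW : ∀ st ∈ steps, ∀ x, (st x).wires ⊆ W x)
    (hV : ∀ st ∈ steps, ∀ x, P x → (st x).Valid N) {l : List ι} (hP : ∀ x ∈ l, P x)
    (hl : l.Pairwise fun x y => Disjoint (W x) (W y)) :
    ∀ b ∈ block steps l, ValidLayer N b := by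
  intro b hb
  obtain ⟨st, hst, rfl⟩ := List.mem_map.1 hb
  refine ⟨fun g hg => ?_, ?_⟩
  · obtain ⟨x, hx, rfl⟩ := List.mem_map.1 hg
    exact hV st hst x (hP x hx)
  · rw [List.pairwise_map]
    exact hl.imp fun {x y} h => h.mono (hW st hst x) (hW st hst y)

end RGate

/-- The classical layer makes sense on `N` qubits. -/
def COp.LayerOn (N : ℕ) (l : List COp) : Prop := Layer l ∧ ∀ o ∈ l, ∀ i ∈ o.wires, i < N

namespace RGate

open COp

theorem validLayer_invBlock {N : ℕ} {l : List ℕ} (h : LayerOn N (l.map COp.inv)) :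
    ∀ b ∈ invBlock l, ValidLayer N b := by
  have h2 := h.1.2
  rw [List.pairwise_map] at h2
  refine validLayer_block (W := fun x => (COp.inv x).wires) (P := fun x => x < N) ?_ ?_
    (fun x hx => h.2 _ (List.mem_map.2 ⟨x, hx, rfl⟩) x (by simp [COp.wires, tgt])) h2
  all_goals
    intro st hst x
    simp only [invSteps, List.mem_append, List.mem_cons, List.mem_replicate] at hst
    rcases hst with (rfl | ⟨-, rfl⟩) | (rfl | h) <;>
      simp_all [COp.wires, COp.tgt, COp.ctrls, wires, Valid]

theorem validLayer_cnotBlock {N : ℕ} {l : List (ℕ × ℕ)}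
    (h : LayerOn N (l.map fun x => COp.cnot x.1 x.2)) : ∀ b ∈ cnotBlock l, ValidLayer N b := by
  have h2 := h.1.2
  rw [List.pairwise_map] at h2
  refine validLayer_block (W := fun x => (COp.cnot x.1 x.2).wires)
    (P := fun x => x.1 < N ∧ x.2 < N ∧ x.1 ≠ x.2) ?_ ?_
    (fun x hx => ⟨?_, ?_, by
      exact h.1.1 _ (List.mem_map.2 ⟨x, hx, rfl⟩)⟩) h2
  · simp [COp.wires, COp.tgt, COp.ctrls, wires, Finset.pair_comm]
  · intro st hst x hx
    rw [List.mem_singleton.1 hst]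
    exact hx
  all_goals exact h.2 _ (List.mem_map.2 ⟨x, hx, rfl⟩) _ (by simp [COp.wires, tgt, ctrls])

theorem validLayer_toffBlock {N : ℕ} {l : List (ℕ × ℕ × ℕ)}
    (h : LayerOn N (l.map fun x => COp.toff x.1 x.2.1 x.2.2)) :
    ∀ b ∈ toffBlock l, ValidLayer N b := by
  have h2 := h.1.2
  rw [List.pairwise_map] at h2
  refine validLayer_block (W := fun x => (COp.toff x.1 x.2.1 x.2.2).wires)
    (P := fun x => (x.1 < N ∧ x.2.1 < N ∧ x.2.2 < N) ∧ x.1 ≠ x.2.1 ∧ x.1 ≠ x.2.2 ∧ x.2.1 ≠ x.2.2)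
    ?_ ?_ (fun x hx => ⟨⟨?_, ?_, ?_⟩, by
      exact h.1.1 _ (List.mem_map.2 ⟨x, hx, rfl⟩)⟩) h2
  · intro st hst x
    refine (toffSteps_wires hst x).trans ?_
    intro i hi
    simp only [COp.wires, COp.tgt, COp.ctrls, Finset.mem_insert, Finset.mem_singleton] at *
    tauto
  · intro st hst x
    simp only [toffSteps, List.mem_append, List.mem_cons, List.mem_replicate, List.not_mem_nil,
      or_false] at hst
    casesm* _ ∨ _, _ ∧ _ <;> subst_vars <;> simp only [Valid] <;> tauto
  all_goals exact h.2 _ (List.mem_map.2 ⟨x, hx, rfl⟩) _ (by simp [COp.wires, tgt, ctrls])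

end RGate

/-! ### Implementing classical layers -/

namespace COp

/-- The basis state after a sequence of layers. -/
def evolve (ls : List (List COp)) (ζ : ℕ → Bool) : ℕ → Bool := ls.foldl (fun ζ l => actL l ζ) ζ

theorem LayerOn.cnot_range {N K : ℕ} {f g : ℕ → ℕ} (hf : ∀ v < K, f v < N) (hg : ∀ v < K, g v < N)
    (hfi : ∀ v < K, ∀ w < K, f v = f w → v = w) (hgi : ∀ v < K, ∀ w < K, g v = g w → v = w)
    (hfg : ∀ v < K, ∀ w < K, f v ≠ g w) :
    LayerOn N (((List.range K).map fun v => (f v, g v)).map fun x => cnot x.1 x.2) := by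
  rw [List.map_map]
  refine ⟨⟨?_, ?_⟩, ?_⟩
  · simp only [List.mem_map, List.mem_range]
    rintro _ ⟨v, hv, rfl⟩
    exact hfg v hv v hv
  · rw [List.pairwise_map]
    refine List.Pairwise.imp_of_mem ?_ (List.nodup_range (n := K))
    intro v w hv hw hvw
    rw [List.mem_range] at hv hw
    have h1 : ¬ f w = f v := fun h => hvw (hfi w hw v hv h).symm
    have h2 : ¬ g w = g v := fun h => hvw (hgi w hw v hv h).symm
    simp [wires, tgt, ctrls, h1, h2, hfg w hw v hv, Ne.symm (hfg v hv w hw)]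
  · simp only [List.mem_map, List.mem_range]
    rintro _ ⟨v, hv, rfl⟩ i hi
    simp only [Function.comp_apply, wires, tgt, ctrls, Finset.mem_insert,
      Finset.mem_singleton] at hi
    rcases hi with rfl | rfl
    exacts [hg v hv, hf v hv]

theorem LayerOn.toff_range {N K : ℕ} {e f g : ℕ → ℕ} (he : ∀ v < K, e v < N)
    (hf : ∀ v < K, f v < N) (hg : ∀ v < K, g v < N) (hei : ∀ v < K, ∀ w < K, e v = e w → v = w)
    (hfi : ∀ v < K, ∀ w < K, f v = f w → v = w) (hgi : ∀ v < K, ∀ w < K, g v = g w → v = w)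
    (hef : ∀ v < K, ∀ w < K, e v ≠ f w) (heg : ∀ v < K, ∀ w < K, e v ≠ g w)
    (hfg : ∀ v < K, ∀ w < K, f v ≠ g w) :
    LayerOn N (((List.range K).map fun v => (e v, f v, g v)).map
      fun x => toff x.1 x.2.1 x.2.2) := by
  rw [List.map_map]
  refine ⟨⟨?_, ?_⟩, ?_⟩
  · simp only [List.mem_map, List.mem_range]
    rintro _ ⟨v, hv, rfl⟩
    exact ⟨hef v hv v hv, heg v hv v hv, hfg v hv v hv⟩
  · rw [List.pairwise_map]
    refine List.Pairwise.imp_of_mem ?_ (List.nodup_range (n := K))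
    intro v w hv hw hvw
    rw [List.mem_range] at hv hw
    have h0 : ¬ e w = e v := fun h => hvw (hei w hw v hv h).symm
    have h1 : ¬ f w = f v := fun h => hvw (hfi w hw v hv h).symm
    have h2 : ¬ g w = g v := fun h => hvw (hgi w hw v hv h).symm
    simp [wires, tgt, ctrls, h0, h1, h2, hfg w hw v hv, Ne.symm (hfg v hv w hw), hef w hw v hv,
      Ne.symm (hef v hv w hw), heg w hw v hv, Ne.symm (heg v hv w hw)]
  · simp only [List.mem_map, List.mem_range]
    rintro _ ⟨v, hv, rfl⟩ i hi
    simp only [Function.comp_apply, wires, tgt, ctrls, Finset.mem_insert,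
      Finset.mem_singleton] at hi
    rcases hi with rfl | rfl | rfl
    exacts [hg v hv, he v hv, hf v hv]

/-- The value of a target of a layer of CNOT gates. -/
theorem LayerOn.cnot_tgt {N K : ℕ} {f g : ℕ → ℕ}
    (h : LayerOn N (((List.range K).map fun v => (f v, g v)).map fun x => cnot x.1 x.2)) {v : ℕ}
    (hv : v < K) (z : ℕ → Bool) :
    actL (((List.range K).map fun v => (f v, g v)).map fun x => cnot x.1 x.2) z (g v) =
      xor (z (g v)) (z (f v)) :=
  h.1.actL_tgt (o := cnot (f v) (g v)) (by simp; exact ⟨v, hv, rfl, rfl⟩) z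

theorem actL_cnot_of_ne {K : ℕ} {f g : ℕ → ℕ} {i : ℕ} (h : ∀ v < K, g v ≠ i) (z : ℕ → Bool) :
    actL (((List.range K).map fun v => (f v, g v)).map fun x => cnot x.1 x.2) z i = z i := by
  refine actL_of_forall_ne ?_ z
  simp only [List.map_map, List.mem_map, List.mem_range]
  rintro _ ⟨v, hv, rfl⟩
  exact h v hv

theorem LayerOn.toff_tgt {N K : ℕ} {e f g : ℕ → ℕ}
    (h : LayerOn N (((List.range K).map fun v => (e v, f v, g v)).map
      fun x => toff x.1 x.2.1 x.2.2)) {v : ℕ} (hv : v < K) (z : ℕ → Bool) :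
    actL (((List.range K).map fun v => (e v, f v, g v)).map fun x => toff x.1 x.2.1 x.2.2) z (g v) =
      xor (z (g v)) (z (e v) && z (f v)) :=
  h.1.actL_tgt (o := toff (e v) (f v) (g v)) (by simp; exact ⟨v, hv, rfl, rfl, rfl⟩) z

theorem actL_toff_of_ne {K : ℕ} {e f g : ℕ → ℕ} {i : ℕ} (h : ∀ v < K, g v ≠ i) (z : ℕ → Bool) :
    actL (((List.range K).map fun v => (e v, f v, g v)).map fun x => toff x.1 x.2.1 x.2.2) z i =
      z i := by
  refine actL_of_forall_ne ?_ z
  simp only [List.map_map, List.mem_map, List.mem_range]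
  rintro _ ⟨v, hv, rfl⟩
  exact h v hv

end COp

namespace RGate

open COp

/-- The quantum layers `B` act on `N` qubits and carry out the classical layers `ls`. -/
def Implements (N : ℕ) (B : List (List RGate)) (ls : List (List COp)) : Prop :=
  (∀ l ∈ ls, LayerOn N l) ∧ (∀ b ∈ B, ValidLayer N b) ∧
    ∀ ψ : Wave, run B.flatten ψ = fun z => ψ (ls.foldr actL z)

theorem Implements.append {N : ℕ} {B B' : List (List RGate)} {ls ls' : List (List COp)}
    (h : Implements N B ls) (h' : Implements N B' ls') : Implements N (B ++ B') (ls ++ ls') := by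
  refine ⟨fun l hl => ?_, fun b hb => ?_, fun ψ => ?_⟩
  · rcases List.mem_append.1 hl with hl | hl
    exacts [h.1 l hl, h'.1 l hl]
  · rcases List.mem_append.1 hb with hb | hb
    exacts [h.2.1 b hb, h'.2.1 b hb]
  · rw [List.flatten_append, run_append, h.2.2, h'.2.2]
    simp only [List.foldr_append]

theorem Implements.cnotBlock {N : ℕ} {l : List (ℕ × ℕ)}
    (h : LayerOn N (l.map fun x => COp.cnot x.1 x.2)) :
    Implements N (cnotBlock l) [l.map fun x => COp.cnot x.1 x.2] :=
  ⟨by simpa using h, validLayer_cnotBlock h, fun ψ => executes_cnotBlock l h.1 ψ⟩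

theorem Implements.toffBlock {N : ℕ} {l : List (ℕ × ℕ × ℕ)}
    (h : LayerOn N (l.map fun x => COp.toff x.1 x.2.1 x.2.2)) :
    Implements N (toffBlock l) [l.map fun x => COp.toff x.1 x.2.1 x.2.2] :=
  ⟨by simpa using h, validLayer_toffBlock h, fun ψ => executes_toffBlock l h.1 ψ⟩

theorem Implements.invBlock {N : ℕ} {l : List ℕ} (h : LayerOn N (l.map COp.inv)) :
    Implements N (invBlock l) [l.map COp.inv] :=
  ⟨by simpa using h, validLayer_invBlock h, fun ψ => executes_invBlock l h.1 ψ⟩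

end RGate

/-! ### Product states of two registers and classical wires -/

open Classical in
/-- The state `φ` on the wires `0, …, n - 1`, `χ` on the wires `N, …, N + n - 1`, and the basis
state `ζ` on all other wires. -/
noncomputable def tens {n : ℕ} (N : ℕ) (φ χ : Bits n → ℂ) (ζ : ℕ → Bool) : Wave := fun z =>
  φ (fun i => z i) * χ (fun i => z (N + i)) *
    if ∀ i, n ≤ i → ¬ (N ≤ i ∧ i < N + n) → z i = ζ i then 1 else 0

namespace COp

theorem tens_actL {n N : ℕ} (φ χ : Bits n → ℂ) (ζ : ℕ → Bool) {l : List COp} (hl : Layer l)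
    (hw : ∀ o ∈ l, ∀ i ∈ o.wires, n ≤ i ∧ ¬ (N ≤ i ∧ i < N + n)) :
    (fun z => tens N φ χ ζ (actL l z)) = tens N φ χ (actL l ζ) := by
  have h1 : ∀ z i, ¬ (n ≤ i ∧ ¬ (N ≤ i ∧ i < N + n)) → actL l z i = z i := fun z i hi =>
    actL_of_forall_ne (fun o ho heq => hi (hw o ho i (by rw [← heq]; simp [wires]))) z
  have h2 : ∀ z z' : ℕ → Bool, (∀ i, n ≤ i → ¬ (N ≤ i ∧ i < N + n) → z i = z' i) →
      ∀ i, n ≤ i → ¬ (N ≤ i ∧ i < N + n) → actL l z i = actL l z' i := by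
    intro z z' h i hi hi'
    by_cases hc : ∃ o ∈ l, o.tgt = i
    · obtain ⟨o, ho, rfl⟩ := hc
      rw [hl.actL_tgt ho, hl.actL_tgt ho, h _ hi hi', val_congr o fun i hi =>
        h i (hw o ho i (by simp [wires, hi])).1 (hw o ho i (by simp [wires, hi])).2]
    · push Not at hc
      rw [actL_of_forall_ne hc, actL_of_forall_ne hc, h i hi hi']
  funext z
  have e1 : (fun i : Fin n => actL l z i) = fun i : Fin n => z i := by
    funext i
    exact h1 z i fun h => by have := i.2; omega
  have e2 : (fun i : Fin n => actL l z (N + i)) = fun i : Fin n => z (N + i) := by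
    funext i
    exact h1 z _ fun h => h.2 (by have := i.2; omega)
  have e3 : (∀ i, n ≤ i → ¬ (N ≤ i ∧ i < N + n) → actL l z i = ζ i) ↔
      ∀ i, n ≤ i → ¬ (N ≤ i ∧ i < N + n) → z i = actL l ζ i := by
    constructor
    · intro h i hi hi'
      rw [← hl.actL_actL z]
      exact h2 _ _ h i hi hi'
    · intro h i hi hi'
      rw [← hl.actL_actL ζ]
      exact h2 _ _ h i hi hi'
  unfold tens
  rw [e1, e2]
  congr 1
  classical exact if_congr e3 rfl rfl

end COp

namespace RGate

open COp

/-- Classical layers away from the two registers act on the classical wires. -/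
theorem Implements.run_tens {n N N' : ℕ} {B : List (List RGate)} {ls : List (List COp)}
    (h : Implements N' B ls)
    (hw : ∀ l ∈ ls, ∀ o ∈ l, ∀ i ∈ o.wires, n ≤ i ∧ ¬ (N ≤ i ∧ i < N + n))
    (φ χ : Bits n → ℂ) (ζ : ℕ → Bool) :
    run B.flatten (tens N φ χ ζ) = tens N φ χ (evolve ls ζ) := by
  rw [h.2.2]
  have hl := fun l hl => (h.1 l hl).1
  clear h
  induction ls generalizing ζ with
  | nil => rfl
  | cons l ls ih =>
    have h1 := tens_actL φ χ ζ (hl l (by simp)) (hw l (by simp))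
    have h2 := ih (fun l hl => hw l (by simp [hl])) (actL l ζ) fun l' h' => hl l' (by simp [h'])
    rw [← h1] at h2
    exact h2

/-- Gates on the first register. -/
theorem run_tens_gates {n N : ℕ} (hn : n ≤ N) (G : List (QGate n)) (φ χ : Bits n → ℂ)
    (ζ : ℕ → Bool) : run (G.map QGate.raw) (tens N φ χ ζ) = tens N ((gatesOp G).mulVec φ) χ ζ := by
  funext z
  have h := run_splice G (tens N φ χ ζ) z fun i => z i
  rw [splice_self] at h
  rw [h]
  have e : ∀ v : Bits n, tens N φ χ ζ (splice z v) = φ v * (χ (fun i => z (N + i)) *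
      tens (n := n) N (fun _ => 1) (fun _ => 1) ζ z) := by
    intro v
    have e1 : (fun i : Fin n => splice z v i) = v := funext fun i => splice_val z v i
    have e2 : (fun i : Fin n => splice z v (N + i)) = fun i : Fin n => z (N + i) :=
      funext fun i => splice_of_le z v (by omega)
    have e3 : (∀ i, n ≤ i → ¬ (N ≤ i ∧ i < N + n) → splice z v i = ζ i) ↔
        ∀ i, n ≤ i → ¬ (N ≤ i ∧ i < N + n) → z i = ζ i :=
      forall_congr' fun i => forall_congr' fun hi => by rw [splice_of_le z v hi]
    have e4 : tens N φ χ ζ (splice z v) = φ v * χ (fun i => z (N + i)) *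
        tens (n := n) N (fun _ => 1) (fun _ => 1) ζ z := by
      unfold tens
      rw [e1, e2, one_mul, one_mul]
      congr 1
      classical exact if_congr e3 rfl rfl
    rw [e4, mul_assoc]
  simp only [e, Matrix.mulVec, dotProduct, ← mul_assoc]
  rw [← Finset.sum_mul, ← Finset.sum_mul]
  simp only [tens, Matrix.mulVec, dotProduct]
  ring

/-- Layers that exchange the two registers wherever the control bits `b q` are set. -/
def swapLayers (n N : ℕ) (mid : List (List RGate)) : List (List RGate) :=
  cnotBlock ((List.range n).map fun q => (q, N + q)) ++ mid ++
    cnotBlock ((List.range n).map fun q => (q, N + q))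

theorem layerOn_copy {n N N' : ℕ} (hn : n ≤ N) (hN : N + n ≤ N') :
    LayerOn N' (((List.range n).map fun q => (q, N + q)).map fun x => COp.cnot x.1 x.2) := by
  apply LayerOn.cnot_range <;> intros <;> omega

/-- If the middle layers add `b q ∧ W q` to the `q`-th wire of the first register, the conjugation
by CNOT gates makes this a swap controlled by `b`. -/
theorem run_swapLayers {n N N' : ℕ} (hn : n ≤ N) (hN : N + n ≤ N') {mid : List (List RGate)}
    {l : List COp} (hmid : Implements N' mid [l]) (b : Bool) (φ χ : Bits n → ℂ) (ζ : ℕ → Bool)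
    (hoff : ∀ z i, n ≤ i → actL l z i = z i)
    (hon : ∀ z, (∀ i, n ≤ i → ¬ (N ≤ i ∧ i < N + n) → z i = ζ i) →
      ∀ q < n, actL l z q = xor (z q) (b && z (N + q))) :
    run (swapLayers n N mid).flatten (tens N φ χ ζ) =
      if b then tens N χ φ ζ else tens N φ χ ζ := by
  have hc := layerOn_copy hn hN
  have himp := ((Implements.cnotBlock hc).append hmid).append (Implements.cnotBlock hc)
  rw [swapLayers, himp.2.2]
  set cl := ((List.range n).map fun q => (q, N + q)).map fun x => COp.cnot x.1 x.2 with hcl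
  have ct : ∀ z q, q < n → actL cl z (N + q) = xor (z (N + q)) (z q) := fun z q hq =>
    LayerOn.cnot_tgt (f := fun q => q) (g := fun q => N + q) hc hq z
  have cn : ∀ z i, ¬ (N ≤ i ∧ i < N + n) → actL cl z i = z i := fun z i hi =>
    actL_cnot_of_ne (f := fun q => q) (g := fun q => N + q) (by intros; omega) z
  funext z
  show tens N φ χ ζ (actL cl (actL l (actL cl z))) = _
  have hoff' : ∀ i, n ≤ i → ¬ (N ≤ i ∧ i < N + n) →
      actL cl (actL l (actL cl z)) i = z i := by
    intro i hi hi'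
    rw [cn _ _ hi', hoff _ _ hi, cn _ _ hi']
  by_cases hz : ∀ i, n ≤ i → ¬ (N ≤ i ∧ i < N + n) → z i = ζ i
  · have hz' : ∀ i, n ≤ i → ¬ (N ≤ i ∧ i < N + n) → actL cl z i = ζ i := fun i hi hi' => by
      rw [cn _ _ hi', hz i hi hi']
    have eM : ∀ q < n, actL cl (actL l (actL cl z)) q = if b then z (N + q) else z q := by
      intro q hq
      rw [cn _ _ (by omega), hon _ hz' q hq, cn _ _ (by omega), ct _ _ hq]
      cases b <;> cases z q <;> cases z (N + q) <;> rfl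
    have eW : ∀ q < n, actL cl (actL l (actL cl z)) (N + q) = if b then z q else z (N + q) := by
      intro q hq
      rw [ct _ _ hq, hoff _ _ (by omega), ct _ _ hq, hon _ hz' q hq, cn _ _ (by omega),
        ct _ _ hq]
      cases b <;> cases z q <;> cases z (N + q) <;> rfl
    have e1 : (fun i : Fin n => actL cl (actL l (actL cl z)) i) =
        fun i : Fin n => if b then z (N + i) else z i := funext fun i => eM i i.2
    have e2 : (fun i : Fin n => actL cl (actL l (actL cl z)) (N + i)) =
        fun i : Fin n => if b then z i else z (N + i) := funext fun i => eW i i.2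
    have e3 : ∀ i, n ≤ i → ¬ (N ≤ i ∧ i < N + n) → actL cl (actL l (actL cl z)) i = ζ i :=
      fun i hi hi' => by rw [hoff' i hi hi', hz i hi hi']
    cases b
    · simp only [Bool.false_eq_true, if_false] at e1 e2 ⊢
      simp only [tens, e1, e2, if_pos e3, if_pos hz]
    · simp only [if_true] at e1 e2 ⊢
      simp only [tens, e1, e2, if_pos e3, if_pos hz]
      ring
  · have e3 : ¬ ∀ i, n ≤ i → ¬ (N ≤ i ∧ i < N + n) → actL cl (actL l (actL cl z)) i = ζ i :=
      fun h => hz fun i hi hi' => by rw [← hoff' i hi hi', h i hi hi']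
    cases b
    · simp only [Bool.false_eq_true, if_false, tens, if_neg e3, if_neg hz, mul_zero]
    · simp only [if_true, tens, if_neg e3, if_neg hz, mul_zero]

end RGate

/-! ### Decoding the clock -/

namespace RGate

open COp

/-- The layers `B` on `N'` qubits turn classical wires satisfying `I` into classical wires
satisfying `J`, whatever the state of the two registers. -/
def Takes (n N N' : ℕ) (B : List (List RGate)) (I J : (ℕ → Bool) → Prop) : Prop :=
  (∀ b ∈ B, ValidLayer N' b) ∧ ∀ ζ, I ζ → ∃ ζ', J ζ' ∧
    ∀ φ χ : Bits n → ℂ, run B.flatten (tens N φ χ ζ) = tens N φ χ ζ'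

section Takes

variable {n N N' : ℕ} {B B' : List (List RGate)} {I J K : (ℕ → Bool) → Prop}

theorem Takes.append (h : Takes n N N' B I J) (h' : Takes n N N' B' J K) :
    Takes n N N' (B ++ B') I K := by
  refine ⟨fun b hb => (List.mem_append.1 hb).elim (h.1 b) (h'.1 b), fun ζ hζ => ?_⟩
  obtain ⟨ζ₁, h1, h2⟩ := h.2 ζ hζ
  obtain ⟨ζ₂, h3, h4⟩ := h'.2 ζ₁ h1
  refine ⟨ζ₂, h3, fun φ χ => ?_⟩
  rw [List.flatten_append, run_append, h2, h4]

theorem Takes.imp (h : Takes n N N' B I J) (hJ : ∀ ζ, J ζ → K ζ) : Takes n N N' B I K :=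
  ⟨h.1, fun ζ hζ => (h.2 ζ hζ).imp fun _ h => ⟨hJ _ h.1, h.2⟩⟩

theorem Takes.flatMap_range {k : ℕ} {B : ℕ → List (List RGate)} {I : ℕ → (ℕ → Bool) → Prop}
    (h : ∀ i < k, Takes n N N' (B i) (I i) (I (i + 1))) :
    Takes n N N' ((List.range k).flatMap B) (I 0) (I k) := by
  induction k with
  | zero => exact ⟨by simp, fun ζ hζ => ⟨ζ, hζ, fun _ _ => rfl⟩⟩
  | succ k ih =>
    rw [List.range_succ, List.flatMap_append, List.flatMap_singleton]
    exact (ih fun i hi => h i (by omega)).append (h k (by omega))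

/-- A layer of controlled negations of the wires `g v` by the wires `f v`, away from the two
registers. -/
theorem Takes.cnot {k : ℕ} {f g : ℕ → ℕ}
    (hf : ∀ v < k, f v < N' ∧ n ≤ f v ∧ ¬ (N ≤ f v ∧ f v < N + n))
    (hg : ∀ v < k, g v < N' ∧ n ≤ g v ∧ ¬ (N ≤ g v ∧ g v < N + n))
    (hfi : ∀ v < k, ∀ w < k, f v = f w → v = w) (hgi : ∀ v < k, ∀ w < k, g v = g w → v = w)
    (hfg : ∀ v < k, ∀ w < k, f v ≠ g w)
    (h : ∀ ζ ζ', I ζ → (∀ v < k, ζ' (g v) = xor (ζ (g v)) (ζ (f v))) →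
      (∀ i, (∀ v < k, g v ≠ i) → ζ' i = ζ i) → J ζ') :
    Takes n N N' (cnotBlock ((List.range k).map fun v => (f v, g v))) I J := by
  have hl := LayerOn.cnot_range (fun v hv => (hf v hv).1) (fun v hv => (hg v hv).1) hfi hgi hfg
  refine ⟨validLayer_cnotBlock hl, fun ζ hζ => ⟨_, h ζ _ hζ
    (fun v hv => LayerOn.cnot_tgt hl hv ζ) (fun i hi => actL_cnot_of_ne hi ζ), fun φ χ => ?_⟩⟩
  refine (Implements.cnotBlock hl).run_tens ?_ φ χ ζ
  simp only [List.mem_singleton, List.map_map]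
  rintro _ rfl o ho i hi
  obtain ⟨v, hv, rfl⟩ := List.mem_map.1 ho
  rw [List.mem_range] at hv
  simp only [Function.comp_apply, COp.wires, tgt, ctrls, Finset.mem_insert,
    Finset.mem_singleton] at hi
  rcases hi with rfl | rfl
  exacts [(hg v hv).2, (hf v hv).2]

/-- A layer of doubly controlled negations of the wires `g v` by the wires `e v` and `f v`, away
from the two registers. -/
theorem Takes.toff {k : ℕ} {e f g : ℕ → ℕ}
    (he : ∀ v < k, e v < N' ∧ n ≤ e v ∧ ¬ (N ≤ e v ∧ e v < N + n))
    (hf : ∀ v < k, f v < N' ∧ n ≤ f v ∧ ¬ (N ≤ f v ∧ f v < N + n))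
    (hg : ∀ v < k, g v < N' ∧ n ≤ g v ∧ ¬ (N ≤ g v ∧ g v < N + n))
    (hei : ∀ v < k, ∀ w < k, e v = e w → v = w)
    (hfi : ∀ v < k, ∀ w < k, f v = f w → v = w) (hgi : ∀ v < k, ∀ w < k, g v = g w → v = w)
    (hef : ∀ v < k, ∀ w < k, e v ≠ f w) (heg : ∀ v < k, ∀ w < k, e v ≠ g w)
    (hfg : ∀ v < k, ∀ w < k, f v ≠ g w)
    (h : ∀ ζ ζ', I ζ → (∀ v < k, ζ' (g v) = xor (ζ (g v)) (ζ (e v) && ζ (f v))) →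
      (∀ i, (∀ v < k, g v ≠ i) → ζ' i = ζ i) → J ζ') :
    Takes n N N' (toffBlock ((List.range k).map fun v => (e v, f v, g v))) I J := by
  have hl := LayerOn.toff_range (fun v hv => (he v hv).1) (fun v hv => (hf v hv).1)
    (fun v hv => (hg v hv).1) hei hfi hgi hef heg hfg
  refine ⟨validLayer_toffBlock hl, fun ζ hζ => ⟨_, h ζ _ hζ
    (fun v hv => LayerOn.toff_tgt hl hv ζ) (fun i hi => actL_toff_of_ne hi ζ), fun φ χ => ?_⟩⟩
  refine (Implements.toffBlock hl).run_tens ?_ φ χ ζ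
  simp only [List.mem_singleton, List.map_map]
  rintro _ rfl o ho i hi
  obtain ⟨v, hv, rfl⟩ := List.mem_map.1 ho
  rw [List.mem_range] at hv
  simp only [Function.comp_apply, COp.wires, tgt, ctrls, Finset.mem_insert,
    Finset.mem_singleton] at hi
  rcases hi with rfl | rfl | rfl
  exacts [(hg v hv).2, (he v hv).2, (hf v hv).2]

end Takes

/-- `min (2 ^ τ) P`, the number of copies after `τ` rounds of doubling. -/
def doubling (P τ : ℕ) : ℕ := (fun x => min (x + x) P)^[τ] 1

theorem doubling_zero (P : ℕ) : doubling P 0 = 1 := rfl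

theorem doubling_succ (P τ : ℕ) :
    doubling P (τ + 1) = min (doubling P τ + doubling P τ) P := by
  rw [doubling, Function.iterate_succ_apply']
  rfl

theorem doubling_le {P : ℕ} (hP : 1 ≤ P) (τ : ℕ) : doubling P τ ≤ P := by
  cases τ with
  | zero => exact hP
  | succ τ => rw [doubling_succ]; exact min_le_right _ _

theorem doubling_le_succ {P : ℕ} (hP : 1 ≤ P) (τ : ℕ) : doubling P τ ≤ doubling P (τ + 1) := by
  have := doubling_le hP τ
  rw [doubling_succ]
  omega

theorem doubling_eq {P τ : ℕ} (h : P ≤ 2 ^ τ) (hP : 1 ≤ P) : doubling P τ = P := by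
  have : ∀ τ, doubling P τ = min (2 ^ τ) P := by
    intro τ
    induction τ with
    | zero => rw [doubling_zero]; omega
    | succ τ ih => rw [doubling_succ, ih, pow_succ]; omega
  rw [this, min_eq_right h]

/-- The layers that copy the first block of `k` bits at `b` to `P` consecutive blocks. Each of the
`s` rounds doubles the number of copies, up to `P`, whereas copying from a single
source would take depth `P`. -/
def fanLayers (b k P s : ℕ) : List (List RGate) :=
  (List.range s).flatMap fun τ =>
    cnotBlock ((List.range ((doubling P (τ + 1) - doubling P τ) * k)).map fun v =>
      (b + v, b + (doubling P τ * k + v)))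

/-- The rounds of doubling produce all copies as soon as `P ≤ 2 ^ s`. -/
theorem takes_fanLayers {n N N' b k P s : ℕ} (hb : N + n ≤ b) (hN : b + P * k ≤ N')
    (hP : 1 ≤ P) (hPs : P ≤ 2 ^ s) (Γ : ℕ → Bool) :
    Takes n N N' (fanLayers b k P s)
      (fun ζ => (∀ v < k, ζ (b + v) = Γ v) ∧ ∀ i, b + k ≤ i → ζ i = false)
      (fun ζ => (∀ v < P * k, ζ (b + v) = Γ (v % k)) ∧ ∀ i, b + P * k ≤ i → ζ i = false) := by
  have main := Takes.flatMap_range (n := n) (N := N) (N' := N') (k := s)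
    (B := fun τ => cnotBlock ((List.range ((doubling P (τ + 1) - doubling P τ) * k)).map fun v =>
      (b + v, b + (doubling P τ * k + v))))
    (I := fun τ ζ => (∀ v < doubling P τ * k, ζ (b + v) = Γ (v % k)) ∧
      ∀ i, b + doubling P τ * k ≤ i → ζ i = false) ?_
  · rw [doubling_eq hPs hP] at main
    refine ⟨main.1, fun ζ hζ => main.2 ζ ?_⟩
    simp only [doubling_zero, one_mul]
    refine ⟨fun v hv => ?_, hζ.2⟩
    rw [hζ.1 v hv, Nat.mod_eq_of_lt hv]
  · intro τ _
    have e1 : doubling P (τ + 1) ≤ doubling P τ + doubling P τ := by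
      rw [doubling_succ]; exact min_le_left _ _
    have e2 : doubling P (τ + 1) * k ≤ P * k := Nat.mul_le_mul_right k (doubling_le hP _)
    have e3 : doubling P τ * k ≤ doubling P (τ + 1) * k :=
      Nat.mul_le_mul_right k (doubling_le_succ hP τ)
    have e4 : (doubling P (τ + 1) - doubling P τ) * k =
        doubling P (τ + 1) * k - doubling P τ * k := Nat.sub_mul _ _ _
    have e5 : doubling P (τ + 1) * k ≤ doubling P τ * k + doubling P τ * k := by
      rw [← Nat.add_mul]; exact Nat.mul_le_mul_right k e1
    rw [e4]
    refine Takes.cnot ?_ ?_ ?_ ?_ ?_ ?_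
    iterate 5 · intros; omega
    · rintro ζ ζ' ⟨h1, h2⟩ h3 h4
      refine ⟨fun v hv => ?_, fun i hi => ?_⟩
      · by_cases hv' : v < doubling P τ * k
        · rw [h4 _ (by intros; omega), h1 v hv']
        · obtain ⟨w, rfl⟩ := Nat.exists_eq_add_of_le (not_lt.1 hv')
          rw [h3 w (by omega), h2 _ (by omega), h1 w (by omega), Bool.false_xor,
            Nat.mul_add_mod']
      · rw [h4 _ (by intros; omega), h2 _ (by omega)]

/-- The layers that add up `Q` consecutive blocks of `k` bits at `b`, in the first block. -/
def sumLayers (b k Q s : ℕ) : List (List RGate) :=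
  (List.range s).flatMap fun τ =>
    cnotBlock ((List.range ((doubling Q (s - τ) - doubling Q (s - 1 - τ)) * k)).map fun v =>
      (b + (doubling Q (s - 1 - τ) * k + v), b + v))

/-- If the bit `v / n = j` is set in the blocks of size `r * n`, the sum of the blocks has the bits
`v / n = j % r`. -/
theorem takes_sumLayers {n N N' b r Q s j : ℕ} (hn1 : 1 ≤ n) (hn : n ≤ N) (hb : N + n ≤ b)
    (hN : b + Q * (r * n) ≤ N') (hr : 1 ≤ r) (hQs : Q ≤ 2 ^ s) (hj : j < Q * r) :
    Takes n N N' (sumLayers b (r * n) Q s)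
      (fun ζ => ∀ v < Q * (r * n), (ζ (b + v) = true ↔ v / n = j))
      (fun ζ => ∀ v < r * n, (ζ (b + v) = true ↔ v / n = j % r)) := by
  have hQ : 1 ≤ Q := Nat.pos_of_ne_zero (by rintro rfl; simp at hj)
  have hi : j % r < r := Nat.mod_lt _ hr
  have main := Takes.flatMap_range (n := n) (N := N) (N' := N') (k := s)
    (B := fun τ => cnotBlock ((List.range ((doubling Q (s - τ) - doubling Q (s - 1 - τ)) *
      (r * n))).map fun v => (b + (doubling Q (s - 1 - τ) * (r * n) + v), b + v)))
    (I := fun τ ζ => ∃ l < doubling Q (s - τ), ∀ v < doubling Q (s - τ) * (r * n),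
      (ζ (b + v) = true ↔ v / n = l * r + j % r)) ?_
  · refine ⟨main.1, fun ζ hζ => ?_⟩
    obtain ⟨ζ', ⟨l, hl, h1⟩, h2⟩ := main.2 ζ (by
      rw [Nat.sub_zero, doubling_eq hQs hQ]
      refine ⟨j / r, (Nat.div_lt_iff_lt_mul hr).2 hj, ?_⟩
      rw [mul_comm (j / r), Nat.div_add_mod]
      exact hζ)
    rw [Nat.sub_self, doubling_zero] at h1 hl
    obtain rfl : l = 0 := by omega
    exact ⟨ζ', by simpa using h1, h2⟩
  · intro τ hτ
    rw [show s - (τ + 1) = s - 1 - τ by omega, show s - τ = s - 1 - τ + 1 by omega]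
    set C := doubling Q (s - 1 - τ) with hC
    set C' := doubling Q (s - 1 - τ + 1) with hC'
    have e1 : C' ≤ C + C := by
      rw [hC', doubling_succ]; exact min_le_left _ _
    have e0 : C ≤ C' := doubling_le_succ hQ _
    have e2 : C' * (r * n) ≤ Q * (r * n) := Nat.mul_le_mul_right _ (doubling_le hQ _)
    have e3 : C * (r * n) ≤ C' * (r * n) := Nat.mul_le_mul_right _ e0
    have e4 : (C' - C) * (r * n) = C' * (r * n) - C * (r * n) := Nat.sub_mul _ _ _
    have e5 : C' * (r * n) ≤ C * (r * n) + C * (r * n) := by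
      rw [← Nat.add_mul]; exact Nat.mul_le_mul_right _ e1
    refine Takes.cnot ?_ ?_ ?_ ?_ ?_ ?_
    iterate 5 · rw [e4]; intros; omega
    · rintro ζ ζ' ⟨l, hl, h1⟩ h3 h4
      have hdiv : ∀ v, (C * (r * n) + v) / n = C * r + v / n := fun v => by
        rw [← mul_assoc, add_comm, Nat.add_mul_div_right _ _ hn1, add_comm]
      have hlt : ∀ v a, v < a * (r * n) ↔ v / n < a * r := fun v a => by
        rw [Nat.div_lt_iff_lt_mul hn1, mul_assoc]
      by_cases hlC : l < C
      · refine ⟨l, hlC, fun v hv => ?_⟩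
        have h5 : l * r + r ≤ C * r := by
          rw [← Nat.succ_mul]; exact Nat.mul_le_mul_right _ hlC
        by_cases hv' : v < (C' - C) * (r * n)
        · have h6 : ζ (b + (C * (r * n) + v)) = false := by
            rw [← Bool.not_eq_true, h1 _ (by omega), hdiv]
            exact Nat.ne_of_gt (by linarith [Nat.zero_le (v / n)])
          rw [h3 v hv', h6, Bool.xor_false, h1 v (by omega)]
        · rw [h4 _ (by intros; omega), h1 v (by omega)]
      · refine ⟨l - C, by omega, fun v hv => ?_⟩
        have h5 : C * r ≤ l * r := Nat.mul_le_mul_right _ (by omega)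
        have h7 : (l - C) * r = l * r - C * r := Nat.sub_mul _ _ _
        have h6 : ζ (b + v) = false := by
          rw [← Bool.not_eq_true, h1 _ (by omega)]
          have := (hlt v C).1 hv
          omega
        rw [h7]
        by_cases hv' : v < (C' - C) * (r * n)
        · rw [h3 v hv', h6, Bool.false_xor, h1 _ (by omega), hdiv]
          omega
        · rw [h4 _ (by intros; omega), h6]
          rw [hlt, Nat.sub_mul] at hv'
          have h8 : l * r + r ≤ C' * r := by
            rw [← Nat.succ_mul]; exact Nat.mul_le_mul_right _ hl
          simp only [Bool.false_eq_true, false_iff]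
          omega

/-- The layers that compute, from `P` copies of `m` bits at `b`, the conjunctions of the `p`-th
copies of the bits in the `p / n`-th list. The conjunctions of the first `v + 1` of these bits are
stored at `b + P * m + v * P`. -/
def andLayers (n m b c P : ℕ) (R : List (List ℕ)) : List (List RGate) :=
  cnotBlock ((List.range P).map fun p =>
    (b + (p * m + (R.getD (p / n) []).getD 0 0), b + P * m + p)) ++
  (List.range c).flatMap fun v => toffBlock ((List.range P).map fun p =>
    (b + P * m + v * P + p, b + (p * m + (R.getD (p / n) []).getD (v + 1) 0),
      b + P * m + (v + 1) * P + p))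

/-- Each conjunction reads a copy of its own, so all of them are computed in depth `O(c)`. -/
theorem takes_andLayers {n m N N' b c P : ℕ} {R : List (List ℕ)} (hb : N + n ≤ b)
    (hN : b + P * m + (c + 1) * P ≤ N')
    (hR : ∀ p < P, ∀ u ≤ c, (R.getD (p / n) []).getD u 0 < m) (Γ : ℕ → Bool) :
    Takes n N N' (andLayers n m b c P R)
      (fun ζ => (∀ v < P * m, ζ (b + v) = Γ (v % m)) ∧ ∀ i, b + P * m ≤ i → ζ i = false)
      (fun ζ => ∀ p < P, (ζ (b + P * m + c * P + p) = true ↔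
        ∀ u ≤ c, Γ ((R.getD (p / n) []).getD u 0) = true)) := by
  have hlt : ∀ p < P, ∀ u ≤ c, p * m + (R.getD (p / n) []).getD u 0 < P * m := by
    intro p hp u hu
    have h1 := hR p hp u hu
    have h2 : p * m + m ≤ P * m := by
      rw [← Nat.succ_mul]; exact Nat.mul_le_mul_right _ hp
    omega
  have hinj : ∀ u ≤ c, ∀ p < P, ∀ p' < P, b + (p * m + (R.getD (p / n) []).getD u 0) =
      b + (p' * m + (R.getD (p' / n) []).getD u 0) → p = p' := by
    intro u hu p hp p' hp' h
    have h1 := hR p hp u hu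
    have h2 := hR p' hp' u hu
    have h3 : ∀ a x, x < m → (a * m + x) / m = a := fun a x hx => by
      rw [add_comm, Nat.add_mul_div_right _ _ (by omega), Nat.div_eq_of_lt hx, zero_add]
    rw [← h3 p _ h1, Nat.add_left_cancel h, h3 p' _ h2]
  have hmod : ∀ p < P, ∀ u ≤ c, (p * m + (R.getD (p / n) []).getD u 0) % m =
      (R.getD (p / n) []).getD u 0 := by
    intro p hp u hu
    rw [Nat.mul_add_mod', Nat.mod_eq_of_lt (hR p hp u hu)]
  have hstep : ∀ v, (v + 1) * P = v * P + P := fun v => Nat.succ_mul v P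
  have hle : ∀ v < c, (v + 1) * P ≤ c * P := fun v hv => Nat.mul_le_mul_right _ hv
  have hc := hstep c
  refine Takes.append (J := fun ζ => (∀ v < P * m, ζ (b + v) = Γ (v % m)) ∧
    (∀ p < P, (ζ (b + P * m + 0 * P + p) = true ↔
      ∀ u ≤ 0, Γ ((R.getD (p / n) []).getD u 0) = true)) ∧
    ∀ i, b + P * m + (0 + 1) * P ≤ i → ζ i = false) ?_ ((Takes.flatMap_range
    (I := fun w ζ => (∀ v < P * m, ζ (b + v) = Γ (v % m)) ∧
    (∀ p < P, (ζ (b + P * m + w * P + p) = true ↔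
      ∀ u ≤ w, Γ ((R.getD (p / n) []).getD u 0) = true)) ∧
    ∀ i, b + P * m + (w + 1) * P ≤ i → ζ i = false) ?_).imp fun ζ h => h.2.1)
  · refine Takes.cnot ?_ ?_ (hinj 0 (Nat.zero_le _)) ?_ ?_ ?_
    · intro p hp
      have := hlt p hp 0 (Nat.zero_le _)
      omega
    · intros; omega
    · intros; omega
    · intro p hp w hw
      have := hlt p hp 0 (Nat.zero_le _)
      omega
    · rintro ζ ζ' ⟨h1, h2⟩ h3 h4
      refine ⟨fun v hv => ?_, fun p hp => ?_, fun i hi => ?_⟩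
      · rw [h4 _ (by intros; omega), h1 v hv]
      · rw [zero_mul, add_zero, h3 p hp, h2 _ (by omega), h1 _ (hlt p hp 0 (Nat.zero_le _)),
          hmod p hp 0 (Nat.zero_le _), Bool.false_xor]
        simp
      · rw [h4 _ (by intros; omega), h2 _ (by omega)]
  · intro w hw
    have hw1 := hstep w
    have hw2 := hstep (w + 1)
    have hw3 := hle w hw
    refine Takes.toff ?_ ?_ ?_ ?_ (hinj (w + 1) hw) ?_ ?_ ?_ ?_ ?_
    · intros; omega
    · intro p hp
      have := hlt p hp (w + 1) hw
      omega
    · intros; omega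
    · intros; omega
    · intros; omega
    · intro p hp p' hp'
      have := hlt p' hp' (w + 1) hw
      omega
    · intros; omega
    · intro p hp p' hp'
      have := hlt p hp (w + 1) hw
      omega
    · rintro ζ ζ' ⟨h1, h2, h5⟩ h3 h4
      refine ⟨fun v hv => ?_, fun p hp => ?_, fun i hi => ?_⟩
      · rw [h4 _ (by intros; omega), h1 v hv]
      · rw [h3 p hp, h5 _ (by omega), h1 _ (hlt p hp (w + 1) hw), hmod p hp (w + 1) hw,
          Bool.false_xor, Bool.and_eq_true, h2 p hp]
        constructor
        · rintro ⟨h6, h7⟩ u hu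
          rcases Nat.lt_or_ge w u with h | h
          · obtain rfl : u = w + 1 := by omega
            exact h7
          · exact h6 u h
        · exact fun h => ⟨fun u hu => h u (by omega), h _ le_rfl⟩
      · rw [h4 _ (by intros; omega), h5 _ (by omega)]

/-- The layers that write `i = j % s` onto `n` wires for each `i < s`, if the clock register
holds the `j`-th list of `R`. With `P = Q * (s * n)`, they make `P` copies of the clock register at
`N + n`, test for each `l < Q * s` on `n` copies whether `l = j`, and add the outcomes with equal
`l % s`; exactly one of the tests succeeds, so the sum modulo `2` is the disjunction. -/
def decodeLayers (n m N c s Q : ℕ) (R : List (List ℕ)) : List (List RGate) :=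
  cnotBlock ((List.range m).map fun e => (n + e, N + n + e)) ++
    (fanLayers (N + n) m (Q * (s * n)) s ++
      (andLayers n m (N + n) c (Q * (s * n)) R ++
        sumLayers (N + n + Q * (s * n) * m + c * (Q * (s * n))) (s * n) Q s))

/-- The hypothesis on `Γ` says that the clock register contains the `l`-th list only for `l = j`. -/
theorem takes_decodeLayers {n m N c s Q j : ℕ} {R : List (List ℕ)} (hn : 1 ≤ n) (hN : n + m ≤ N)
    (hs : 1 ≤ s) (hQ : Q * (s * n) ≤ 2 ^ s) (hj : j < Q * s)
    (hR : ∀ p < Q * (s * n), ∀ u ≤ c, (R.getD (p / n) []).getD u 0 < m) (Γ : ℕ → Bool)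
    (hΓ : ∀ l < Q * s, ((∀ u ≤ c, Γ ((R.getD l []).getD u 0) = true) ↔ l = j)) :
    Takes n N (N + n + Q * (s * n) * m + (c + 1) * (Q * (s * n)))
      (decodeLayers n m N c s Q R)
      (fun ζ => (∀ e < m, ζ (n + e) = Γ e) ∧ ∀ i, N + n ≤ i → ζ i = false)
      (fun ζ => ∀ v < s * n, (ζ (N + n + Q * (s * n) * m + c * (Q * (s * n)) + v) = true ↔
        v / n = j % s)) := by
  have hQ1 : 1 ≤ Q := Nat.pos_of_ne_zero (by rintro rfl; simp at hj)
  have hD : 1 ≤ s * n := Nat.mul_pos hs hn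
  have hP : 1 ≤ Q * (s * n) := Nat.mul_pos hQ1 hD
  have hc : (c + 1) * (Q * (s * n)) = c * (Q * (s * n)) + Q * (s * n) := Nat.succ_mul _ _
  have hm : m ≤ Q * (s * n) * m := Nat.le_mul_of_pos_left _ hP
  refine Takes.append ?_ ((takes_fanLayers le_rfl (by omega) hP hQ Γ).append
    ((takes_andLayers le_rfl (by omega) hR Γ).append ?_))
  · refine Takes.cnot ?_ ?_ ?_ ?_ ?_ ?_
    iterate 5 · intros; omega
    · rintro ζ ζ' ⟨h1, h2⟩ h3 h4
      refine ⟨fun v hv => ?_, fun i hi => ?_⟩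
      · rw [h3 v hv, h2 _ (by omega), h1 v hv, Bool.false_xor]
      · rw [h4 _ (by intros; omega), h2 _ (by omega)]
  · have h := takes_sumLayers (N' := N + n + Q * (s * n) * m + (c + 1) * (Q * (s * n)))
      (b := N + n + Q * (s * n) * m + c * (Q * (s * n))) hn (show n ≤ N by omega) (by omega)
      (by omega) hs ((Nat.le_mul_of_pos_right _ hD).trans hQ) hj
    refine ⟨h.1, fun ζ hζ => h.2 ζ fun v hv => ?_⟩
    rw [hζ v hv]
    refine hΓ _ ?_
    rw [Nat.div_lt_iff_lt_mul hn, mul_assoc]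
    exact hv

end RGate

/-! ### Completing a partial run -/

namespace RGate

open COp

/-- The layers that swap the registers if the `i`-th group of control wires is set, followed by the
`i`-th gate. -/
def stage (n N b : ℕ) (G : List RGate) (i : ℕ) : List (List RGate) :=
  swapLayers n N (toffBlock ((List.range n).map fun q => (b + (i * n + q), N + q, q))) ++
    [[G.getD i (had 0)]]

/-- The layers that exchange the two registers, apply the gates, and exchange the registers back
before the gate whose number is given by the control wires. The earlier gates then act on the content
of the second register only, and the later ones complete the run. -/
def resumeLayers (n N b : ℕ) (G : List RGate) : List (List RGate) :=
  swapLayers n N (cnotBlock ((List.range n).map fun q => (N + q, q))) ++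
    (List.range G.length).flatMap (stage n N b G)

theorem layerOn_swap {n N N' : ℕ} (hn : n ≤ N) (hN : N + n ≤ N') :
    LayerOn N' (((List.range n).map fun q => (N + q, q)).map fun x => COp.cnot x.1 x.2) := by
  apply LayerOn.cnot_range <;> intros <;> omega

theorem run_swap {n N N' : ℕ} (hn : n ≤ N) (hN : N + n ≤ N') (φ χ : Bits n → ℂ) (ζ : ℕ → Bool) :
    run (swapLayers n N (cnotBlock ((List.range n).map fun q => (N + q, q)))).flatten
      (tens N φ χ ζ) = tens N χ φ ζ := by
  have hl := layerOn_swap hn hN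
  refine (run_swapLayers hn hN (Implements.cnotBlock hl) true φ χ ζ ?_ ?_).trans (if_pos rfl)
  · intro z i hi
    exact actL_cnot_of_ne (f := fun q => N + q) (g := fun q => q) (by intros; omega) z
  · intro z _ q hq
    rw [LayerOn.cnot_tgt (f := fun q => N + q) (g := fun q => q) hl hq, Bool.true_and]

theorem layerOn_controlled {n N N' b : ℕ} (hn : n ≤ N) (hN : N + n ≤ b) {i : ℕ}
    (hi : b + (i + 1) * n ≤ N') :
    LayerOn N' (((List.range n).map fun q => (b + (i * n + q), N + q, q)).map
      fun x => COp.toff x.1 x.2.1 x.2.2) := by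
  rw [Nat.succ_mul] at hi
  apply LayerOn.toff_range <;> intros <;> omega

theorem run_controlledSwap {n N N' b : ℕ} (hn : n ≤ N) (hN : N + n ≤ b) {i : ℕ}
    (hi : b + (i + 1) * n ≤ N') (β : Bool) (φ χ : Bits n → ℂ) (ζ : ℕ → Bool)
    (hζ : ∀ q < n, ζ (b + (i * n + q)) = β) :
    run (swapLayers n N
      (toffBlock ((List.range n).map fun q => (b + (i * n + q), N + q, q)))).flatten
        (tens N φ χ ζ) = if β then tens N χ φ ζ else tens N φ χ ζ := by
  have hl := layerOn_controlled hn hN hi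
  refine run_swapLayers hn (show N + n ≤ N' by omega) (Implements.toffBlock hl) β φ χ ζ ?_ ?_
  · intro z i hi
    exact actL_toff_of_ne (g := fun q => q) (by intros; omega) z
  · intro z hz q hq
    rw [LayerOn.toff_tgt (e := fun q => b + (i * n + q)) (f := fun q => N + q) (g := fun q => q)
      hl hq, hz (b + (i * n + q)) (by omega) (by omega), hζ q hq]

theorem validLayer_swapLayers {n N N' : ℕ} (hn : n ≤ N) (hN : N + n ≤ N')
    {mid : List (List RGate)} (h : ∀ b ∈ mid, ValidLayer N' b) :
    ∀ b ∈ swapLayers n N mid, ValidLayer N' b := by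
  have hc := validLayer_cnotBlock (layerOn_copy hn hN)
  intro b hb
  rcases List.mem_append.1 hb with hb | hb
  · exact (List.mem_append.1 hb).elim (hc b) (h b)
  · exact hc b hb

theorem validLayer_resumeLayers {n N N' b : ℕ} (hn : n ≤ N) (hN : N + n ≤ b)
    {G : List (QGate n)} (hb : b + G.length * n ≤ N') :
    ∀ l ∈ resumeLayers n N b (G.map QGate.raw), ValidLayer N' l := by
  intro l hl
  have hN' : N + n ≤ N' := by omega
  rcases List.mem_append.1 hl with hl | hl
  · exact validLayer_swapLayers hn hN' (validLayer_cnotBlock (layerOn_swap hn hN')) l hl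
  · obtain ⟨i, hi, hl⟩ := List.mem_flatMap.1 hl
    rw [List.mem_range, List.length_map] at hi
    have hi' : (i + 1) * n ≤ G.length * n := Nat.mul_le_mul_right _ hi
    rcases List.mem_append.1 hl with hl | hl
    · exact validLayer_swapLayers hn hN' (validLayer_toffBlock
        (layerOn_controlled hn hN (show b + (i + 1) * n ≤ N' by omega))) l hl
    · obtain rfl := List.mem_singleton.1 hl
      refine ⟨fun g hg => ?_, List.pairwise_singleton _ _⟩
      obtain rfl := List.mem_singleton.1 hg
      rw [List.getD_eq_getElem _ _ (by simpa using hi), List.getElem_map]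
      have h1 : ValidLayer n [(G[i]).raw] :=
        ⟨by simpa using (G[i]).valid_raw, List.pairwise_singleton _ _⟩
      exact (h1.mono (show n ≤ N' by omega)).1 _ (by simp)

/-- If the control wires say `i₀`, the first register ends up in the state in which the gates from
number `i₀` on have been applied to it. -/
theorem run_resumeLayers {n N b i₀ : ℕ} (hn : n ≤ N) (hN : N + n ≤ b) {G : List (QGate n)}
    (hi₀ : i₀ < G.length) (φ χ : Bits n → ℂ) (ζ : ℕ → Bool) (hn1 : 1 ≤ n)
    (hζ : ∀ v < G.length * n, (ζ (b + v) = true ↔ v / n = i₀)) :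
    ∃ χ', run (resumeLayers n N b (G.map QGate.raw)).flatten (tens N φ χ ζ) =
      tens N ((gatesOp (G.drop i₀)).mulVec φ) χ' ζ := by
  have main : ∀ i ≤ G.length, ∃ χ' : Bits n → ℂ,
      run ((List.range i).flatMap (stage n N b (G.map QGate.raw))).flatten (tens N χ φ ζ) =
        if i ≤ i₀ then tens N χ' φ ζ else
          tens N ((gatesOp ((G.take i).drop i₀)).mulVec φ) χ' ζ := by
    intro i hi
    induction i with
    | zero => exact ⟨χ, by simp [run_nil]⟩
    | succ i ih =>
      obtain ⟨χ', h1⟩ := ih (by omega)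
      have hi' : (i + 1) * n ≤ G.length * n := Nat.mul_le_mul_right _ hi
      have hc : ∀ q < n, ζ (b + (i * n + q)) = decide (i = i₀) := by
        intro q hq
        rw [Nat.succ_mul] at hi'
        rw [Bool.eq_iff_iff, hζ _ (by omega), decide_eq_true_eq, add_comm,
          Nat.add_mul_div_right _ _ hn1, Nat.div_eq_of_lt hq, zero_add]
      have hg : ∀ (φ χ : Bits n → ℂ) (ζ : ℕ → Bool),
          run [(G.map QGate.raw).getD i (had 0)] (tens N φ χ ζ) =
            tens N ((G[i]).op.mulVec φ) χ ζ := by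
        intro φ χ ζ
        have := run_tens_gates hn [G[i]] φ χ ζ
        rwa [gatesOp_singleton, List.map_singleton, ← List.getElem_map QGate.raw (l := G)
          (h := by simpa using hi), ← List.getD_eq_getElem _ (had 0)] at this
      have e : ((List.range (i + 1)).flatMap (stage n N b (G.map QGate.raw))).flatten =
          ((List.range i).flatMap (stage n N b (G.map QGate.raw))).flatten ++
          ((swapLayers n N (toffBlock ((List.range n).map fun q =>
            (b + (i * n + q), N + q, q)))).flatten ++ [(G.map QGate.raw).getD i (had 0)]) := by
        rw [List.range_succ, List.flatMap_append, List.flatten_append, List.flatMap_singleton,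
          stage, List.flatten_append]
        simp
      rw [e, run_append, h1, run_append]
      have hsw := fun φ χ => run_controlledSwap hn hN (le_refl (b + (i + 1) * n)) _ φ χ ζ hc
      rcases lt_trichotomy i i₀ with h | h | h
      · refine ⟨(G[i]).op.mulVec χ', ?_⟩
        rw [if_pos h.le, hsw, if_neg (by simpa using h.ne), if_pos (by omega), hg]
      · subst h
        refine ⟨χ', ?_⟩
        rw [if_pos le_rfl, hsw, if_pos (by simp), if_neg (by omega), hg, List.take_succ_eq_append_getElem hi,
          List.drop_append, List.drop_of_length_le (by simp), List.nil_append]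
        simp [gatesOp_singleton, Nat.min_eq_left (show i ≤ G.length by omega)]
      · refine ⟨χ', ?_⟩
        rw [if_neg (by omega), hsw, if_neg (by simpa using h.ne'), if_neg (by omega), hg,
          List.take_succ_eq_append_getElem hi, List.drop_append_of_le_length (by simp; omega),
          gatesOp_append, gatesOp_singleton, Matrix.mulVec_mulVec]
  obtain ⟨χ', h⟩ := main G.length le_rfl
  rw [if_neg (by omega), List.take_length] at h
  refine ⟨χ', ?_⟩
  rw [resumeLayers, List.flatten_append, run_append, run_swap hn le_rfl, List.length_map, h]

theorem length_cnotBlock (l : List (ℕ × ℕ)) : (cnotBlock l).length = 1 := rfl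

theorem length_toffBlock (l : List (ℕ × ℕ × ℕ)) : (toffBlock l).length = 35 := rfl

theorem length_flatMap_range {α : Type} {f : ℕ → List α} {a : ℕ} (h : ∀ i, (f i).length = a)
    (k : ℕ) : ((List.range k).flatMap f).length = k * a := by
  simp [List.length_flatMap, h]

theorem length_decodeLayers (n m N c s Q : ℕ) (R : List (List ℕ)) :
    (decodeLayers n m N c s Q R).length = 2 + 2 * s + 35 * c := by
  simp only [decodeLayers, fanLayers, andLayers, sumLayers, List.length_append, length_cnotBlock,
    length_flatMap_range (fun i => length_cnotBlock _), length_flatMap_range (fun i => length_toffBlock _)]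
  ring

theorem length_resumeLayers (n N b : ℕ) (G : List RGate) :
    (resumeLayers n N b G).length = 3 + 38 * G.length := by
  have h : ∀ i, (stage n N b G i).length = 38 := fun i => by
    simp [stage, swapLayers, length_cnotBlock, length_toffBlock]
  simp only [resumeLayers, List.length_append, length_flatMap_range h, swapLayers,
    length_cnotBlock]
  ring

end RGate

/-! ### Uniformity of the circuits -/

namespace RGate

/-- The layers of the circuit that breaks the puzzle, from the layers `B` of a simulator on `N`
qubits: they set the clock to its initial state, simulate, and complete the current run of the
gates `G`. -/
def breakerLayers (n m N c Q : ℕ) (R : List (List ℕ)) (G : List RGate) (B : List (List RGate)) :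
    List (List RGate) :=
  invBlock ((R.getD 0 []).map fun e => n + e) ++ (B ++
    (decodeLayers n m N c G.length Q R ++
      resumeLayers n N (N + n + Q * (G.length * n) * m + c * (Q * (G.length * n))) G))

/-- The number of qubits of that circuit. -/
def breakerWidth (n m N c Q s : ℕ) : ℕ :=
  N + n + Q * (s * n) * m + (c + 1) * (Q * (s * n))

end RGate

namespace PolyTime

variable {α : Type} [TreeEnc α]

@[fun_prop]
theorem had {f : α → ℕ} (hf : PolyTime f) : PolyTime fun a => RGate.had (f a) := by
  have := (const (α := α) 0).prodMk hf
  obtain ⟨p, τ, h⟩ := this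
  exact ⟨p, τ, h⟩

@[fun_prop]
theorem tee {f : α → ℕ} (hf : PolyTime f) : PolyTime fun a => RGate.tee (f a) := by
  have := (const (α := α) 1).prodMk hf
  obtain ⟨p, τ, h⟩ := this
  exact ⟨p, τ, h⟩

@[fun_prop]
theorem cnot {f g : α → ℕ} (hf : PolyTime f) (hg : PolyTime g) :
    PolyTime fun a => RGate.cnot (f a) (g a) := by
  have := (const (α := α) 2).prodMk (hf.prodMk hg)
  obtain ⟨p, τ, h⟩ := this
  exact ⟨p, τ, h⟩

@[fun_prop]
theorem cnotBlock {f : α → List (ℕ × ℕ)} (hf : PolyTime f) :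
    PolyTime fun a => RGate.cnotBlock (f a) := by
  simp only [RGate.cnotBlock, RGate.block, List.map_cons, List.map_nil]
  fun_prop

@[fun_prop]
theorem invBlock {f : α → List ℕ} (hf : PolyTime f) :
    PolyTime fun a => RGate.invBlock (f a) := by
  simp only [RGate.invBlock, RGate.block, RGate.invSteps, List.map_cons, List.map_nil,
    List.replicate, List.cons_append, List.nil_append]
  fun_prop

theorem block {ι : Type} [TreeEnc ι] {steps : List (ι → RGate)} (h : ∀ st ∈ steps, PolyTime st)
    {f : α → List ι} (hf : PolyTime f) : PolyTime fun a => RGate.block steps (f a) := by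
  induction steps with
  | nil => exact const []
  | cons st steps ih =>
    have h1 : PolyTime st := h st (by simp)
    have h2 := ih fun st hst => h st (by simp [hst])
    have h3 : PolyTime fun a => (f a).map st := map hf (h1.comp (by fun_prop))
    exact cons h3 h2

@[fun_prop]
theorem toffBlock {f : α → List (ℕ × ℕ × ℕ)} (hf : PolyTime f) :
    PolyTime fun a => RGate.toffBlock (f a) := by
  refine block ?_ hf
  intro st hst
  simp only [RGate.toffSteps, List.mem_append, List.mem_cons, List.mem_replicate,
    List.not_mem_nil, or_false] at hst
  casesm* _ ∨ _, _ ∧ _ <;> subst_vars <;> fun_prop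

@[fun_prop]
theorem doubling {f g : α → ℕ} (hf : PolyTime f) (hg : PolyTime g) :
    PolyTime fun a => RGate.doubling (f a) (g a) := by
  obtain ⟨P, hP⟩ := hf.bdd
  refine iterate (h := fun a x => min (x + x) (f a)) hg (const 1) (by fun_prop)
    ⟨P + 3, fun a k _ => ?_⟩
  have h1 : (fun x => min (x + x) (f a))^[k] 1 ≤ f a + 1 := by
    cases k with
    | zero => simp
    | succ k => rw [Function.iterate_succ_apply']; exact (min_le_right _ _).trans (by omega)
  have h2 := hP a
  rw [sz_nat] at h2 ⊢
  rw [Polynomial.eval_add, Polynomial.eval_ofNat]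
  omega

variable {n m N c Q s b k : α → ℕ} {R : α → List (List ℕ)} {G : α → List RGate}
  {B : α → List (List RGate)}

@[fun_prop]
theorem swapLayers (hn : PolyTime n) (hN : PolyTime N) (hB : PolyTime B) :
    PolyTime fun a => RGate.swapLayers (n a) (N a) (B a) := by
  unfold RGate.swapLayers
  fun_prop

@[fun_prop]
theorem resumeLayers (hn : PolyTime n) (hN : PolyTime N) (hb : PolyTime b) (hG : PolyTime G) :
    PolyTime fun a => RGate.resumeLayers (n a) (N a) (b a) (G a) := by
  unfold RGate.resumeLayers RGate.stage
  fun_prop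

@[fun_prop]
theorem fanLayers (hb : PolyTime b) (hk : PolyTime k) (hQ : PolyTime Q) (hs : PolyTime s) :
    PolyTime fun a => RGate.fanLayers (b a) (k a) (Q a) (s a) := by
  unfold RGate.fanLayers
  fun_prop

@[fun_prop]
theorem sumLayers (hb : PolyTime b) (hk : PolyTime k) (hQ : PolyTime Q) (hs : PolyTime s) :
    PolyTime fun a => RGate.sumLayers (b a) (k a) (Q a) (s a) := by
  unfold RGate.sumLayers
  fun_prop

@[fun_prop]
theorem andLayers (hn : PolyTime n) (hm : PolyTime m) (hb : PolyTime b) (hc : PolyTime c)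
    (hQ : PolyTime Q) (hR : PolyTime R) :
    PolyTime fun a => RGate.andLayers (n a) (m a) (b a) (c a) (Q a) (R a) := by
  unfold RGate.andLayers
  fun_prop

@[fun_prop]
theorem breakerLayers (hn : PolyTime n) (hm : PolyTime m) (hN : PolyTime N) (hc : PolyTime c)
    (hQ : PolyTime Q) (hR : PolyTime R) (hG : PolyTime G) (hB : PolyTime B) :
    PolyTime fun a =>
      RGate.breakerLayers (n a) (m a) (N a) (c a) (Q a) (R a) (G a) (B a) := by
  unfold RGate.breakerLayers RGate.decodeLayers
  fun_prop

@[fun_prop]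
theorem breakerWidth (hn : PolyTime n) (hm : PolyTime m) (hN : PolyTime N) (hc : PolyTime c)
    (hQ : PolyTime Q) (hs : PolyTime s) :
    PolyTime fun a => RGate.breakerWidth (n a) (m a) (N a) (c a) (Q a) (s a) := by
  unfold RGate.breakerWidth
  fun_prop

@[fun_prop]
theorem mem {f : α → ℕ} {l : α → List ℕ} (hf : PolyTime f) (hl : PolyTime l) :
    PolyTime fun a => decide (f a ∈ l a) := by
  have : PolyTime fun a => !decide (((l a).filter fun x => decide (x = f a)).length = 0) := by
    fun_prop
  convert this using 2 with a
  rw [Bool.eq_iff_iff]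
  simp

end PolyTime

attribute [fun_prop] PolyTime.revolvingDoor PolyTime.polynomialEval

/-- The number of clock qubits for a circuit with `s` gates. -/
def numClockQubits (T : Polynomial ℕ) (c n s : ℕ) : ℕ :=
  ((List.range (2 * s * T.eval n)).filter
    fun i => decide ((i + 1) ^ c ≤ 2 * s * T.eval n)).length

@[fun_prop]
theorem PolyTime.numClockQubits {α : Type} [TreeEnc α] (T : Polynomial ℕ) (c : ℕ) {n s : α → ℕ}
    (hn : PolyTime n) (hs : PolyTime s) : PolyTime fun a => numClockQubits T c (n a) (s a) := by
  unfold _root_.numClockQubits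
  fun_prop

theorem Gen.circuit {s : ℕ → ℕ} (F : IteratedFunction s) :
    Gen (fun n => n + s n) fun n => ((n, (F.circuit n).raw) : ℕ × List (List RGate)) := by
  have h := F.circuit_uniform
  unfold UniformFamily at h
  simp only [← QCircuit.tree_raw] at h
  exact h

theorem length_raw {s : ℕ → ℕ} (F : IteratedFunction s) {n : ℕ} (hn : 1 ≤ n) :
    (F.circuit n).raw.flatten.length = s n := by
  rw [QCircuit.flatten_raw, List.length_map]
  exact F.circuit_size n hn

theorem clockTree_doorSet (k m L : ℕ) : clockTree L (doorSet k m) = tree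
    ((List.range (L + 1)).map fun j => (List.range m).map fun i =>
      if i ∈ (revolvingDoor k m).getD j [] then 1 else 0) := by
  have h : ∀ {α β γ : Type} (e : β → Tree₂) (e' : γ → Tree₂) (f : α → β) (f' : α → γ),
      (∀ a, e (f a) = e' (f' a)) → ∀ l : List α,
      Tree₂.ofList e (l.map f) = Tree₂.ofList e' (l.map f') := by
    intro α β γ e e' f f' hf l
    induction l with
    | nil => rfl
    | cons a l ih => rw [List.map_cons, List.map_cons, Tree₂.ofList, Tree₂.ofList, hf, ih]
  show Tree₂.ofList _ _ = Tree₂.ofList tree _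
  rw [← List.map_id (List.range (L + 1)), List.map_map]
  refine h _ _ _ _ (fun j => ?_) _
  show Tree₂.ofList _ _ = Tree₂.ofList tree ((List.range m).map _)
  rw [← List.map_coe_finRange_eq_range, List.map_map, ← List.map_id (List.finRange m), List.map_map]
  refine h _ _ _ _ (fun i => ?_) _
  simp only [doorSet, Finset.mem_filter, Finset.mem_univ, true_and, id, Function.comp_apply]
  split_ifs <;> rfl

theorem polyTimeGenerated_clockTree {s : ℕ → ℕ} (F : IteratedFunction s) (T : Polynomial ℕ) {c : ℕ}
    (hc : 1 ≤ c) : PolyTimeGenerated (fun n => n + s n) fun n =>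
      clockTree (clockLength s T n) (doorSet (c + 1) (clockQubits s T c n)) := by
  have hf : PolyTime fun x : ℕ × List (List RGate) =>
      (List.range (2 * x.2.flatten.length * T.eval x.1 + 1)).map fun j =>
        (List.range (numClockQubits T c x.1 x.2.flatten.length)).map fun i =>
          if i ∈ (revolvingDoor (c + 1) (numClockQubits T c x.1 x.2.flatten.length)).getD j []
          then 1 else 0 := by
    fun_prop
  refine PolyTimeGenerated.congr_eventually (.of_le fun n => Nat.le_add_right _ _)
    ((Gen.circuit F).map hf) ?_
  filter_upwards [eventually_ge_atTop 1] with n hn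
  rw [clockTree_doorSet, length_raw F hn, clockQubits_eq _ _ hc, numClockQubits, clockLength]

/-- The circuits that break the puzzle are generated efficiently. -/
theorem gen_breaker {s : ℕ → ℕ} (F : IteratedFunction s) (T : Polynomial ℕ) (c : ℕ)
    {B : ℕ → ℕ} (hB : PolyBdd (fun n => n + s n) B) {N : ℕ → ℕ} {C : ∀ n, QCircuit (N n)}
    (hC : UniformFamily B C) : Gen B fun n =>
      let m := numClockQubits T c n (F.circuit n).raw.flatten.length
      (RGate.breakerWidth n m (N n) c (2 * T.eval n + 1) (F.circuit n).raw.flatten.length,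
        RGate.breakerLayers n m (N n) c (2 * T.eval n + 1) (revolvingDoor (c + 1) m)
          (F.circuit n).raw.flatten (C n).raw) := by
  have hf : PolyTime fun x : (ℕ × List (List RGate)) × (ℕ × List (List RGate)) =>
      (RGate.breakerWidth x.1.1 (numClockQubits T c x.1.1 x.1.2.flatten.length) x.2.1 c
          (2 * T.eval x.1.1 + 1) x.1.2.flatten.length,
        RGate.breakerLayers x.1.1 (numClockQubits T c x.1.1 x.1.2.flatten.length) x.2.1 c
          (2 * T.eval x.1.1 + 1)
          (revolvingDoor (c + 1) (numClockQubits T c x.1.1 x.1.2.flatten.length))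
          x.1.2.flatten x.2.2) := by
    fun_prop
  have hC' : Gen B fun n => ((N n, (C n).raw) : ℕ × List (List RGate)) := by
    unfold UniformFamily at hC
    simp only [← QCircuit.tree_raw] at hC
    exact hC
  exact (Gen.pair (PolyTimeGenerated.mono (Gen.circuit F) hB) hC').map hf

/-! ### Inner products of amplitudes -/

section innerProducts

variable {ι κ : Type} [Fintype κ]

/-- Bessel's inequality. -/
theorem bessel [Fintype ι] [DecidableEq ι] {e : ι → κ → ℂ}
    (he : ∀ i j, star (e i) ⬝ᵥ e j = if i = j then 1 else 0) (f : κ → ℂ) :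
    ∑ i, ‖star (e i) ⬝ᵥ f‖ ^ 2 ≤ ∑ v, ‖f v‖ ^ 2 := by
  have hin : ∀ a b : κ → ℂ, inner ℂ (WithLp.toLp 2 a : EuclideanSpace ℂ κ) (WithLp.toLp 2 b) =
      star a ⬝ᵥ b := fun a b => by
    rw [EuclideanSpace.inner_toLp_toLp, dotProduct_comm]
  have ho : Orthonormal ℂ fun i => (WithLp.toLp 2 (e i) : EuclideanSpace ℂ κ) := by
    rw [orthonormal_iff_ite]
    intro i j
    rw [hin, he]
  have := ho.sum_inner_products_le (WithLp.toLp 2 f) (s := Finset.univ)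
  simpa only [hin, EuclideanSpace.norm_sq_eq] using this

theorem dotProduct_mulVec_unitary [DecidableEq κ] {U : Matrix κ κ ℂ}
    (hU : U ∈ Matrix.unitaryGroup κ ℂ) (f g : κ → ℂ) :
    star (U.mulVec f) ⬝ᵥ U.mulVec g = star f ⬝ᵥ g := by
  rw [Matrix.star_mulVec, Matrix.dotProduct_mulVec, Matrix.vecMul_vecMul,
    ← Matrix.star_eq_conjTranspose, (Matrix.mem_unitaryGroup_iff').1 hU, Matrix.vecMul_one]

theorem sum_append {n a : ℕ} {M : Type*} [AddCommMonoid M] (f : Bits (n + a) → M) :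
    ∑ v, f v = ∑ y : Bits n, ∑ w : Bits a, f (Fin.append y w) := by
  rw [← Fintype.sum_prod_type', ← (Fin.appendEquiv n a).sum_comp]
  rfl

theorem append_eq_append_iff {n a : ℕ} {y y' : Bits n} {w w' : Bits a} :
    Fin.append y w = Fin.append y' w' ↔ y = y' ∧ w = w' := by
  have := (Fin.appendEquiv (α := Bool) n a).injective.eq_iff (a := (y, w)) (b := (y', w'))
  rw [Prod.mk.injEq] at this
  exact this

theorem append_comp_castAdd {n a : ℕ} (y : Bits n) (w : Bits a) :
    (fun i => Fin.append y w (Fin.castAdd a i)) = y := funext fun i => Fin.append_left y w i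

theorem append_comp_natAdd {n a : ℕ} (y : Bits n) (w : Bits a) :
    (fun i => Fin.append y w (Fin.natAdd n i)) = w := funext fun i => Fin.append_right y w i

theorem append_of_lt {n a : ℕ} (y : Bits n) (w : Bits a) {i : ℕ} (h : i < n) (h' : i < n + a) :
    Fin.append y w ⟨i, h'⟩ = y ⟨i, h⟩ := Fin.append_left y w ⟨i, h⟩

theorem append_of_le {n a : ℕ} (y : Bits n) (w : Bits a) {i : ℕ} (h : i < a) (h' : n + i < n + a) :
    Fin.append y w ⟨n + i, h'⟩ = w ⟨i, h⟩ := Fin.append_right y w ⟨i, h⟩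

end innerProducts

/-! ### States with zeros on all ancillas -/

open Classical in
/-- The state `φ` on the first `N` wires, with zeros on all other wires. -/
noncomputable def emb {N : ℕ} (φ : Bits N → ℂ) : Wave := fun z =>
  if ∀ i, N ≤ i → z i = false then φ fun i => z i else 0

section emb

variable {N : ℕ}

theorem emb_splice_false (φ : Bits N → ℂ) (w : Bits N) : emb φ (splice (fun _ => false) w) = φ w := by
  rw [emb, if_pos fun i hi => splice_of_le _ _ hi]
  congr 1
  exact funext fun i => splice_val _ _ i

theorem eq_splice_false_iff {z : ℕ → Bool} {w : Bits N} : z = splice (fun _ => false) w ↔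
    (∀ i, N ≤ i → z i = false) ∧ (fun i : Fin N => z i) = w := by
  constructor
  · rintro rfl
    exact ⟨fun i hi => splice_of_le _ _ hi, funext fun i => splice_val _ _ i⟩
  · rintro ⟨h, rfl⟩
    funext i
    unfold splice
    split_ifs with hi
    · rfl
    · exact h i (by omega)

open Classical in
theorem emb_single (u : Bits N) :
    emb (Pi.single u 1) = fun z => if z = splice (fun _ => false) u then 1 else 0 := by
  funext z
  rw [emb]
  simp only [eq_splice_false_iff, Pi.single_apply]
  split_ifs <;> tauto

/-- Raw gates act on an embedded state as the circuit does on the state. -/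
theorem run_emb (G : List (QGate N)) (φ : Bits N → ℂ) :
    RGate.run (G.map QGate.raw) (emb φ) = emb ((gatesOp G).mulVec φ) := by
  funext z
  have h := run_splice G (emb φ) z fun i => z i
  rw [splice_self] at h
  rw [h, emb]
  have e1 : ∀ v : Bits N, (∀ i, N ≤ i → splice z v i = false) ↔ ∀ i, N ≤ i → z i = false :=
    fun v => forall_congr' fun i => forall_congr' fun hi => by rw [splice_of_le z v hi]
  have e2 : ∀ v : Bits N, (fun i : Fin N => splice z v i) = v := fun v =>
    funext fun i => splice_val z v i
  split_ifs with hz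
  · congr 2
    funext v
    rw [emb, if_pos ((e1 v).2 hz), e2]
  · have : (fun v : Bits N => emb φ (splice z v)) = 0 := by
      funext v
      rw [emb, if_neg (mt (e1 v).1 hz)]
      rfl
    rw [this, Matrix.mulVec_zero]
    rfl

/-- The amplitudes of a state on `N` wires, as a state on `W ≥ N` wires. -/
noncomputable def extend {N : ℕ} (W : ℕ) (φ : Bits N → ℂ) : Bits W → ℂ := fun v =>
  emb φ (splice (fun _ => false) v)

/-- Additional wires in the state `0` do not change inner products. -/
theorem dotProduct_extend {W : ℕ} (h : N ≤ W) (φ χ : Bits N → ℂ) :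
    star (extend W φ) ⬝ᵥ extend W χ = star φ ⬝ᵥ χ := by
  classical
  have hz : ∀ v : Bits W, (∀ i, N ≤ i → splice (fun _ => false) v i = false) ↔
      ∃ u : Bits N, v = fun i : Fin W => splice (fun _ => false) u i := by
    intro v
    constructor
    · intro h1
      refine ⟨fun i => v ⟨i, by omega⟩, funext fun i => ?_⟩
      by_cases hi : i.1 < N
      · rw [splice_of_lt _ _ hi]
      · rw [splice_of_le _ _ (by omega), ← splice_val (fun _ => false) v i, h1 _ (by omega)]
    · rintro ⟨u, rfl⟩ i hi
      by_cases hi' : i < W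
      · rw [splice_of_lt (N := W) _ _ hi', splice_of_le (N := N) _ _ hi]
      · rw [splice_of_le (N := W) _ _ (by omega)]
  have hinj : Function.Injective fun (u : Bits N) => fun i : Fin W =>
      splice (fun _ => false) u i := by
    intro u u' huu
    funext i
    have := congrFun huu ⟨i, by omega⟩
    simpa only [splice_val] using this
  have hext : ∀ u : Bits N, splice (fun _ => false) (fun i : Fin W => splice (fun _ => false) u i) =
      splice (fun _ => false) u := by
    intro u
    funext i
    by_cases hi : i < W
    · rw [splice_of_lt _ _ hi]
    · rw [splice_of_le (N := W) _ _ (by omega), splice_of_le (N := N) _ _ (by omega)]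
  simp only [dotProduct, Pi.star_apply]
  rw [← Finset.sum_subset (Finset.subset_univ (Finset.univ.image fun (u : Bits N) =>
    fun i : Fin W => splice (fun _ => false) u i)), Finset.sum_image fun u _ u' _ h => hinj h]
  · simp only [extend, hext, emb_splice_false]
  · intro v _ hv
    have : ¬ ∀ i, N ≤ i → splice (fun _ => false) v i = false := by
      rw [hz]
      rintro ⟨u, rfl⟩
      exact hv (Finset.mem_image_of_mem _ (Finset.mem_univ u))
    rw [extend, extend, emb, if_neg this, star_zero, zero_mul]

theorem mulVec_extend {W : ℕ} (G : List (QGate W)) (φ : Bits N → ℂ) (v : Bits W) :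
    (gatesOp G).mulVec (extend W φ) v =
      RGate.run (G.map QGate.raw) (emb φ) (splice (fun _ => false) v) := by
  rw [run_splice]
  rfl

end emb

/-! ### History states -/

/-- The bits of the clock state `|S⟩`. -/
def clockBits {m : ℕ} (S : Finset (Fin m)) : Bits m := fun i => decide (i ∈ S)

theorem clockBits_injective {m : ℕ} : Function.Injective (clockBits (m := m)) := fun S S' h => by
  ext i
  have := congrFun h i
  simpa [clockBits] using this

/-- The state `U_j ⋯ U_1 |x⟩ ⊗ |γ_j⟩`. -/
noncomputable def historyState {n m : ℕ} (U : List (QGate n)) (γ : ℕ → Finset (Fin m)) (x : Bits n)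
    (j : ℕ) : Bits (n + m) → ℂ := fun p =>
  (gatesOp (U.take j)).mulVec (Pi.single x 1) (fun i => p (Fin.castAdd m i)) *
    if (fun i => p (Fin.natAdd n i)) = clockBits (γ j) then 1 else 0

theorem historyState_append {n m : ℕ} (U : List (QGate n)) (γ : ℕ → Finset (Fin m)) (x y : Bits n)
    (κ : Bits m) (j : ℕ) : historyState U γ x j (Fin.append y κ) =
      (gatesOp (U.take j)).mulVec (Pi.single x 1) y * if κ = clockBits (γ j) then 1 else 0 := by
  rw [historyState, append_comp_castAdd, append_comp_natAdd]

theorem dotProduct_historyState {n m : ℕ} (U : List (QGate n)) (γ : ℕ → Finset (Fin m))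
    (x : Bits n) {j j' : ℕ} (h : γ j = γ j' → j = j') :
    star (historyState U γ x j) ⬝ᵥ historyState U γ x j' = if j = j' then 1 else 0 := by
  simp only [dotProduct, Pi.star_apply]
  rw [sum_append]
  simp only [historyState_append, star_mul', apply_ite star, star_one, star_zero]
  split_ifs with hj
  · subst hj
    have h1 := dotProduct_mulVec_unitary (gatesOp_unitary (U.take j)) (Pi.single x 1)
      (Pi.single x 1)
    simp only [dotProduct, Pi.star_apply] at h1
    simp only [mul_ite, mul_one, mul_zero, Finset.sum_ite_eq', Finset.mem_univ, if_true, ite_mul,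
      zero_mul]
    rw [h1]
    simp [Pi.single_apply, apply_ite]
  · refine Finset.sum_eq_zero fun y _ => Finset.sum_eq_zero fun κ _ => ?_
    by_cases h1 : κ = clockBits (γ j)
    · have h2 : κ ≠ clockBits (γ j') := fun h2 => hj (h (clockBits_injective (h1.symm.trans h2)))
      rw [if_neg h2, mul_zero, mul_zero]
    · rw [if_neg h1, mul_zero, zero_mul]

/-- Completing the current round. -/
theorem take_append_drop_flatten_replicate {α : Type*} (G : List α) (hG : 0 < G.length) {r j : ℕ}
    (hj : j ≤ r * G.length) :
    ((List.replicate r G).flatten).take j ++ G.drop (j % G.length) =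
      (List.replicate (j / G.length + 1) G).flatten := by
  induction r generalizing j with
  | zero =>
    obtain rfl : j = 0 := by omega
    simp
  | succ r ih =>
    rw [List.replicate_succ, List.flatten_cons]
    rcases lt_or_ge j G.length with h | h
    · rw [List.take_append_of_le_length h.le, Nat.mod_eq_of_lt h, Nat.div_eq_of_lt h,
        List.take_append_drop]
      simp
    · obtain ⟨i, rfl⟩ := Nat.exists_eq_add_of_le h
      rw [Nat.succ_mul] at hj
      rw [List.take_length_add_append, List.append_assoc, Nat.add_mod_left,
        Nat.add_div_left _ hG, ih (by omega), ← List.flatten_cons, ← List.replicate_succ]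

/-! ### The success probability of the completed simulation -/

section success

variable {n m a : ℕ}

theorem splice_append_false {n k : ℕ} (x : Bits n) :
    splice (fun _ => false) (Fin.append x fun _ : Fin k => false) = splice (fun _ => false) x := by
  funext i
  rcases lt_or_ge i n with h | h
  · rw [splice_of_lt _ _ (by omega), splice_of_lt _ _ h, append_of_lt _ _ h]
  · rw [splice_of_le _ x h]
    rcases lt_or_ge i (n + k) with h' | h'
    · obtain ⟨e, rfl⟩ := Nat.exists_eq_add_of_le h
      rw [splice_of_lt _ _ h', append_of_le _ _ (by omega)]
    · rw [splice_of_le _ _ h']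

theorem splice_injective {N : ℕ} (z : ℕ → Bool) : Function.Injective (splice (N := N) z) := by
  intro w w' h
  funext i
  rw [← splice_val z w i, h, splice_val]

/-- Setting the clock. -/
theorem run_invBlock_emb {l : List ℕ} (hl : l.Nodup) (hlm : ∀ e ∈ l, e < m) {S : Finset (Fin m)}
    (hS : ∀ e : Fin m, e ∈ S ↔ e.1 ∈ l) (x : Bits n) {W : ℕ} (hW : n + m + a ≤ W) :
    (∀ b ∈ RGate.invBlock (l.map fun e => n + e), RGate.ValidLayer W b) ∧
    RGate.run (RGate.invBlock (l.map fun e => n + e)).flatten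
      (emb (Pi.single (Fin.append (Fin.append x fun _ => false) fun _ => false : Bits (n + m + a))
        1)) =
      emb (Pi.single (Fin.append (Fin.append x (clockBits S)) fun _ => false : Bits (n + m + a))
        1) := by
  have hlayer : COp.LayerOn W ((l.map fun e => n + e).map COp.inv) := by
    refine ⟨⟨?_, ?_⟩, ?_⟩
    · simp only [List.mem_map]
      rintro _ ⟨_, _, rfl⟩
      trivial
    · rw [List.map_map, List.pairwise_map]
      refine hl.imp fun {e e'} h => ?_
      simpa [COp.wires, COp.tgt, COp.ctrls] using h
    · simp only [List.mem_map]
      rintro _ ⟨_, ⟨e, he, rfl⟩, rfl⟩ i hi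
      have := hlm e he
      simp only [COp.wires, COp.tgt, COp.ctrls, Finset.insert_empty, Finset.mem_singleton] at hi
      omega
  have himp := RGate.Implements.invBlock hlayer
  refine ⟨himp.2.1, ?_⟩
  rw [himp.2.2, emb_single, emb_single]
  funext z
  have key : ∀ (z : ℕ → Bool) i, COp.actL ((l.map fun e => n + e).map COp.inv) z i =
      if ∃ e ∈ l, i = n + e then !z i else z i := by
    intro z i
    split_ifs with h
    · obtain ⟨e, he, rfl⟩ := h
      have := hlayer.1.actL_tgt (o := .inv (n + e)) (by simpa using he) z
      simpa [COp.tgt, COp.val] using this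
    · refine COp.actL_of_forall_ne ?_ z
      simp only [List.mem_map]
      rintro _ ⟨_, ⟨e, he, rfl⟩, rfl⟩ h'
      exact h ⟨e, he, h'.symm⟩
  have hact : COp.actL ((l.map fun e => n + e).map COp.inv) (splice (fun _ => false)
      (Fin.append (Fin.append x fun _ => false) fun _ => false : Bits (n + m + a))) =
      splice (fun _ => false)
        (Fin.append (Fin.append x (clockBits S)) fun _ => false : Bits (n + m + a)) := by
    funext i
    rw [key]
    rcases lt_or_ge i n with h | h
    · rw [if_neg (by rintro ⟨e, -, rfl⟩; omega), splice_of_lt _ _ (by omega),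
        splice_of_lt _ _ (by omega), append_of_lt _ _ (show i < n + m by omega),
        append_of_lt _ _ (show i < n + m by omega), append_of_lt _ _ h, append_of_lt _ _ h]
    · obtain ⟨e, rfl⟩ := Nat.exists_eq_add_of_le h
      rcases lt_or_ge e m with he | he
      · rw [splice_of_lt _ _ (by omega), splice_of_lt _ _ (by omega),
          append_of_lt _ _ (show n + e < n + m by omega),
          append_of_lt _ _ (show n + e < n + m by omega), append_of_le _ _ he, append_of_le _ _ he]
        have h1 : (∃ e' ∈ l, n + e = n + e') ↔ (⟨e, he⟩ : Fin m) ∈ S := by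
          rw [hS]
          constructor
          · rintro ⟨e', h2, h3⟩
            obtain rfl := Nat.add_left_cancel h3
            exact h2
          · exact fun h2 => ⟨e, h2, rfl⟩
        simp only [h1, clockBits]
        split_ifs with h2 <;> simp [h2]
      · have h1 : ¬ ∃ e' ∈ l, n + e = n + e' := by
          rintro ⟨e', h2, h3⟩
          have := hlm e' h2
          omega
        rw [if_neg h1]
        rcases lt_or_ge e (m + a) with he' | he'
        · obtain ⟨q, rfl⟩ := Nat.exists_eq_add_of_le he
          rw [splice_of_lt _ _ (by omega), splice_of_lt _ _ (by omega)]
          simp only [← Nat.add_assoc]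
          rw [append_of_le _ _ (by omega), append_of_le _ _ (by omega)]
        · rw [splice_of_le _ _ (by omega), splice_of_le _ _ (by omega)]
  have hiff : COp.actL ((l.map fun e => n + e).map COp.inv) z = splice (fun _ => false)
      (Fin.append (Fin.append x fun _ => false) fun _ => false : Bits (n + m + a)) ↔
      z = splice (fun _ => false)
        (Fin.append (Fin.append x (clockBits S)) fun _ => false : Bits (n + m + a)) := by
    rw [← hact]
    constructor
    · intro h; rw [← h, hlayer.1.actL_actL]
    · rintro rfl; rw [hlayer.1.actL_actL]
  classical exact if_congr hiff rfl rfl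

/-- A history state with ancillas in the basis state `w`, as a product state. -/
theorem emb_historyState (U : List (QGate n)) (γ : ℕ → Finset (Fin m)) (x : Bits n) (j : ℕ)
    (w : Bits a) :
    emb (fun u : Bits (n + m + a) => historyState U γ x j (fun i => u (Fin.castAdd a i)) *
      if (fun i => u (Fin.natAdd (n + m) i)) = w then 1 else 0) =
    tens (n + m + a) ((gatesOp (U.take j)).mulVec (Pi.single x 1)) (Pi.single (fun _ => false) 1)
      (splice (fun _ => false)
        (Fin.append (Fin.append (fun _ : Fin n => false) (clockBits (γ j))) w)) := by
  funext z
  set ζ := splice (fun _ => false)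
        (Fin.append (Fin.append (fun _ : Fin n => false) (clockBits (γ j))) w) with hζ
  have hc : ∀ e (h : e < m), ζ (n + e) = clockBits (γ j) ⟨e, h⟩ := fun e h => by
    rw [hζ, splice_of_lt _ _ (by omega), append_of_lt _ _ (show n + e < n + m by omega),
      append_of_le _ _ h]
  have hw : ∀ e (h : e < a), ζ (n + m + e) = w ⟨e, h⟩ := fun e h => by
    rw [hζ, splice_of_lt _ _ (by omega), append_of_le _ _ h]
  have h0 : ∀ i, n + m + a ≤ i → ζ i = false := fun i hi => by
    rw [hζ, splice_of_le _ _ hi]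
  have hiff : ((∀ i, n + m + a ≤ i → z i = false) ∧
      (fun i : Fin m => z (Fin.castAdd a (Fin.natAdd n i))) = clockBits (γ j) ∧
      (fun i : Fin a => z (Fin.natAdd (n + m) i)) = w) ↔
      ((fun i : Fin n => z (n + m + a + i)) = (fun _ => false) ∧
        ∀ i, n ≤ i → ¬ (n + m + a ≤ i ∧ i < n + m + a + n) → z i = ζ i) := by
    constructor
    · rintro ⟨h1, h2, h3⟩
      refine ⟨funext fun i => h1 _ (by omega), fun i hi hi' => ?_⟩
      obtain ⟨e, rfl⟩ := Nat.exists_eq_add_of_le hi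
      rcases lt_or_ge e m with he | he
      · rw [hc e he, ← h2]; rfl
      · obtain ⟨q, rfl⟩ := Nat.exists_eq_add_of_le he
        rcases lt_or_ge q a with hq | hq
        · rw [← Nat.add_assoc, hw q hq, ← h3]; rfl
        · rw [h1 _ (by omega), h0 _ (by omega)]
    · rintro ⟨h1, h2⟩
      refine ⟨fun i hi => ?_, funext fun e => ?_, funext fun e => ?_⟩
      · by_cases hi' : i < n + m + a + n
        · obtain ⟨q, rfl⟩ := Nat.exists_eq_add_of_le hi
          exact congrFun h1 ⟨q, by omega⟩
        · rw [h2 i (by omega) (by omega), h0 i hi]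
      · have := e.2
        show z (n + e) = _
        rw [h2 _ (by omega) (by omega), hc e e.2]
      · have := e.2
        show z (n + m + e) = _
        rw [h2 _ (by omega) (by omega), hw e e.2]
  simp only [emb, tens, historyState, Pi.single_apply]
  by_cases h : (∀ i, n + m + a ≤ i → z i = false) ∧
      (fun i : Fin m => z (Fin.castAdd a (Fin.natAdd n i))) = clockBits (γ j) ∧
      (fun i : Fin a => z (Fin.natAdd (n + m) i)) = w
  · obtain ⟨h4, h5⟩ := hiff.1 h
    rw [if_pos h.1, if_pos h.2.1, if_pos h.2.2, if_pos h4, if_pos h5]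
    rfl
  · have h' := mt hiff.2 h
    by_cases h1 : ∀ i, n + m + a ≤ i → z i = false
    · rw [if_pos h1]
      by_cases h2 : (fun i : Fin m => z (Fin.castAdd a (Fin.natAdd n i))) = clockBits (γ j)
      · rw [if_pos h2, if_neg fun h3 => h ⟨h1, h2, h3⟩]
        by_cases h4 : (fun i : Fin n => z (n + m + a + i)) = (fun _ => false)
        · rw [if_pos h4, if_neg fun h5 => h' ⟨h4, h5⟩, mul_zero, mul_zero]
        · rw [if_neg h4, mul_zero, mul_zero, zero_mul]
      · rw [if_neg h2]
        by_cases h4 : (fun i : Fin n => z (n + m + a + i)) = (fun _ => false)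
        · rw [if_pos h4, if_neg fun h5 => h' ⟨h4, h5⟩, mul_zero, mul_zero, zero_mul]
        · rw [if_neg h4, mul_zero, mul_zero, zero_mul, zero_mul]
    · rw [if_neg h1]
      by_cases h4 : (fun i : Fin n => z (n + m + a + i)) = (fun _ => false)
      · rw [if_pos h4, if_neg fun h5 => h' ⟨h4, h5⟩, mul_zero]
      · rw [if_neg h4, mul_zero, zero_mul]

theorem dotProduct_mul_ite {N a : ℕ} (f : Bits N → ℂ) (w : Bits a) (g : Bits (N + a) → ℂ) :
    star (fun u : Bits (N + a) => f (fun i => u (Fin.castAdd a i)) *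
      if (fun i => u (Fin.natAdd N i)) = w then 1 else 0) ⬝ᵥ g =
    star f ⬝ᵥ fun p => g (Fin.append p w) := by
  simp only [dotProduct, Pi.star_apply]
  rw [sum_append]
  simp [append_comp_castAdd, append_comp_natAdd, apply_ite, ite_mul]

/-- If the second part of a circuit maps the history states in `J`, with any ancillas, to outputs in
`S`, then the probability of an output in `S` is at least the weight of these history states
after the first part. -/
theorem sum_outputProb_ge {a' : ℕ} {C' : QCircuit (n + a')} {C : QCircuit (n + m + a)}
    {pre post : List RGate} (hraw : C'.raw.flatten = pre ++ (C.raw.flatten ++ post))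
    (hW : n + m + a ≤ n + a') {γ : ℕ → Finset (Fin m)} {U : List (QGate n)} {x : Bits n}
    (hpre : RGate.run pre (emb (Pi.single (Fin.append (Fin.append x fun _ => false)
        fun _ => false : Bits (n + m + a)) 1)) =
      emb (Pi.single (Fin.append (Fin.append x (clockBits (γ 0))) fun _ => false :
        Bits (n + m + a)) 1))
    {J : Finset ℕ} (hγ : ∀ i ∈ J, ∀ j ∈ J, γ i = γ j → i = j) {S : Finset (Bits n)}
    (hpost : ∀ j ∈ J, ∀ w : Bits a, ∀ z : ℕ → Bool, (fun i : Fin n => z i) ∉ S →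
      RGate.run post (emb (fun u : Bits (n + m + a) =>
        historyState U γ x j (fun i => u (Fin.castAdd a i)) *
          if (fun i => u (Fin.natAdd (n + m) i)) = w then 1 else 0)) z = 0) :
    ∑ j ∈ J, ∑ w : Bits a, ‖star (historyState U γ x j) ⬝ᵥ fun p =>
        C.op (Fin.append p w) (Fin.append (Fin.append x (clockBits (γ 0))) fun _ => false)‖ ^ 2 ≤
      ∑ y ∈ S, C'.outputProb x y := by
  classical
  obtain ⟨G₁, G₂, hG, hG1, hG2⟩ : ∃ G₁ G₂, C'.gates = G₁ ++ G₂ ∧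
      G₁.map QGate.raw = pre ++ C.raw.flatten ∧ G₂.map QGate.raw = post := by
    rw [QCircuit.flatten_raw C', ← List.append_assoc] at hraw
    obtain ⟨G₁, G₂, h1, h2, h3⟩ := List.map_eq_append_iff.1 hraw
    exact ⟨G₁, G₂, h1, h2, h3⟩
  set u₀ : Bits (n + m + a) := Fin.append (Fin.append x fun _ => false) fun _ => false
  set u₁ : Bits (n + m + a) := Fin.append (Fin.append x (clockBits (γ 0))) fun _ => false
  set φ : Bits (n + m + a) → ℂ := C.op.mulVec (Pi.single u₁ 1) with hφ
  set Φ := extend (n + a') φ with hΦ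
  set η : ℕ → Bits a → Bits (n + m + a) → ℂ := fun j w u =>
    historyState U γ x j (fun i => u (Fin.castAdd a i)) *
      if (fun i => u (Fin.natAdd (n + m) i)) = w then 1 else 0 with hη
  have hφw : ∀ v, φ v = C.op v u₁ := fun v => by rw [hφ, Matrix.mulVec_single_one]; rfl
  -- the amplitudes of the output
  have hout : ∀ v, C'.op v (Fin.append x fun _ => false) = (gatesOp G₂).mulVec Φ v := by
    intro v
    have h1 : (Pi.single (Fin.append x fun _ => false : Bits (n + a')) 1 : Bits (n + a') → ℂ) =
        extend (n + a') (Pi.single u₀ 1) := by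
      funext v
      rw [extend, emb_single, Pi.single_apply]
      refine if_congr ?_ rfl rfl
      rw [show splice (fun _ => false) u₀ =
        splice (fun _ => false) (Fin.append x fun _ : Fin a' => false) from by
          simp only [u₀, splice_append_false]]
      exact (splice_injective _).eq_iff.symm
    have h2 : C'.op = gatesOp (G₁ ++ G₂) := by rw [← hG]; rfl
    have h3 : C'.op v (Fin.append x fun _ => false) =
        C'.op.mulVec (Pi.single (Fin.append x fun _ => false) 1) v := by
      rw [Matrix.mulVec_single_one]; rfl
    rw [h3, h1, h2, mulVec_extend, List.map_append, hG1,
      List.append_assoc, RGate.run_append, hpre, RGate.run_append, QCircuit.flatten_raw, run_emb,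
      mulVec_extend]
    rfl
  have hsum : ∑ y ∈ S, C'.outputProb x y = ∑ v : Bits (n + a'),
      ‖if (fun i : Fin n => v (Fin.castAdd a' i)) ∈ S then (gatesOp G₂).mulVec Φ v else 0‖ ^ 2 := by
    rw [sum_append, ← Finset.sum_subset (Finset.subset_univ S)]
    · refine Finset.sum_congr rfl fun y hy => ?_
      simp only [append_comp_castAdd, if_pos hy, QCircuit.outputProb, hout]
    · intro y _ hy
      simp [hy]
  rw [hsum]
  have hon : ∀ p q : J × Bits a,
      star ((gatesOp G₂).mulVec (extend (n + a') (η p.1 p.2))) ⬝ᵥ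
        (gatesOp G₂).mulVec (extend (n + a') (η q.1 q.2)) = if p = q then 1 else 0 := by
    intro p q
    rw [dotProduct_mulVec_unitary (gatesOp_unitary _), dotProduct_extend hW, hη,
      dotProduct_mul_ite]
    simp only [append_comp_castAdd, append_comp_natAdd]
    by_cases hw : p.2 = q.2
    · simp only [hw, if_true, mul_one]
      rw [dotProduct_historyState U γ x (hγ _ p.1.2 _ q.1.2)]
      refine if_congr ?_ rfl rfl
      rw [Prod.ext_iff, Subtype.ext_iff]
      exact ⟨fun h => ⟨h, hw⟩, fun h => h.1⟩
    · rw [if_neg fun h => hw (congrArg Prod.snd h)]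
      simp [hw, dotProduct]
  refine le_trans (le_of_eq ?_) (bessel hon _)
  rw [Fintype.sum_prod_type, ← Finset.sum_coe_sort]
  refine Finset.sum_congr rfl fun j _ => Finset.sum_congr rfl fun w _ => ?_
  congr 2
  calc _ = star (extend (n + a') (η j w)) ⬝ᵥ Φ := by
        rw [hΦ, dotProduct_extend hW, hη, dotProduct_mul_ite]
        simp only [hφw]
    _ = star ((gatesOp G₂).mulVec (extend (n + a') (η j w))) ⬝ᵥ (gatesOp G₂).mulVec Φ :=
        (dotProduct_mulVec_unitary (gatesOp_unitary _) _ _).symm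
    _ = _ := by
        simp only [dotProduct, Pi.star_apply]
        refine Finset.sum_congr rfl fun v _ => ?_
        split_ifs with hv
        · rfl
        · rw [mulVec_extend, hG2, hpost j j.2 w _ ?_, star_zero, zero_mul, zero_mul]
          rwa [show (fun i : Fin n => splice (fun _ => false) v i) =
            fun i => v (Fin.castAdd a' i) from
              funext fun i => splice_val (fun _ => false) v (Fin.castAdd a' i)]

end success

/-! ### Clock transitions -/

section clockStep

variable {m : ℕ}

/-- The clock states that a transition from `S` to `S'` does not annihilate: those with ones on `S`
and zeros on `S' \ S`. -/
def StepDomain (S S' : Finset (Fin m)) (y : Bits m) : Prop :=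
  ∀ i, (i ∈ S → y i = true) ∧ (i ∈ S' → i ∉ S → y i = false)

/-- The bits in which `S` and `S'` differ are flipped. -/
def stepFlip (S S' : Finset (Fin m)) (y : Bits m) : Bits m :=
  fun i => xor (y i) (xor (decide (i ∈ S)) (decide (i ∈ S')))

theorem stepFlip_stepFlip (S S' : Finset (Fin m)) (y : Bits m) :
    stepFlip S S' (stepFlip S S' y) = y := by
  funext i
  simp only [stepFlip]
  cases y i <;> cases decide (i ∈ S) <;> cases decide (i ∈ S') <;> rfl

theorem stepFlip_comm (S S' : Finset (Fin m)) (y : Bits m) :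
    stepFlip S S' y = stepFlip S' S y := by
  funext i
  simp only [stepFlip]
  rw [Bool.xor_comm (decide (i ∈ S))]

theorem stepDomain_stepFlip (S S' : Finset (Fin m)) (y : Bits m) :
    StepDomain S S' (stepFlip S S' y) ↔ StepDomain S' S y := by
  refine forall_congr' fun i => ?_
  by_cases h : i ∈ S <;> by_cases h' : i ∈ S' <;> simp [stepFlip, h, h']

theorem stepDomain_stepFlip_swap (S S' : Finset (Fin m)) (y : Bits m) :
    StepDomain S' S (stepFlip S S' y) ↔ StepDomain S S' y := by
  rw [stepFlip_comm, stepDomain_stepFlip]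

theorem stepDomain_disjoint {S S' : Finset (Fin m)} (h : S ≠ S') {y : Bits m}
    (h1 : StepDomain S S' y) (h2 : StepDomain S' S y) : False := by
  refine h (Finset.ext fun i => ⟨fun hi => ?_, fun hi => ?_⟩)
  · by_contra hi'
    have := (h2 i).2 hi hi'
    rw [(h1 i).1 hi] at this
    exact Bool.noConfusion this
  · by_contra hi'
    have := (h1 i).2 hi hi'
    rw [(h2 i).1 hi] at this
    exact Bool.noConfusion this

open Classical in
theorem clockStep_apply (S S' : Finset (Fin m)) (x y : Bits m) :
    clockStep S S' x y = if StepDomain S S' y ∧ x = stepFlip S S' y then 1 else 0 := by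
  have h1 : ∀ i, (if i ∈ S then
      if i ∈ S' then Matrix.single true true (1 : ℂ) else Matrix.single false true 1
    else
      if i ∈ S' then Matrix.single true false 1 else 1) (x i) (y i) =
      if ((i ∈ S → y i = true) ∧ (i ∈ S' → i ∉ S → y i = false)) ∧ x i = stepFlip S S' y i
        then 1 else 0 := by
    intro i
    by_cases h : i ∈ S <;> by_cases h' : i ∈ S' <;> cases x i <;> cases hy : y i <;>
      simp [stepFlip, h, h', hy, Matrix.single_apply, Matrix.one_apply]
  rw [clockStep, Matrix.of_apply, Finset.prod_congr rfl fun i _ => h1 i]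
  have h2 : (StepDomain S S' y ∧ x = stepFlip S S' y) ↔ ∀ i, ((i ∈ S → y i = true) ∧
      (i ∈ S' → i ∉ S → y i = false)) ∧ x i = stepFlip S S' y i := by
    rw [StepDomain, funext_iff, ← forall_and]
  split_ifs with h
  · exact Finset.prod_eq_one fun i _ => if_pos (h2.1 h i)
  · rw [h2] at h
    push Not at h
    obtain ⟨i, hi⟩ := h
    exact Finset.prod_eq_zero (Finset.mem_univ i) (if_neg fun h => hi h.1 h.2)

theorem conjTranspose_clockStep (S S' : Finset (Fin m)) :
    (clockStep S S').conjTranspose = clockStep S' S := by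
  classical
  ext x y
  rw [Matrix.conjTranspose_apply, clockStep_apply, clockStep_apply, apply_ite star, star_one,
    star_zero]
  refine if_congr ?_ rfl rfl
  constructor
  · rintro ⟨h, rfl⟩
    rw [stepFlip_comm S' S, stepDomain_stepFlip_swap, stepFlip_stepFlip]
    exact ⟨h, rfl⟩
  · rintro ⟨h, rfl⟩
    rw [stepFlip_comm S' S, stepDomain_stepFlip, stepFlip_stepFlip]
    exact ⟨h, rfl⟩

theorem clockBits_stepFlip (S S' : Finset (Fin m)) : stepFlip S S' (clockBits S) = clockBits S' := by
  funext i
  simp only [stepFlip, clockBits]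
  cases decide (i ∈ S) <;> cases decide (i ∈ S') <;> rfl

/-- On the basis states of one Hamming weight, a transition from `S` to `S'` is the matrix unit
`|S'⟩⟨S|`. -/
theorem clockStep_clockBits {S S' R : Finset (Fin m)} (h : R.card = S.card) (x : Bits m) :
    clockStep S S' x (clockBits R) = if R = S ∧ x = clockBits S' then 1 else 0 := by
  classical
  rw [clockStep_apply]
  refine if_congr ?_ rfl rfl
  constructor
  · rintro ⟨h1, rfl⟩
    have h2 : S = R := Finset.eq_of_subset_of_card_le
      (fun i hi => by simpa [clockBits] using (h1 i).1 hi) h.le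
    subst h2
    exact ⟨rfl, clockBits_stepFlip _ _⟩
  · rintro ⟨rfl, rfl⟩
    refine ⟨fun i => ⟨fun hi => by simpa [clockBits] using hi,
      fun _ hi => by simpa [clockBits] using hi⟩, (clockBits_stepFlip _ _).symm⟩

end clockStep

/-! ### Locality -/

section locality

variable {N : ℕ}

/-- A criterion for an operator to act on `Q` only. -/
theorem actsOn_iff {Q : Finset (Fin N)} {h : QOp N} : ActsOn Q h ↔
    (∀ x y, (∃ i, i ∉ Q ∧ x i ≠ y i) → h x y = 0) ∧
    ∀ x y x' y', (∀ i ∉ Q, x i = y i) → (∀ i ∉ Q, x' i = y' i) →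
      (∀ i ∈ Q, x i = x' i) → (∀ i ∈ Q, y i = y' i) → h x y = h x' y' := by
  classical
  constructor
  · rintro ⟨u, rfl⟩
    refine ⟨?_, ?_⟩
    · rintro x y ⟨i, hi, hxy⟩
      rw [Matrix.of_apply, if_neg fun h => hxy (h i hi)]
    · intro x y x' y' h1 h2 h3 h4
      rw [Matrix.of_apply, Matrix.of_apply, if_pos h1, if_pos h2,
        show (fun i : Q => x i) = fun i : Q => x' i from funext fun i => h3 i i.2,
        show (fun i : Q => y i) = fun i : Q => y' i from funext fun i => h4 i i.2]
  · rintro ⟨h1, h2⟩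
    let ext : (Q → Bool) → Bits N := fun b i => if hi : i ∈ Q then b ⟨i, hi⟩ else false
    refine ⟨fun a b => h (ext a) (ext b), ?_⟩
    ext x y
    rw [Matrix.of_apply]
    split_ifs with hxy
    · refine h2 _ _ _ _ hxy (fun i hi => ?_) (fun i hi => ?_) fun i hi => ?_ <;> simp [ext, hi]
    · push Not at hxy
      exact h1 x y hxy

theorem ActsOn.add {Q : Finset (Fin N)} {h h' : QOp N} (hh : ActsOn Q h) (hh' : ActsOn Q h') :
    ActsOn Q (h + h') := by
  rw [actsOn_iff] at *
  refine ⟨fun x y hxy => ?_, fun x y x' y' h1 h2 h3 h4 => ?_⟩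
  · rw [Matrix.add_apply, hh.1 x y hxy, hh'.1 x y hxy, add_zero]
  · rw [Matrix.add_apply, Matrix.add_apply, hh.2 x y x' y' h1 h2 h3 h4,
      hh'.2 x y x' y' h1 h2 h3 h4]

theorem ActsOn.conjTranspose {Q : Finset (Fin N)} {h : QOp N} (hh : ActsOn Q h) :
    ActsOn Q h.conjTranspose := by
  rw [actsOn_iff] at *
  refine ⟨fun x y ⟨i, hi, hxy⟩ => ?_, fun x y x' y' h1 h2 h3 h4 => ?_⟩
  · rw [Matrix.conjTranspose_apply, hh.1 y x ⟨i, hi, hxy.symm⟩, star_zero]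
  · rw [Matrix.conjTranspose_apply, Matrix.conjTranspose_apply, hh.2 y x y' x'
      (fun i hi => (h1 i hi).symm) (fun i hi => (h2 i hi).symm) h4 h3]

theorem QGate.actsOn (g : QGate N) : ActsOn g.wires g.op := by
  rw [actsOn_iff]
  have hq : ∀ (q : Fin N) (u : Matrix Bool Bool ℂ),
      (∀ x y, (∃ i, i ∉ ({q} : Finset (Fin N)) ∧ x i ≠ y i) → onQubit q u x y = 0) ∧
      ∀ x y x' y', (∀ i ∉ ({q} : Finset (Fin N)), x i = y i) →
        (∀ i ∉ ({q} : Finset (Fin N)), x' i = y' i) →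
        (∀ i ∈ ({q} : Finset (Fin N)), x i = x' i) → (∀ i ∈ ({q} : Finset (Fin N)), y i = y' i) →
        onQubit q u x y = onQubit q u x' y' := by
    intro q u
    simp only [Finset.mem_singleton, forall_eq, onQubit, Matrix.of_apply]
    refine ⟨fun x y ⟨i, hi, hxy⟩ => if_neg fun h => hxy (h i hi), fun x y x' y' h1 h2 h3 h4 => ?_⟩
    rw [if_pos h1, if_pos h2, h3, h4]
  cases g with
  | had q => exact hq q _
  | tee q => exact hq q _
  | cnot c t hne =>
    simp only [op, wires, Matrix.of_apply, Finset.mem_insert, Finset.mem_singleton, not_or]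
    refine ⟨?_, ?_⟩
    · rintro x y ⟨i, ⟨-, hi⟩, hxy⟩
      refine if_neg fun h => hxy ?_
      rw [h, Function.update_of_ne hi]
    · intro x y x' y' h1 h2 h3 h4
      have key : ∀ x y : Bits N, (∀ i, ¬ i = c ∧ ¬ i = t → x i = y i) →
          (x = Function.update y t (xor (y t) (y c)) ↔ x c = y c ∧ x t = xor (y t) (y c)) := by
        intro x y h
        constructor
        · intro h'
          rw [h', Function.update_of_ne hne, Function.update_self]
          exact ⟨rfl, rfl⟩
        · rintro ⟨h5, h6⟩
          funext i
          by_cases hi : i = t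
          · subst hi; rw [Function.update_self, h6]
          · rw [Function.update_of_ne hi]
            by_cases hi' : i = c
            · rw [hi', h5]
            · exact h i ⟨hi', hi⟩
      refine if_congr ?_ rfl rfl
      rw [key x y h1, key x' y' h2, h3 c (Or.inl rfl), h3 t (Or.inr rfl), h4 c (Or.inl rfl),
        h4 t (Or.inr rfl)]

theorem card_wires_le (g : QGate N) : g.wires.card ≤ 2 := by
  cases g with
  | had q => simp [QGate.wires]
  | tee q => simp [QGate.wires]
  | cnot c t _ => exact Finset.card_le_two

theorem actsOn_clockStep {m : ℕ} (S S' : Finset (Fin m)) : ActsOn (S ∪ S') (clockStep S S') := by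
  classical
  rw [actsOn_iff]
  simp only [Finset.mem_union, not_or, clockStep_apply]
  refine ⟨?_, ?_⟩
  · rintro x y ⟨i, ⟨hi, hi'⟩, hxy⟩
    refine if_neg fun h => hxy ?_
    rw [h.2]
    simp [stepFlip, hi, hi']
  · intro x y x' y' h1 h2 h3 h4
    refine if_congr (and_congr ?_ ?_) rfl rfl
    · refine forall_congr' fun i => ?_
      by_cases h : i ∈ S <;> by_cases h' : i ∈ S' <;> simp [h, h', h4]
    · rw [funext_iff, funext_iff]
      refine forall_congr' fun i => ?_
      by_cases h : i ∈ S ∨ i ∈ S'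
      · rw [stepFlip, stepFlip, h3 i h, h4 i h]
      · rw [not_or] at h
        simp [stepFlip, h.1, h.2, h1 i h, h2 i h]

theorem ActsOn.tensorOp {n m : ℕ} {A : QOp n} {B : QOp m} {Q : Finset (Fin n)} {R : Finset (Fin m)}
    (hA : ActsOn Q A) (hB : ActsOn R B) :
    ActsOn (Q.map (Fin.castAddEmb m) ∪ R.map (Fin.natAddEmb n)) (tensorOp A B) := by
  rw [actsOn_iff] at *
  have m1 : ∀ i, Fin.castAdd m i ∈ Q.map (Fin.castAddEmb m) ∪ R.map (Fin.natAddEmb n) ↔ i ∈ Q := by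
    intro i
    simp only [Finset.mem_union, Finset.mem_map, Fin.castAddEmb_apply, Fin.natAddEmb_apply]
    constructor
    · rintro (⟨j, hj, h⟩ | ⟨j, hj, h⟩)
      · rwa [← Fin.castAdd_injective _ _ h]
      · have := congrArg Fin.val h; simp at this; omega
    · exact fun h => Or.inl ⟨i, h, rfl⟩
  have m2 : ∀ i, Fin.natAdd n i ∈ Q.map (Fin.castAddEmb m) ∪ R.map (Fin.natAddEmb n) ↔ i ∈ R := by
    intro i
    simp only [Finset.mem_union, Finset.mem_map, Fin.castAddEmb_apply, Fin.natAddEmb_apply]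
    constructor
    · rintro (⟨j, hj, h⟩ | ⟨j, hj, h⟩)
      · have := congrArg Fin.val h; simp at this; omega
      · rwa [← Fin.natAdd_injective _ _ h]
    · exact fun h => Or.inr ⟨i, h, rfl⟩
  refine ⟨?_, ?_⟩
  · rintro x y ⟨i, hi, hxy⟩
    rw [_root_.tensorOp, Matrix.of_apply]
    induction i using Fin.addCases with
    | left i => rw [hA.1 _ _ ⟨i, mt (m1 i).2 hi, hxy⟩, zero_mul]
    | right i => rw [hB.1 _ _ ⟨i, mt (m2 i).2 hi, hxy⟩, mul_zero]
  · intro x y x' y' h1 h2 h3 h4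
    rw [_root_.tensorOp, Matrix.of_apply, Matrix.of_apply]
    congr 1
    · exact hA.2 _ _ _ _ (fun i hi => h1 _ (mt (m1 i).1 hi)) (fun i hi => h2 _ (mt (m1 i).1 hi))
        (fun i hi => h3 _ ((m1 i).2 hi)) fun i hi => h4 _ ((m1 i).2 hi)
    · exact hB.2 _ _ _ _ (fun i hi => h1 _ (mt (m2 i).1 hi)) (fun i hi => h2 _ (mt (m2 i).1 hi))
        (fun i hi => h3 _ ((m2 i).2 hi)) fun i hi => h4 _ ((m2 i).2 hi)

theorem conjTranspose_tensorOp {n m : ℕ} (A : QOp n) (B : QOp m) :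
    (tensorOp A B).conjTranspose = tensorOp A.conjTranspose B.conjTranspose := by
  ext x y
  simp [tensorOp]

theorem tensorOp_mulVec {n m : ℕ} (A : QOp n) (B : QOp m) (f : Bits (n + m) → ℂ) (y : Bits n)
    (κ : Bits m) : (tensorOp A B).mulVec f (Fin.append y κ) =
      ∑ κ', B κ κ' * A.mulVec (fun y' => f (Fin.append y' κ')) y := by
  simp only [Matrix.mulVec, dotProduct]
  rw [sum_append, Finset.sum_comm]
  simp only [tensorOp, Matrix.of_apply, append_comp_castAdd, append_comp_natAdd, Finset.mul_sum]
  refine Finset.sum_congr rfl fun κ' _ => Finset.sum_congr rfl fun y' _ => ?_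
  ring

open Classical in
theorem tensorOp_clockStep_mulVec {n m : ℕ} (A : QOp n) (S S' : Finset (Fin m))
    (f : Bits (n + m) → ℂ) (y : Bits n) (κ : Bits m) :
    (tensorOp A (clockStep S S')).mulVec f (Fin.append y κ) = if StepDomain S' S κ then
      A.mulVec (fun y' => f (Fin.append y' (stepFlip S S' κ))) y else 0 := by
  rw [tensorOp_mulVec, Finset.sum_eq_single (stepFlip S S' κ)]
  · rw [clockStep_apply, stepFlip_stepFlip, stepDomain_stepFlip]
    split_ifs <;> simp_all
  · intro κ' _ h
    rw [clockStep_apply, if_neg, zero_mul]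
    rintro ⟨-, rfl⟩
    rw [stepFlip_stepFlip] at h
    exact h rfl
  · simp

theorem sum_norm_sq_unitary {n : ℕ} {A : QOp n} (hA : A ∈ Matrix.unitaryGroup (Bits n) ℂ)
    (f : Bits n → ℂ) : ∑ y, ‖A.mulVec f y‖ ^ 2 = ∑ y, ‖f y‖ ^ 2 := by
  have h : ∀ g : Bits n → ℂ, ((∑ y, ‖g y‖ ^ 2 : ℝ) : ℂ) = star g ⬝ᵥ g := by
    intro g
    simp only [dotProduct, Pi.star_apply, RCLike.star_def, Complex.conj_mul']
    push_cast
    rfl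
  exact_mod_cast (h _).trans ((dotProduct_mulVec_unitary hA f f).trans (h f).symm)

/-- The terms of the Hamiltonian exchange pairs of clock states while applying a unitary, so that
they have norm at most one. -/
theorem norm_hop_le {n m : ℕ} {A : QOp n} (hA : A ∈ Matrix.unitaryGroup (Bits n) ℂ)
    {S S' : Finset (Fin m)} (h : S ≠ S') : ‖Matrix.toEuclideanCLM (𝕜 := ℂ)
      (tensorOp A (clockStep S S') + (tensorOp A (clockStep S S')).conjTranspose)‖ ≤ 1 := by
  classical
  refine ContinuousLinearMap.opNorm_le_bound _ zero_le_one fun f => ?_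
  rw [one_mul]
  refine le_of_sq_le_sq ?_ (norm_nonneg _)
  rw [EuclideanSpace.norm_sq_eq, EuclideanSpace.norm_sq_eq, sum_append, sum_append,
    Finset.sum_comm, Finset.sum_comm (s := (Finset.univ : Finset (Bits n)))]
  have hflip : Function.Involutive (stepFlip S S') := stepFlip_stepFlip S S'
  rw [← Equiv.sum_comp hflip.toPerm fun κ => ∑ y, ‖f (Fin.append y κ)‖ ^ 2]
  refine Finset.sum_le_sum fun κ _ => ?_
  have hA' : A.conjTranspose ∈ Matrix.unitaryGroup (Bits n) ℂ := Unitary.star_mem hA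
  simp only [Matrix.ofLp_toEuclideanCLM, Matrix.add_mulVec, Pi.add_apply, conjTranspose_tensorOp,
    conjTranspose_clockStep, tensorOp_clockStep_mulVec, stepFlip_comm S' S]
  by_cases h1 : StepDomain S' S κ
  · have h2 : ¬ StepDomain S S' κ := fun h2 => stepDomain_disjoint h h2 h1
    simp only [if_pos h1, if_neg h2, add_zero]
    exact (sum_norm_sq_unitary hA _).le
  · by_cases h2 : StepDomain S S' κ
    · simp only [if_pos h2, if_neg h1, zero_add]
      exact (sum_norm_sq_unitary hA' _).le
    · simp only [if_neg h2, if_neg h1, add_zero, norm_zero]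
      rw [zero_pow two_ne_zero, Finset.sum_const_zero]
      positivity

/-- A term acts on at most two qubits of the computation and on the clock qubits in
`γ j ∪ γ (j + 1)`, a set of `k + 2` elements. -/
theorem isLocalHamiltonian_feynman {n m k : ℕ} (U : List (QGate n)) {γ : ℕ → Finset (Fin m)}
    (hγ : ∀ j ≤ U.length, (γ j).card = k + 1)
    (hγ' : ∀ j < U.length, (γ j ∩ γ (j + 1)).card = k) :
    IsLocalHamiltonian (k + 4) (feynmanHamiltonian U γ) := by
  refine ⟨U.length, _, rfl, fun j => ⟨?_, ?_, ?_⟩⟩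
  · exact Matrix.isHermitian_add_transpose_self _
  · refine norm_hop_le (QGate.op_unitary _) fun h => ?_
    have h1 := hγ' j j.2
    rw [← h, Finset.inter_self, hγ j j.2.le] at h1
    omega
  · refine ⟨_, ?_, ((QGate.actsOn _).tensorOp (actsOn_clockStep _ _)).add
      ((QGate.actsOn _).tensorOp (actsOn_clockStep _ _)).conjTranspose⟩
    refine (Finset.card_union_le _ _).trans ?_
    rw [Finset.card_map, Finset.card_map]
    have h1 := card_wires_le (U.get j)
    have h2 := Finset.card_union_add_card_inter (γ j) (γ (j + 1))
    rw [hγ j j.2.le, hγ (j + 1) j.2, hγ' j j.2] at h2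
    omega

end locality

/-! ### The evolution of the history state -/

section evolution

theorem hasDerivAt_dotProduct_exp {κ : Type} [Fintype κ] [DecidableEq κ] (H : Matrix κ κ ℂ)
    (v w : κ → ℂ) (u : ℝ) : HasDerivAt
      (fun u : ℝ => v ⬝ᵥ (NormedSpace.exp ((-(Complex.I * u)) • H)).mulVec w)
      (-Complex.I * (v ⬝ᵥ H.mulVec ((NormedSpace.exp ((-(Complex.I * u)) • H)).mulVec w))) u := by
  let _ : NormedRing (Matrix κ κ ℂ) := Matrix.linftyOpNormedRing
  let _ : NormedAlgebra ℝ (Matrix κ κ ℂ) := Matrix.linftyOpNormedAlgebra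
  let _ : NormedAlgebra ℂ (Matrix κ κ ℂ) := Matrix.linftyOpNormedAlgebra
  have e : ∀ u : ℝ, (-(Complex.I * u)) • H = u • ((-Complex.I) • H) := by
    intro u
    rw [← Complex.coe_smul, smul_smul]
    congr 1
    ring
  simp only [e]
  have h1 := hasDerivAt_exp_smul_const' ((-Complex.I) • H) u
  let ℓ : Matrix κ κ ℂ →ₗ[ℝ] ℂ :=
    { toFun := fun M => v ⬝ᵥ M.mulVec w
      map_add' := fun M M' => by rw [Matrix.add_mulVec, dotProduct_add]
      map_smul' := fun a M => by rw [Matrix.smul_mulVec, dotProduct_smul, RingHom.id_apply] }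
  have h2 := (LinearMap.toContinuousLinearMap ℓ).hasFDerivAt.comp_hasDerivAt u h1
  refine h2.congr_deriv ?_
  show v ⬝ᵥ ((-Complex.I) • H * _).mulVec w = _
  rw [Matrix.smul_mul, Matrix.smul_mulVec, dotProduct_smul, Matrix.mulVec_mulVec]
  rfl

theorem exp_mem_unitaryGroup {κ : Type} [Fintype κ] [DecidableEq κ] {H : Matrix κ κ ℂ}
    (hH : H.IsHermitian) (t : ℝ) :
    NormedSpace.exp ((-(Complex.I * t)) • H) ∈ Matrix.unitaryGroup κ ℂ := by
  rw [Matrix.mem_unitaryGroup_iff', Matrix.star_eq_conjTranspose, ← Matrix.exp_conjTranspose,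
    Matrix.conjTranspose_smul, hH.eq,
    show star (-(Complex.I * t)) • H = -((-(Complex.I * t)) • H) by
      rw [← neg_smul]; congr 1; simp,
    Matrix.exp_neg]
  exact Matrix.nonsing_inv_mul _ ((Matrix.isUnit_iff_isUnit_det _).1 (Matrix.isUnit_exp _))

variable {n m : ℕ}

/-- The product of a state and a clock state. -/
noncomputable def withClock (f : Bits n → ℂ) (R : Finset (Fin m)) : Bits (n + m) → ℂ := fun p =>
  f (fun i => p (Fin.castAdd m i)) * if (fun i => p (Fin.natAdd n i)) = clockBits R then 1 else 0

theorem withClock_append (f : Bits n → ℂ) (R : Finset (Fin m)) (y : Bits n) (κ : Bits m) :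
    withClock f R (Fin.append y κ) = f y * if κ = clockBits R then 1 else 0 := by
  rw [withClock, append_comp_castAdd, append_comp_natAdd]

theorem ext_append {f g : Bits (n + m) → ℂ}
    (h : ∀ y κ, f (Fin.append y κ) = g (Fin.append y κ)) : f = g := by
  funext p
  rw [← Fin.append_castAdd_natAdd (f := p)]
  exact h _ _

/-- On clock states of equal weight the transition `S → S'` is the matrix unit: the literal operator,
which ignores the other clock qubits, vanishes on all clock states of that weight but `S`. -/
theorem tensorOp_mulVec_withClock (A : QOp n) (f : Bits n → ℂ) {S S' R : Finset (Fin m)}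
    (h : R.card = S.card) : (tensorOp A (clockStep S S')).mulVec (withClock f R) =
      if R = S then withClock (A.mulVec f) S' else 0 := by
  refine ext_append fun y κ => ?_
  rw [tensorOp_mulVec, Finset.sum_eq_single (clockBits R)]
  · simp only [withClock_append, if_true, mul_one]
    rw [clockStep_clockBits h]
    by_cases h1 : R = S <;> by_cases h2 : κ = clockBits S' <;>
      simp [h1, h2, withClock_append]
  · intro κ' _ h'
    simp only [withClock_append, if_neg h', mul_zero]
    rw [show (fun _ : Bits n => (0 : ℂ)) = 0 from rfl, Matrix.mulVec_zero]
    simp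
  · simp

variable {U : List (QGate n)} {γ : ℕ → Finset (Fin m)} {k : ℕ}

theorem feynmanHamiltonian_isHermitian (U : List (QGate n)) (γ : ℕ → Finset (Fin m)) :
    (feynmanHamiltonian U γ).IsHermitian := by
  rw [Matrix.IsHermitian, feynmanHamiltonian, Matrix.conjTranspose_sum]
  exact Finset.sum_congr rfl fun j _ => Matrix.isHermitian_add_transpose_self _

/-- The Hamiltonian moves the history states along a path. -/
theorem feynmanHamiltonian_mulVec (hcard : ∀ j ≤ U.length, (γ j).card = k)
    (hinj : ∀ i ≤ U.length, ∀ j ≤ U.length, γ i = γ j → i = j) (x : Bits n) {j : ℕ}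
    (hj : j ≤ U.length) : (feynmanHamiltonian U γ).mulVec (historyState U γ x j) =
      (if j < U.length then historyState U γ x (j + 1) else 0) +
        if 1 ≤ j then historyState U γ x (j - 1) else 0 := by
  have e : ∀ j, historyState U γ x j =
    withClock ((gatesOp (U.take j)).mulVec (Pi.single x 1)) (γ j) := fun _ => rfl
  have htake : ∀ i (hi : i < U.length), gatesOp (U.take (i + 1)) =
      (U[i]).op * gatesOp (U.take i) := by
    intro i hi
    rw [List.take_succ_eq_append_getElem hi, gatesOp_append, gatesOp_singleton]
  rw [feynmanHamiltonian, Matrix.sum_mulVec]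
  simp only [Matrix.add_mulVec, conjTranspose_tensorOp, conjTranspose_clockStep]
  rw [Finset.sum_add_distrib]
  congr 1
  · have h1 : ∀ i : Fin U.length, (tensorOp (U.get i).op (clockStep (γ i) (γ (i + 1)))).mulVec
        (historyState U γ x j) = if j = i then historyState U γ x (i + 1) else 0 := by
      intro i
      rw [e, tensorOp_mulVec_withClock _ _ ((hcard j hj).trans (hcard i i.2.le).symm)]
      by_cases h : j = i
      · rw [if_pos h, if_pos (by rw [h]), e, htake i i.2, ← Matrix.mulVec_mulVec, h]
        rfl
      · rw [if_neg h, if_neg fun h' => h (hinj j hj i i.2.le h')]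
    rw [Finset.sum_congr rfl fun i _ => h1 i]
    split_ifs with h
    · rw [Finset.sum_eq_single ⟨j, h⟩ (fun i _ hi => if_neg fun h' => hi (Fin.ext h'.symm))
        (by simp), if_pos rfl]
    · exact Finset.sum_eq_zero fun i _ => if_neg (by have := i.2; omega)
  · have h1 : ∀ i : Fin U.length, (tensorOp (U.get i).op.conjTranspose
        (clockStep (γ (i + 1)) (γ i))).mulVec (historyState U γ x j) =
          if j = i + 1 then historyState U γ x i else 0 := by
      intro i
      rw [e, tensorOp_mulVec_withClock _ _ ((hcard j hj).trans (hcard (i + 1) i.2).symm)]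
      by_cases h : j = i + 1
      · rw [if_pos h, if_pos (by rw [h]), e, h, htake i i.2, Matrix.mulVec_mulVec, ← mul_assoc]
        have : (U.get i).op.conjTranspose * (U[(i : ℕ)]).op = 1 :=
          (Matrix.mem_unitaryGroup_iff').1 (QGate.op_unitary _)
        rw [this, one_mul]
      · rw [if_neg h, if_neg fun h' => h (hinj j hj (i + 1) i.2 h')]
    rw [Finset.sum_congr rfl fun i _ => h1 i]
    split_ifs with h
    · rw [Finset.sum_eq_single ⟨j - 1, by omega⟩
        (fun i _ hi => if_neg fun h' => hi (Fin.ext (by simp; omega))) (by simp),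
        if_pos (by simp; omega)]
    · exact Finset.sum_eq_zero fun i _ => if_neg (by omega)

/-- After time `t`, the clock shows at least `t / 4 - 1` with probability at least `1 / 3`. -/
theorem one_third_le_sum_history (hcard : ∀ j ≤ U.length, (γ j).card = k)
    (hinj : ∀ i ≤ U.length, ∀ j ≤ U.length, γ i = γ j → i = j) (x : Bits n) {t : ℝ}
    (ht : 2 * t ≤ U.length) :
    1 / 3 ≤ ∑ j ∈ Finset.range (U.length + 1) with t / 4 ≤ ((j : ℕ) : ℝ) + 1,
      ‖star (historyState U γ x j) ⬝ᵥ (NormedSpace.exp ((-(Complex.I * t)) •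
        feynmanHamiltonian U γ)).mulVec (historyState U γ x 0)‖ ^ 2 := by
  set H := feynmanHamiltonian U γ with hH
  set α : ℕ → ℝ → ℂ := fun j u => if j ≤ U.length then
    star (historyState U γ x j) ⬝ᵥ (NormedSpace.exp ((-(Complex.I * u)) • H)).mulVec
      (historyState U γ x 0) else 0 with hα
  have hα' : ∀ j ≤ U.length, ∀ u, HasDerivAt (α j)
      (-Complex.I * (α (j + 1) u + if 1 ≤ j then α (j - 1) u else 0)) u := by
    intro j hj u
    have h1 := hasDerivAt_dotProduct_exp H (star (historyState U γ x j)) (historyState U γ x 0) u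
    have h2 : α j = fun u : ℝ => star (historyState U γ x j) ⬝ᵥ
        (NormedSpace.exp ((-(Complex.I * u)) • H)).mulVec (historyState U γ x 0) := by
      funext u
      simp only [hα, if_pos hj]
    rw [h2]
    refine h1.congr_deriv ?_
    congr 1
    have h3 : ∀ w, star (historyState U γ x j) ⬝ᵥ H.mulVec w =
        star (H.mulVec (historyState U γ x j)) ⬝ᵥ w := by
      intro w
      rw [Matrix.dotProduct_mulVec, Matrix.star_mulVec,
        show H.conjTranspose = H from feynmanHamiltonian_isHermitian U γ]
    rw [h3, feynmanHamiltonian_mulVec hcard hinj x hj, star_add, add_dotProduct]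
    simp only [hα]
    congr 1
    · by_cases h : j < U.length
      · rw [if_pos h, if_pos (show j + 1 ≤ U.length from h)]
      · rw [if_neg h, if_neg (show ¬ j + 1 ≤ U.length from h), star_zero, zero_dotProduct]
    · by_cases h : 1 ≤ j
      · rw [if_pos h, if_pos h, if_pos (by omega)]
      · rw [if_neg h, if_neg h, star_zero, zero_dotProduct]
  -- the phases `i ^ j` make the amplitudes real
  set y : ℕ → ℝ → ℝ := fun j u => if 1 ≤ j then (Complex.I ^ (j - 1) * α (j - 1) u).re else 0
    with hy
  have hwalk : IsPathWalk (U.length + 1) y := by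
    refine ⟨fun u => rfl, fun u => ?_, fun j hj u => ?_⟩
    · simp [hy, hα]
    · have h1 := ((hα' j (by omega) u).const_mul (Complex.I ^ j))
      have h2 := (Complex.reCLM.hasFDerivAt.comp_hasDerivAt u h1)
      have h3 : y (j + 1) = fun u => (Complex.I ^ j * α j u).re := by
        funext u
        simp [hy]
      rw [h3]
      refine h2.congr_deriv ?_
      show (Complex.I ^ j * (-Complex.I * _)).re = _
      cases j with
      | zero => simp [hy]
      | succ j =>
        have h4 : Complex.I ^ (j + 1) * (-Complex.I * (α (j + 1 + 1) u +
            if 1 ≤ j + 1 then α (j + 1 - 1) u else 0)) = Complex.I ^ j * α j u -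
              Complex.I ^ (j + 2) * α (j + 2) u := by
          have hI : Complex.I ^ (j + 2) = -Complex.I ^ j := by rw [pow_add, Complex.I_sq]; ring
          rw [hI, if_pos (by omega), pow_succ]
          simp only [Nat.add_sub_cancel]
          linear_combination (-Complex.I ^ j * (α (j + 2) u + α j u)) * Complex.I_mul_I
        rw [h4, Complex.sub_re]
        simp [hy]
  have hα0 : ∀ j ≤ U.length, α j 0 = if j = 0 then 1 else 0 := by
    intro j hj
    simp only [hα, if_pos hj, Complex.ofReal_zero, mul_zero, neg_zero, zero_smul,
      NormedSpace.exp_zero, Matrix.one_mulVec]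
    exact dotProduct_historyState U γ x (hinj j hj 0 (Nat.zero_le _))
  have h1 : y 1 0 = 1 := by simp [hy, hα0]
  have h0 : ∀ j, 1 < j → j ≤ U.length + 1 → y j 0 = 0 := by
    intro j hj hj'
    simp only [hy, if_pos hj.le]
    rw [hα0 _ (by omega), if_neg (by omega), mul_zero, Complex.zero_re]
  have hmain : 1 / 3 ≤ ∑ j ∈ Finset.range (U.length + 1) with t / 4 ≤ ((j : ℕ) : ℝ) + 1,
      y (j + 1) t ^ 2 := by
    rcases le_or_gt 1 t with h | h
    · refine hwalk.escape ?_ h1 h0 h (by push_cast; linarith)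
      have : (2 : ℝ) ≤ U.length := by linarith
      have : 2 ≤ U.length := by exact_mod_cast this
      omega
    · rw [Finset.filter_true_of_mem fun j _ => by
        have : (0 : ℝ) ≤ (j : ℝ) := Nat.cast_nonneg j
        linarith, hwalk.sum_sq_eq, Finset.sum_range_succ', Finset.sum_eq_zero fun j hj => by
          rw [h0 _ (by omega) (by have := Finset.mem_range.1 hj; omega)]; norm_num, h1]
      norm_num
  refine hmain.trans (Finset.sum_le_sum fun j hj => ?_)
  have hj' := Finset.mem_range.1 (Finset.mem_filter.1 hj).1
  have h2 : y (j + 1) t = (Complex.I ^ j * α j t).re := by simp [hy]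
  have h3 : ‖Complex.I ^ j * α j t‖ = ‖α j t‖ := by simp
  have h4 : α j t = star (historyState U γ x j) ⬝ᵥ (NormedSpace.exp ((-(Complex.I * t)) •
        H)).mulVec (historyState U γ x 0) := by simp only [hα, if_pos (show j ≤ U.length by omega)]
  rw [← h4, ← h3, h2, ← sq_abs]
  exact pow_le_pow_left₀ (abs_nonneg _) (Complex.abs_re_le_norm _) 2

end evolution

open scoped ComplexOrder

/-! ### Trace distance -/

section traceDist

variable {κ : Type}

theorem pureState_isHermitian (ψ : κ → ℂ) : (pureState ψ).IsHermitian := by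
  rw [Matrix.IsHermitian, pureState, Matrix.conjTranspose_vecMulVec, star_star]

variable [Fintype κ]

theorem dotProduct_pureState (v ψ : κ → ℂ) :
    (star v ⬝ᵥ (pureState ψ).mulVec v).re = ‖star v ⬝ᵥ ψ‖ ^ 2 := by
  have h : (pureState ψ).mulVec v = (star ψ ⬝ᵥ v) • ψ := by
    funext i
    rw [pureState, Matrix.mulVec]
    simp only [Matrix.vecMulVec_apply, dotProduct, Pi.smul_apply, smul_eq_mul, Finset.sum_mul]
    exact Finset.sum_congr rfl fun j _ => by ring
  have h2 : star ψ ⬝ᵥ v = star (star v ⬝ᵥ ψ) := by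
    rw [Matrix.star_dotProduct, dotProduct_comm]
  rw [h, dotProduct_smul, smul_eq_mul, h2, RCLike.star_def, Complex.conj_mul']
  norm_cast

theorem trace_pureState (ψ : κ → ℂ) : (pureState ψ).trace = star ψ ⬝ᵥ ψ := by
  rw [Matrix.trace, dotProduct]
  exact Finset.sum_congr rfl fun i _ => mul_comm _ _

variable [DecidableEq κ]

/-- Orthonormal vectors see at most the trace of a positive matrix. -/
theorem sum_dotProduct_le_trace {ι : Type} [Fintype ι] [DecidableEq ι] {v : ι → κ → ℂ}
    (hv : ∀ i j, star (v i) ⬝ᵥ v j = if i = j then 1 else 0) {P : Matrix κ κ ℂ}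
    (hP : P.PosSemidef) : ∑ i, (star (v i) ⬝ᵥ P.mulVec (v i)).re ≤ P.trace.re := by
  obtain ⟨X, rfl⟩ := CStarAlgebra.nonneg_iff_eq_star_mul_self.1 hP.nonneg
  rw [Matrix.star_eq_conjTranspose]
  have h1 : ∀ i, (star (v i) ⬝ᵥ (X.conjTranspose * X).mulVec (v i)).re =
      ∑ r, ‖star (v i) ⬝ᵥ fun c => star (X r c)‖ ^ 2 := by
    intro i
    rw [← Matrix.mulVec_mulVec, Matrix.dotProduct_mulVec, ← Matrix.star_mulVec, dotProduct,
      Complex.re_sum]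
    refine Finset.sum_congr rfl fun r _ => ?_
    have h2 : (star (v i) ⬝ᵥ fun c => star (X r c)) = star (X.mulVec (v i) r) := by
      simp only [Matrix.mulVec, dotProduct, star_sum, star_mul', Pi.star_apply]
      exact Finset.sum_congr rfl fun c _ => mul_comm _ _
    rw [h2, norm_star, Pi.star_apply, RCLike.star_def, Complex.conj_mul']
    norm_cast
  have h2 : (X.conjTranspose * X).trace.re = ∑ r, ∑ c, ‖star (X r c)‖ ^ 2 := by
    rw [Matrix.trace, Complex.re_sum]
    simp only [Matrix.diag_apply, Matrix.mul_apply, Matrix.conjTranspose_apply]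
    rw [Finset.sum_comm]
    refine Finset.sum_congr rfl fun c _ => ?_
    rw [Complex.re_sum]
    refine Finset.sum_congr rfl fun r _ => ?_
    rw [RCLike.star_def, Complex.conj_mul', RCLike.norm_conj]
    norm_cast
  rw [h2, Finset.sum_congr rfl fun i _ => h1 i, Finset.sum_comm]
  exact Finset.sum_le_sum fun r _ => bessel hv fun c => star (X r c)

/-- The trace distance bounds the difference of the weights of two states in a subspace. -/
theorem sum_dotProduct_sub_le_traceDist {ι : Type} [Fintype ι] [DecidableEq ι] {v : ι → κ → ℂ}
    (hv : ∀ i j, star (v i) ⬝ᵥ v j = if i = j then 1 else 0) {ρ σ : Matrix κ κ ℂ}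
    (hρ : ρ.IsHermitian) (hσ : σ.IsHermitian) (htr : ρ.trace = σ.trace) :
    ∑ i, (star (v i) ⬝ᵥ σ.mulVec (v i)).re - ∑ i, (star (v i) ⬝ᵥ ρ.mulVec (v i)).re ≤
      traceDist ρ σ := by
  have hsa : IsSelfAdjoint (ρ - σ) := (hρ.sub hσ : (ρ - σ).IsHermitian)
  have h1 : (ρ - σ)⁺ - (ρ - σ)⁻ = ρ - σ := CFC.posPart_sub_negPart _ hsa
  have h2 : (ρ - σ)⁺ + (ρ - σ)⁻ = CFC.abs (ρ - σ) := CFC.posPart_add_negPart _ hsa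
  have hp : ((ρ - σ)⁺).PosSemidef := Matrix.nonneg_iff_posSemidef.1 (CFC.posPart_nonneg _)
  have hn : ((ρ - σ)⁻).PosSemidef := Matrix.nonneg_iff_posSemidef.1 (CFC.negPart_nonneg _)
  generalize (ρ - σ)⁺ = P at *
  generalize (ρ - σ)⁻ = M at *
  have h3 : P.trace = M.trace := by
    rw [← sub_eq_zero, ← Matrix.trace_sub, h1, Matrix.trace_sub, htr, sub_self]
  have h4 : traceDist ρ σ = M.trace.re := by
    rw [traceDist, ← h2, Matrix.trace_add, h3, Complex.add_re]
    ring
  rw [h4, ← Finset.sum_sub_distrib]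
  refine le_trans (Finset.sum_le_sum fun i _ => ?_) (sum_dotProduct_le_trace hv hn)
  have h5 : σ = ρ - P + M := by
    rw [← sub_sub_cancel ρ σ, ← h1]
    abel
  have h6 : 0 ≤ (star (v i) ⬝ᵥ P.mulVec (v i)).re := (Complex.nonneg_iff.1 (hp.dotProduct_mulVec_nonneg (v i))).1
  rw [h5, Matrix.add_mulVec, Matrix.sub_mulVec, dotProduct_add, dotProduct_sub, Complex.add_re,
    Complex.sub_re]
  linarith

end traceDist

section outputState

variable {N a : ℕ} (C : QCircuit (N + a)) (u : Bits N)

/-- The output state on a computational basis state is a mixture of pure states, one for each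
state of the ancillas. -/
theorem outputState_single : C.outputState (Pi.single u 1) =
    ∑ w : Bits a, pureState fun p => C.op (Fin.append p w) (Fin.append u fun _ => false) := by
  ext x y
  rw [Matrix.sum_apply, QCircuit.outputState, Matrix.of_apply]
  refine Finset.sum_congr rfl fun w _ => ?_
  have h : ∀ z, ∑ x, C.op z (Fin.append x fun _ => false) * (Pi.single u 1 : Bits N → ℂ) x =
      C.op z (Fin.append u fun _ => false) := by
    intro z
    simp [Pi.single_apply]
  show (∑ x', C.op (Fin.append x w) (Fin.append x' fun _ => false) * _) *
    star (∑ x', C.op (Fin.append y w) (Fin.append x' fun _ => false) * _) = _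
  rw [h, h]
  rfl

theorem isHermitian_outputState : (C.outputState (Pi.single u 1)).IsHermitian := by
  rw [outputState_single, Matrix.IsHermitian, Matrix.conjTranspose_sum]
  exact Finset.sum_congr rfl fun w _ => pureState_isHermitian _

theorem trace_outputState : (C.outputState (Pi.single u 1)).trace = 1 := by
  rw [outputState_single, Matrix.trace_sum]
  simp only [trace_pureState]
  have h1 := dotProduct_mulVec_unitary (gatesOp_unitary C.gates)
    (Pi.single (Fin.append u fun _ => false) 1) (Pi.single (Fin.append u fun _ => false) 1)
  rw [Matrix.mulVec_single_one] at h1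
  simp only [dotProduct] at h1 ⊢
  rw [sum_append, Finset.sum_comm] at h1
  refine Eq.trans ?_ (h1.trans (by simp [Pi.single_apply, apply_ite]))
  rfl

/-- A simulation of a Hamiltonian preserves the weights of orthonormal states up to its error. -/
theorem QCircuit.Simulates.sum_le {H : QOp N} (hH : H.IsHermitian) {t ε : ℝ} {C : QCircuit (N + a)}
    (h : C.Simulates H t ε) {ι : Type} [Fintype ι] [DecidableEq ι] {v : ι → Bits N → ℂ}
    (hv : ∀ i j, star (v i) ⬝ᵥ v j = if i = j then 1 else 0) (u : Bits N) :
    ∑ i, ‖star (v i) ⬝ᵥ (NormedSpace.exp ((-(Complex.I * t)) • H)).mulVec (Pi.single u 1)‖ ^ 2 ≤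
      ∑ i, ∑ w : Bits a, ‖star (v i) ⬝ᵥ fun p =>
        C.op (Fin.append p w) (Fin.append u fun _ => false)‖ ^ 2 + ε := by
  have h1 := h (Pi.single u 1) (by simp [Pi.single_apply, apply_ite])
  have h2 := sum_dotProduct_sub_le_traceDist hv (isHermitian_outputState C u)
    (pureState_isHermitian ((NormedSpace.exp ((-(Complex.I * t)) • H)).mulVec (Pi.single u 1))) (by
      rw [trace_outputState, trace_pureState, dotProduct_mulVec_unitary (exp_mem_unitaryGroup hH t)]
      simp)
  have h3 := h2.trans h1
  simp only [dotProduct_pureState] at h3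
  have h4 : ∀ i, (star (v i) ⬝ᵥ (C.outputState (Pi.single u 1)).mulVec (v i)).re =
      ∑ w : Bits a, ‖star (v i) ⬝ᵥ fun p =>
        C.op (Fin.append p w) (Fin.append u fun _ => false)‖ ^ 2 := by
    intro i
    rw [outputState_single, Matrix.sum_mulVec, dotProduct_sum, Complex.re_sum]
    simp only [dotProduct_pureState]
  simp only [h4] at h3
  linarith

end outputState

/-! ### Running the puzzle -/

section puzzle

variable {s : ℕ → ℕ} (F : IteratedFunction s) {n : ℕ}

/-- The circuit for `g` maps `|x⟩` to `|g(x)⟩`, up to a phase. -/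
theorem IteratedFunction.exists_circuit_mulVec (hn : 1 ≤ n) {x : Bits n} (hx : x ∈ F.X n) :
    ∃ α : ℂ, (gatesOp (F.circuit n).gates).mulVec (Pi.single x 1) =
      α • (Pi.single (F.g n x) 1 : Bits n → ℂ) := by
  set ψ := (gatesOp (F.circuit n).gates).mulVec (Pi.single x 1) with hψ
  have hψy : ∀ y, ψ y = (F.circuit n).op y x := fun y => by
    rw [hψ, Matrix.mulVec_single_one]; rfl
  have h1 : ∑ y, ‖ψ y‖ ^ 2 = 1 := by
    have h := dotProduct_mulVec_unitary (gatesOp_unitary (F.circuit n).gates) (Pi.single x 1)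
      (Pi.single x 1)
    rw [← hψ] at h
    simp only [dotProduct, Pi.star_apply, RCLike.star_def, Complex.conj_mul'] at h
    have h' : ((∑ y, ‖ψ y‖ ^ 2 : ℝ) : ℂ) = 1 := by
      push_cast
      rw [h]
      simp [Pi.single_apply, apply_ite]
    exact_mod_cast h'
  have h2 : ‖ψ (F.g n x)‖ ^ 2 = 1 := by rw [hψy]; exact F.circuit_computes n hn x hx
  rw [← Finset.add_sum_erase _ _ (Finset.mem_univ (F.g n x)), h2, add_eq_left,
    Finset.sum_eq_zero_iff_of_nonneg fun _ _ => sq_nonneg _] at h1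
  refine ⟨ψ (F.g n x), funext fun y => ?_⟩
  rw [Pi.smul_apply, Pi.single_apply, smul_eq_mul]
  split_ifs with hy
  · rw [hy, mul_one]
  · have := h1 y (Finset.mem_erase.2 ⟨hy, Finset.mem_univ y⟩)
    rw [mul_zero]
    exact norm_eq_zero.1 (pow_eq_zero_iff two_ne_zero |>.1 this)

/-- `r` runs of the circuit map `|x⟩` to `|f(r, x)⟩`, up to a phase. -/
theorem IteratedFunction.exists_iterGates_mulVec (hn : 1 ≤ n) (r : ℕ) {x : Bits n}
    (hx : x ∈ F.X n) : ∃ α : ℂ, (gatesOp (F.iterGates n r)).mulVec (Pi.single x 1) =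
      α • (Pi.single (F.f n r x) 1 : Bits n → ℂ) := by
  induction r generalizing x with
  | zero => exact ⟨1, by rw [one_smul]; exact Matrix.one_mulVec _⟩
  | succ r ih =>
    obtain ⟨α, hα⟩ := F.exists_circuit_mulVec hn hx
    obtain ⟨β, hβ⟩ := ih (F.g_mem n x hx)
    refine ⟨α * β, ?_⟩
    rw [iterGates, List.replicate_succ, List.flatten_cons, gatesOp_append, ← Matrix.mulVec_mulVec,
      hα, Matrix.mulVec_smul]
    rw [iterGates] at hβ
    rw [hβ, smul_smul]
    rfl

theorem IteratedFunction.length_iterGates (hn : 1 ≤ n) (r : ℕ) :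
    (F.iterGates n r).length = r * s n := by
  rw [iterGates, List.length_flatten, List.map_replicate, List.sum_replicate, smul_eq_mul]
  exact congrArg _ (F.circuit_size n hn)

end puzzle

theorem historyState_zero {n m : ℕ} (U : List (QGate n)) (γ : ℕ → Finset (Fin m)) (x : Bits n) :
    historyState U γ x 0 = Pi.single (Fin.append x (clockBits (γ 0))) 1 := by
  refine ext_append fun y κ => ?_
  rw [historyState_append, List.take_zero, show gatesOp ([] : List (QGate n)) = 1 from rfl,
    Matrix.one_mulVec]
  simp only [Pi.single_apply, append_eq_append_iff, ite_and]
  by_cases h : y = x <;> simp [h]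

/-! ### The circuit that breaks the puzzle -/

theorem mem_doorSet {k m j : ℕ} (i : Fin m) :
    i ∈ doorSet k m j ↔ i.1 ∈ (revolvingDoor k m).getD j [] := by
  simp [doorSet]

/-- An entry of the revolving-door path. -/
theorem getD_revolvingDoor {k m j : ℕ} (hj : j < m.choose k) :
    (revolvingDoor k m).getD j [] ∈ revolvingDoor k m := by
  have h : j < (revolvingDoor k m).length := by rwa [length_revolvingDoor]
  rw [List.getD_eq_getElem _ _ h]
  exact List.getElem_mem h

/-- Among the sets of the path, only `γ_j` is contained in `γ_j`. -/
theorem forall_mem_getD_revolvingDoor_iff {c m j l : ℕ} (hj : j < m.choose (c + 1))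
    (hl : l < m.choose (c + 1)) :
    (∀ u ≤ c, decide ((((revolvingDoor (c + 1) m).getD l []).getD u 0) ∈
      (revolvingDoor (c + 1) m).getD j []) = true) ↔ l = j := by
  obtain ⟨h1, h2, h3⟩ := of_mem_revolvingDoor (getD_revolvingDoor hl)
  constructor
  · intro h
    refine doorSet_injOn hl hj (Finset.eq_of_subset_of_card_le (fun i hi => ?_) ?_)
    · rw [mem_doorSet] at hi ⊢
      obtain ⟨u, hu, hui⟩ := List.getElem_of_mem hi
      have := h u (by omega)
      rwa [List.getD_eq_getElem _ _ hu, hui, decide_eq_true_eq] at this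
    · rw [card_doorSet hl, card_doorSet hj]
  · rintro rfl u hu
    have hu' : u < ((revolvingDoor (c + 1) m).getD l []).length := by omega
    rw [decide_eq_true_eq, List.getD_eq_getElem _ _ hu']
    exact List.getElem_mem _

/-- Clock states of equal weight are told apart by one-sided conjunctions: a `(c + 1)`-set that
contains the `l`-th one is the `l`-th one. -/
theorem RGate.takes_decodeLayers_revolvingDoor {n m N c s r j : ℕ} (hn : 1 ≤ n) (hN : n + m ≤ N)
    (hs : 1 ≤ s) (hpow : (r + 1) * (s * n) ≤ 2 ^ s) (hchoose : (r + 1) * s ≤ m.choose (c + 1))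
    (hj : j < (r + 1) * s) :
    RGate.Takes n N (N + n + (r + 1) * (s * n) * m + (c + 1) * ((r + 1) * (s * n)))
      (RGate.decodeLayers n m N c s (r + 1) (revolvingDoor (c + 1) m))
      (fun ζ => (∀ e < m, ζ (n + e) = decide (e ∈ (revolvingDoor (c + 1) m).getD j [])) ∧
        ∀ i, N + n ≤ i → ζ i = false)
      fun ζ => ∀ v < s * n, ζ (N + n + (r + 1) * (s * n) * m + c * ((r + 1) * (s * n)) + v) = true ↔
        v / n = j % s := by
  have hR : ∀ p < (r + 1) * (s * n), ∀ u ≤ c,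
      (((revolvingDoor (c + 1) m).getD (p / n) []).getD u 0) < m := by
    intro p hp u hu
    have hp' : p / n < m.choose (c + 1) := lt_of_lt_of_le
      ((Nat.div_lt_iff_lt_mul hn).2 (by rwa [Nat.mul_assoc])) hchoose
    obtain ⟨h1, h2, h3⟩ := of_mem_revolvingDoor (getD_revolvingDoor hp')
    rw [List.getD_eq_getElem _ _ (by omega)]
    exact h3 _ (List.getElem_mem _)
  exact RGate.takes_decodeLayers hn hN hs hpow hj hR
    (fun e => decide (e ∈ (revolvingDoor (c + 1) m).getD j []))
    fun l hl => forall_mem_getD_revolvingDoor_iff (by omega) (by omega)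

/-- Finding the clock state and completing the current run of the circuit takes every history
state to an iterate of `g`. -/
theorem run_finish_historyState {s : ℕ → ℕ} (F : IteratedFunction s) {n m a c r : ℕ} (hn : 1 ≤ n)
    (hs : 1 ≤ s n) (hpow : (r + 1) * (s n * n) ≤ 2 ^ s n)
    (hchoose : (r + 1) * s n ≤ m.choose (c + 1)) {j : ℕ} (hj : j ≤ r * s n) {x : Bits n}
    (hx : x ∈ F.X n) (w : Bits a) {z : ℕ → Bool}
    (hz : (fun i : Fin n => z i) ≠ F.f n (j / s n + 1) x) :
    RGate.run (RGate.decodeLayers n m (n + m + a) c (s n) (r + 1) (revolvingDoor (c + 1) m) ++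
        RGate.resumeLayers n (n + m + a) (n + m + a + n + (r + 1) * (s n * n) * m +
          c * ((r + 1) * (s n * n))) ((F.circuit n).gates.map QGate.raw)).flatten
      (emb (fun u : Bits (n + m + a) =>
        historyState (F.iterGates n r) (doorSet (c + 1) m) x j (fun i => u (Fin.castAdd a i)) *
          if (fun i => u (Fin.natAdd (n + m) i)) = w then 1 else 0)) z = 0 := by
  have hG : (F.circuit n).gates.length = s n := F.circuit_size n hn
  have hjQ : j < (r + 1) * s n := by nlinarith
  have htakes := RGate.takes_decodeLayers_revolvingDoor (N := n + m + a) hn (by omega) hs hpow hchoose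
    hjQ
  obtain ⟨ζ', hζ', hrun⟩ := htakes.2 (splice (fun _ => false)
    (Fin.append (Fin.append (fun _ : Fin n => false) (clockBits (doorSet (c + 1) m j))) w)) (by
      refine ⟨fun e he => ?_, fun i hi => splice_of_le _ _ (by omega)⟩
      rw [splice_of_lt _ _ (by omega), append_of_lt _ _ (show n + e < n + m by omega),
        append_of_le _ _ he]
      simp only [clockBits, mem_doorSet])
  rw [List.flatten_append, RGate.run_append, emb_historyState, hrun]
  obtain ⟨χ, hχ⟩ := RGate.run_resumeLayers (n := n) (N := n + m + a)
    (b := n + m + a + n + (r + 1) * (s n * n) * m + c * ((r + 1) * (s n * n))) (i₀ := j % s n)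
    (by omega) (by omega) (by rw [hG]; exact Nat.mod_lt _ hs)
    ((gatesOp ((F.iterGates n r).take j)).mulVec (Pi.single x 1))
    (Pi.single (fun _ => false) 1) ζ' hn (by rwa [hG])
  rw [hχ, Matrix.mulVec_mulVec, ← gatesOp_append]
  have hcat := take_append_drop_flatten_replicate (F.circuit n).gates (by omega) (r := r) (j := j)
    (by rwa [hG])
  rw [hG] at hcat
  obtain ⟨α, hα⟩ := F.exists_iterGates_mulVec hn (j / s n + 1) hx
  rw [IteratedFunction.iterGates] at hα ⊢
  rw [hcat, hα, tens, Pi.smul_apply, Pi.single_apply, if_neg hz]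
  simp

/-- A simulator on `n + m + a` qubits can be completed to a circuit that outputs iterates of `g`, at
least with the weight of the history states in the simulated state. -/
theorem exists_breaker {s : ℕ → ℕ} (F : IteratedFunction s) {n m a c r : ℕ} (hn : 1 ≤ n)
    (hs : 1 ≤ s n) (hpow : (r + 1) * (s n * n) ≤ 2 ^ s n)
    (hchoose : (r + 1) * s n ≤ m.choose (c + 1)) (C : QCircuit (n + m + a)) :
    ∃ (a' : ℕ) (C' : QCircuit (n + a')),
      n + a' = RGate.breakerWidth n m (n + m + a) c (r + 1) (s n) ∧
      C'.raw = RGate.breakerLayers n m (n + m + a) c (r + 1) (revolvingDoor (c + 1) m)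
        (F.circuit n).raw.flatten C.raw ∧
      ∀ x ∈ F.X n, ∀ J : Finset ℕ, (∀ j ∈ J, j ≤ r * s n) → ∀ S : Finset (Bits n),
        (∀ j ∈ J, F.f n (j / s n + 1) x ∈ S) →
        ∑ j ∈ J, ∑ w : Bits a, ‖star (historyState (F.iterGates n r) (doorSet (c + 1) m) x j) ⬝ᵥ
          fun p => C.op (Fin.append p w) (Fin.append
            (Fin.append x (clockBits (doorSet (c + 1) m 0))) fun _ => false)‖ ^ 2 ≤
          ∑ y ∈ S, C'.outputProb x y := by
  have hG : (F.circuit n).gates.length = s n := F.circuit_size n hn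
  have hpos : 1 ≤ (r + 1) * s n := Nat.mul_pos r.succ_pos hs
  obtain ⟨a', ha'⟩ : ∃ a', RGate.breakerWidth n m (n + m + a) c (r + 1) (s n) = n + a' :=
    ⟨_, (Nat.add_sub_of_le (by unfold RGate.breakerWidth; omega)).symm⟩
  have hW : n + m + a ≤ n + a' := by rw [← ha']; unfold RGate.breakerWidth; omega
  obtain ⟨h1, h2, h3⟩ := of_mem_revolvingDoor (getD_revolvingDoor (show 0 < m.choose (c + 1) by
    omega))
  have hpre : ∀ x : Bits n, _ := fun x =>
    run_invBlock_emb (a := a) h2 h3 (S := doorSet (c + 1) m 0) (fun e => mem_doorSet e) x hW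
  have hdecode : ∀ b ∈ RGate.decodeLayers n m (n + m + a) c (s n) (r + 1) (revolvingDoor (c + 1) m),
      RGate.ValidLayer (n + a') b := by
    rw [← ha']
    exact (RGate.takes_decodeLayers_revolvingDoor hn (by omega) hs hpow hchoose hpos).1
  obtain ⟨C', hC'⟩ := QCircuit.exists_raw_eq (N := n + a') (ls :=
    RGate.breakerLayers n m (n + m + a) c (r + 1) (revolvingDoor (c + 1) m)
      (F.circuit n).raw.flatten C.raw) (by
    intro l hl
    simp only [RGate.breakerLayers, List.mem_append] at hl
    rw [QCircuit.flatten_raw, List.length_map, hG] at hl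
    rcases hl with hl | hl | hl | hl
    · exact (hpre fun _ => false).1 l hl
    · exact (C.validLayer_raw hl).mono hW
    · exact hdecode l hl
    · refine RGate.validLayer_resumeLayers (by omega) (by omega) ?_ l hl
      rw [← ha', hG, RGate.breakerWidth]
      have : s n * n ≤ (r + 1) * (s n * n) := Nat.le_mul_of_pos_left _ r.succ_pos
      have : (c + 1) * ((r + 1) * (s n * n)) = c * ((r + 1) * (s n * n)) + (r + 1) * (s n * n) :=
        Nat.succ_mul _ _
      omega)
  refine ⟨a', C', ha'.symm, hC', fun x hx J hJ S hS => ?_⟩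
  refine sum_outputProb_ge (pre := _) (post := _) (C' := C') (by
    rw [hC', RGate.breakerLayers, List.flatten_append, List.flatten_append]) hW (hpre x).2 ?_ ?_
  · intro i hi j hj h
    have hi' := hJ i hi
    have hj' := hJ j hj
    exact doorSet_injOn (by nlinarith) (by nlinarith) h
  · intro j hj w z hz
    rw [QCircuit.flatten_raw, List.length_map, hG]
    exact run_finish_historyState F hn hs hpow hchoose (hJ j hj) hx w fun h => hz (h ▸ hS j hj)

/-- The completed circuit is deeper than the simulator only by `O(s(n))`. -/
theorem length_breakerLayers (n m N c Q : ℕ) (R : List (List ℕ)) (G : List RGate)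
    (B : List (List RGate)) : (RGate.breakerLayers n m N c Q R G B).length =
      B.length + 11 + 35 * c + 40 * G.length := by
  have h : ∀ l, (RGate.invBlock l).length = 6 := fun _ => rfl
  rw [RGate.breakerLayers, List.length_append, List.length_append, List.length_append, h,
    RGate.length_decodeLayers, RGate.length_resumeLayers]
  ring

/-! ### Growth rates -/

theorem Polynomial.exists_eval_le_pow (P : Polynomial ℕ) :
    ∃ e : ℕ, ∀ n : ℕ, 2 ≤ n → P.eval n ≤ n ^ e := by
  induction P using Polynomial.induction_on' with
  | add p q hp hq =>
    obtain ⟨e, he⟩ := hp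
    obtain ⟨e', he'⟩ := hq
    refine ⟨max e e' + 1, fun n hn => ?_⟩
    rw [Polynomial.eval_add, pow_succ]
    have h1 := (he n hn).trans (Nat.pow_le_pow_right (by omega) (le_max_left e e'))
    have h2 := (he' n hn).trans (Nat.pow_le_pow_right (by omega) (le_max_right e e'))
    nlinarith
  | monomial k a =>
    refine ⟨a + k, fun n hn => ?_⟩
    rw [Polynomial.eval_monomial, pow_add]
    exact Nat.mul_le_mul_right _ (Nat.lt_two_pow_self.le.trans (Nat.pow_le_pow_left hn a))

theorem subexponential_of_le_eval {k : ℕ → ℕ} (P : Polynomial ℕ) (h : ∀ n, k n ≤ P.eval n) :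
    Subexponential k := by
  obtain ⟨e, he⟩ := P.exists_eval_le_pow
  have hlog : (fun n : ℕ => Real.log n) =o[atTop] fun n : ℕ => (n : ℝ) :=
    Real.isLittleO_log_id_atTop.comp_tendsto tendsto_natCast_atTop_atTop
  refine Asymptotics.IsBigO.trans_isLittleO (Asymptotics.IsBigO.of_bound (e / Real.log 2) ?_) hlog
  filter_upwards [eventually_ge_atTop 2] with n hn
  have h2 : 0 < Real.log 2 := Real.log_pos one_lt_two
  have hn' : 0 ≤ Real.log n := Real.log_natCast_nonneg n
  have hk' : 0 ≤ Real.log (k n) := Real.log_natCast_nonneg _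
  rw [Real.logb, Real.norm_of_nonneg (by positivity), Real.norm_of_nonneg hn', div_mul_eq_mul_div]
  gcongr
  rcases Nat.eq_zero_or_pos (k n) with h0 | h0
  · rw [h0, Nat.cast_zero, Real.log_zero]
    positivity
  · rw [← Real.log_pow]
    refine Real.log_le_log (by exact_mod_cast h0) ?_
    exact_mod_cast (h n).trans (he n hn)

theorem eventually_eval_le_two_pow (P : Polynomial ℕ) : ∀ᶠ m : ℕ in atTop, P.eval m ≤ 2 ^ m := by
  obtain ⟨e, he⟩ := P.exists_eval_le_pow
  have h := (isLittleO_pow_const_const_pow_of_one_lt (R := ℝ) e one_lt_two).bound one_pos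
  filter_upwards [h, eventually_ge_atTop 2] with m hm hm2
  refine (he m hm2).trans ?_
  rw [one_mul, Real.norm_of_nonneg (by positivity), Real.norm_of_nonneg (by positivity)] at hm
  exact_mod_cast hm

/-- `s` rounds of doubling make the `(2T + 1)sn` copies of the clock register that are needed to
decode it. -/
theorem eventually_le_two_pow_size {s : ℕ → ℕ} (F : IteratedFunction s) (T : Polynomial ℕ) :
    ∀ᶠ n : ℕ in atTop, (2 * T.eval n + 1) * (s n * n) ≤ 2 ^ s n := by
  obtain ⟨a, ha, h⟩ := F.s_linear
  obtain ⟨K, hK⟩ := exists_nat_gt a⁻¹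
  set P : Polynomial ℕ := (2 * T.comp (Polynomial.C K * Polynomial.X) + 1) *
    (Polynomial.X * (Polynomial.C K * Polynomial.X)) with hP
  filter_upwards [h, (tendsto_size F).eventually (eventually_eval_le_two_pow P)] with n hn hn'
  have h1 : n ≤ K * s n := by
    have h2 : (n : ℝ) ≤ a⁻¹ * s n := by rwa [inv_mul_eq_div, le_div_iff₀ ha, mul_comm]
    have h3 : (n : ℝ) ≤ K * s n :=
      h2.trans (mul_le_mul_of_nonneg_right hK.le (Nat.cast_nonneg _))
    exact_mod_cast h3
  refine le_trans ?_ hn'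
  have h2 := T.eval_nat_mono h1
  simp only [hP, Polynomial.eval_mul, Polynomial.eval_add, Polynomial.eval_comp, Polynomial.eval_C,
    Polynomial.eval_X, Polynomial.eval_one, Polynomial.eval_ofNat] at h2 ⊢
  gcongr

/-! ### The lower bound -/

/-- The breaking circuit of an accurate simulator succeeds with probability at least `1/12`. -/
theorem one_twelfth_le_successProb {s : ℕ → ℕ} (F : IteratedFunction s) {n m a a' c r k : ℕ}
    (hn : 1 ≤ n) (hs : 1 ≤ s n) (hchoose : (r + 1) * s n ≤ m.choose (c + 1))
    (hX : (F.Xhat n).Nonempty) {C : QCircuit (n + m + a)} {C' : QCircuit (n + a')}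
    (hC' : ∀ x ∈ F.X n, ∀ J : Finset ℕ, (∀ j ∈ J, j ≤ r * s n) → ∀ S : Finset (Bits n),
      (∀ j ∈ J, F.f n (j / s n + 1) x ∈ S) →
      ∑ j ∈ J, ∑ w : Bits a, ‖star (historyState (F.iterGates n r) (doorSet (c + 1) m) x j) ⬝ᵥ
        fun p => C.op (Fin.append p w) (Fin.append
          (Fin.append x (clockBits (doorSet (c + 1) m 0))) fun _ => false)‖ ^ 2 ≤
        ∑ y ∈ S, C'.outputProb x y)
    {t ε : ℝ} (ht : 2 * t ≤ r * s n) (hk : (k : ℝ) ≤ t / (2 * s n)) (hε : ε < 1 / 4)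
    (hsim : C.Simulates (feynmanHamiltonian (F.iterGates n r) (doorSet (c + 1) m)) t ε) :
    1 / 12 ≤ F.successProb C' k (r + 1) := by
  classical
  have hlen := F.length_iterGates hn r
  have hlt : ∀ j ≤ r * s n, j < m.choose (c + 1) := fun j hj => by nlinarith
  have hinj : ∀ i ≤ r * s n, ∀ j ≤ r * s n,
      doorSet (c + 1) m i = doorSet (c + 1) m j → i = j := fun i hi j hj h =>
    doorSet_injOn (hlt i hi) (hlt j hj) h
  have hs' : (0 : ℝ) < s n := by exact_mod_cast hs
  rw [IteratedFunction.successProb, le_div_iff₀ (by exact_mod_cast hX.card_pos), mul_comm,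
    ← nsmul_eq_mul]
  refine Finset.card_nsmul_le_sum _ _ _ fun x hx => ?_
  have h1 := one_third_le_sum_history (U := F.iterGates n r) (γ := doorSet (c + 1) m) (k := c + 1)
    (fun j hj => card_doorSet (hlt j (hlen ▸ hj))) (by rwa [hlen]) x (t := t)
    (by rw [hlen]; exact_mod_cast ht)
  set J := (Finset.range ((F.iterGates n r).length + 1)).filter fun j : ℕ => t / 4 ≤ (j : ℝ) + 1
    with hJ
  have hJle : ∀ j ∈ J, j ≤ r * s n := fun j hj => by
    rw [hJ, Finset.mem_filter, Finset.mem_range, hlen] at hj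
    omega
  have h2 := hsim.sum_le (feynmanHamiltonian_isHermitian _ _) (ι := J)
    (v := fun j => historyState (F.iterGates n r) (doorSet (c + 1) m) x j) (fun i j => by
      rw [dotProduct_historyState _ _ _ (hinj _ (hJle _ i.2) _ (hJle _ j.2))]
      exact if_congr Subtype.ext_iff.symm rfl rfl)
    (Fin.append x (clockBits (doorSet (c + 1) m 0)))
  rw [← historyState_zero (F.iterGates n r)] at h2
  rw [Finset.sum_coe_sort J fun j => ‖star (historyState (F.iterGates n r) (doorSet (c + 1) m) x j) ⬝ᵥ
      (NormedSpace.exp (-(Complex.I * t) • feynmanHamiltonian (F.iterGates n r)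
        (doorSet (c + 1) m))).mulVec (historyState (F.iterGates n r) (doorSet (c + 1) m) x 0)‖ ^ 2,
    Finset.sum_coe_sort J fun j => ∑ w : Bits a,
      ‖star (historyState (F.iterGates n r) (doorSet (c + 1) m) x j) ⬝ᵥ fun p =>
        C.op (Fin.append p w) (Fin.append
          (Fin.append x (clockBits (doorSet (c + 1) m 0))) fun _ => false)‖ ^ 2] at h2
  have h3 := hC' x (F.Xhat_subset n hx) J hJle
    (Finset.univ.filter fun y => ∃ k' : ℕ, k ≤ 2 * k' ∧ k' ≤ r + 1 ∧ y = F.f n k' x) (by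
      intro j hj
      rw [Finset.mem_filter]
      refine ⟨Finset.mem_univ _, j / s n + 1, ?_, ?_, rfl⟩
      · -- `k ≤ t / 2s ≤ 2 (j + 1) / s ≤ 2 (⌊j / s⌋ + 1)`
        rw [hJ, Finset.mem_filter] at hj
        have h4 : j + 1 ≤ (j / s n + 1) * s n := by
          have := Nat.lt_div_mul_add (a := j) hs
          rw [Nat.succ_mul]
          omega
        have h5 : ((j : ℝ) + 1) ≤ ((j / s n + 1 : ℕ) : ℝ) * s n := by exact_mod_cast h4
        have h6 : (k : ℝ) ≤ 2 * ((j / s n + 1 : ℕ) : ℝ) := by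
          refine hk.trans ?_
          rw [div_le_iff₀ (by positivity)]
          linarith [hj.2]
        exact_mod_cast h6
      · have := Nat.div_le_of_le_mul (m := j) (k := s n) (n := r)
          (by rw [Nat.mul_comm]; exact hJle j hj)
        omega)
  refine le_trans ?_ h3
  linarith

theorem mainTheorem2 (s d : ℕ → ℕ) (F : IteratedFunction s) (hF : F.IsParallelHardPuzzle d)
    (T : Polynomial ℕ) (hT : T ≠ 0) (c : ℕ) (hc : 1 ≤ c) :
    ∃ (γ : ∀ n, ℕ → Finset (Fin (clockQubits s T c n)))
      (H : ∀ n, QOp (n + clockQubits s T c n)),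
      -- the clock, hence the Hamiltonian, is efficiently described
      PolyTimeGenerated (fun n => n + s n) (fun n => clockTree (clockLength s T n) (γ n)) ∧
      (∀ n, H n = feynmanHamiltonian (F.iterGates n (2 * T.eval n)) (γ n)) ∧
      (∀ᶠ n in atTop, IsJohnsonClock (c + 1) (clockLength s T n) (γ n) ∧
        IsLocalHamiltonian (c + 4) (H n)) ∧
      -- the depth lower bound
      ∃ A : ℝ, ∀ t ε : ℕ → ℝ,
        (∀ n, 0 ≤ t n ∧ t n ≤ s n * T.eval n) → (∀ n, ε n < 1 / 4) →
        ∀ (a : ℕ → ℕ) (C : ∀ n, QCircuit (n + clockQubits s T c n + a n)),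
          UniformFamily (fun n => n + s n + ⌊t n / (2 * s n)⌋₊ + d ⌊t n / (2 * s n)⌋₊) C →
          ∀ᶠ n in atTop, (C n).Simulates (H n) (t n) (ε n) →
            (d ⌊t n / (2 * s n)⌋₊ : ℝ) - A * s n ≤ (C n).depth := by
  -- the breaking circuit adds depth `11 + 35c + 40s`, at most `(51 + 35c)s` if `s ≥ 1`
  refine ⟨fun n => doorSet (c + 1) (clockQubits s T c n), fun n =>
    feynmanHamiltonian (F.iterGates n (2 * T.eval n)) (doorSet (c + 1) (clockQubits s T c n)),
    polyTimeGenerated_clockTree F T hc, fun _ => rfl, ?_, 51 + 35 * c, ?_⟩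
  · filter_upwards [eventually_le_choose F hT hc, (tendsto_size F).eventually_ge_atTop 1,
      eventually_ge_atTop 1] with n hch hs hn
    have hlt : clockLength s T n < (clockQubits s T c n).choose (c + 1) := by
      rw [clockLength]
      nlinarith
    have hlen : (F.iterGates n (2 * T.eval n)).length = clockLength s T n := by
      rw [F.length_iterGates hn, clockLength]
      ring
    refine ⟨isJohnsonClock_doorSet hlt, isLocalHamiltonian_feynman _ (fun j hj => ?_)
      fun j hj => ?_⟩
    · exact card_doorSet (by omega)
    · exact Nat.succ_injective (card_doorSet_inter (by omega))
  intro t ε ht hε a C hC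
  set k : ℕ → ℕ := fun n => ⌊t n / (2 * s n)⌋₊ with hk
  -- the breaking circuit; for the finitely many `n` without one, the empty circuit
  have hbreak : ∀ n, ∃ (a' : ℕ) (C' : QCircuit (n + a')), 1 ≤ n → 1 ≤ s n →
      (2 * T.eval n + 1) * (s n * n) ≤ 2 ^ s n →
      (2 * T.eval n + 1) * s n ≤ (clockQubits s T c n).choose (c + 1) →
      n + a' = RGate.breakerWidth n (clockQubits s T c n) (n + clockQubits s T c n + a n) c
        (2 * T.eval n + 1) (s n) ∧
      C'.raw = RGate.breakerLayers n (clockQubits s T c n) (n + clockQubits s T c n + a n) c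
        (2 * T.eval n + 1) (revolvingDoor (c + 1) (clockQubits s T c n))
        (F.circuit n).raw.flatten (C n).raw ∧
      ∀ x ∈ F.X n, ∀ J : Finset ℕ, (∀ j ∈ J, j ≤ 2 * T.eval n * s n) → ∀ S : Finset (Bits n),
        (∀ j ∈ J, F.f n (j / s n + 1) x ∈ S) →
        ∑ j ∈ J, ∑ w : Bits (a n), ‖star (historyState (F.iterGates n (2 * T.eval n))
            (doorSet (c + 1) (clockQubits s T c n)) x j) ⬝ᵥ fun p => (C n).op (Fin.append p w)
              (Fin.append (Fin.append x (clockBits (doorSet (c + 1) (clockQubits s T c n) 0)))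
                fun _ => false)‖ ^ 2 ≤
          ∑ y ∈ S, C'.outputProb x y := by
    intro n
    by_cases h : 1 ≤ n ∧ 1 ≤ s n ∧ (2 * T.eval n + 1) * (s n * n) ≤ 2 ^ s n ∧
      (2 * T.eval n + 1) * s n ≤ (clockQubits s T c n).choose (c + 1)
    · obtain ⟨a', C', h'⟩ := exists_breaker F h.1 h.2.1 h.2.2.1 h.2.2.2 (C n)
      exact ⟨a', C', fun _ _ _ _ => h'⟩
    · exact ⟨0, ⟨[], by simp⟩, fun h1 h2 h3 h4 => absurd ⟨h1, h2, h3, h4⟩ h⟩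
  choose a' C' hC' using hbreak
  have hgood : ∀ᶠ n in atTop, 1 ≤ n ∧ 1 ≤ s n ∧ (2 * T.eval n + 1) * (s n * n) ≤ 2 ^ s n ∧
      (2 * T.eval n + 1) * s n ≤ (clockQubits s T c n).choose (c + 1) := by
    filter_upwards [eventually_ge_atTop 1, (tendsto_size F).eventually_ge_atTop 1,
      eventually_le_two_pow_size F T, eventually_le_choose F hT hc] with n h1 h2 h3 h4
    exact ⟨h1, h2, h3, h4⟩
  have huniform : UniformFamily (fun n => n + s n + k n + d (k n)) C' := by
    refine PolyTimeGenerated.congr_eventually (.of_le fun n => by omega)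
      (gen_breaker F T c (.of_le fun n => by omega) hC) ?_
    filter_upwards [hgood] with n ⟨h1, h2, h3, h4⟩
    obtain ⟨h5, h6, -⟩ := hC' n h1 h2 h3 h4
    have hm : numClockQubits T c n (s n) = clockQubits s T c n := by
      rw [clockQubits_eq s T hc, numClockQubits, clockLength]
    rw [← QCircuit.tree_raw, h6, h5]
    simp only [length_raw F h1, hm]
  have hkT : ∀ n, t n / (2 * s n) ≤ T.eval n := fun n => by
    refine div_le_of_le_mul₀ (by positivity) (by positivity) ((ht n).2.trans ?_)
    have : (0 : ℝ) ≤ s n * T.eval n := by positivity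
    linarith
  have hsub : Subexponential k := subexponential_of_le_eval T fun n =>
    Nat.floor_le_of_le (hkT n)
  have hsubK : Subexponential fun n => 2 * T.eval n + 1 :=
    subexponential_of_le_eval (2 * T + 1) fun n => by simp
  obtain ⟨α, β, hα, -, hX⟩ := F.Xhat_card
  -- success with probability `1/12` contradicts the hardness with `e = 1` once `n ≥ 13`
  filter_upwards [hgood, hX, hF.2 k _ hsub hsubK a' C' huniform 1, eventually_ge_atTop 13] with
    n ⟨hn, hs, hpow, hch⟩ hX hhard hn' hsim
  obtain ⟨-, hraw, hsum⟩ := hC' n hn hs hpow hch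
  by_contra! hlt
  have hs' : (1 : ℝ) ≤ s n := by exact_mod_cast hs
  have hdepth : (C' n).depth = (C n).depth + 11 + 35 * c + 40 * s n := by
    have h : ∀ {N : ℕ} (D : QCircuit N), D.depth = D.raw.length := fun D =>
      (List.length_map _).symm
    rw [h, hraw, length_breakerLayers, length_raw F hn, ← h]
  have hdepth' : (C' n).depth < d (k n) := by
    rw [← Nat.cast_lt (α := ℝ), hdepth]
    push_cast
    nlinarith [mul_nonneg (Nat.cast_nonneg (α := ℝ) c) (sub_nonneg.2 hs')]
  have hXne : (F.Xhat n).Nonempty := by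
    rw [← Finset.card_pos, ← Nat.cast_pos (α := ℝ)]
    exact lt_of_lt_of_le (by positivity) hX.1
  have hsucc := one_twelfth_le_successProb F hn hs hch hXne hsum (t := t n) (k := k n)
    (by push_cast; linarith [(ht n).2])
    (Nat.floor_le (div_nonneg (ht n).1 (by positivity))) (hε n) hsim
  have h13 : (13 : ℝ) ≤ n := by exact_mod_cast hn'
  have hsmall : 1 / (n : ℝ) ^ 1 < 1 / 12 := by
    rw [pow_one]
    exact one_div_lt_one_div_of_lt (by norm_num) (by linarith)
  exact absurd (hhard hdepth') (by linarith)
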